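/- \textbf{Setting.} Let $m=2$, let $\lambda>1$ and $\boldsymbol\mu=(1,\mu_1,\mu_2)$ with $\mu_1,\mu_2>0$. Put $2\lambda_j=2\lambda-2+2j$ and $$d_\ell=\sum_{j=0}^{\ell}\binom{\ell}{j}^2\frac{(\ell-j)!}{(2\lambda_j)_{\ell-j}}\mu_j^2\quad(0\le \ell\le 2,\ \mu_0=1),\qquad \mathrm B=\mathrm{diag}(d_0,d_1,d_2),$$ where $(x)_n=x(x+1)\cdots(x+n-1)$. Let $\mathbb S$ be the $3\times3$ matrix (indices $0,1,2$) with $\mathbb S_{\ell p}=\ell\,\delta_{p+1,\ell}$, let $D(x)=\mathrm{diag}((1-x)^2,1-x,1)$, and for $z,w$ in the unit disc $\mathbb D$ let $$K^{(\lambda,\boldsymbol\mu)}(z,w)=(1-z\bar w)^{-2\lambda-2}D(z\bar w)\exp(\bar w\,\mathbb S)\,\mathrm B\,\exp(z\,\mathbb S^*)\,D(z\bar w).$$ Let $\mathbf A^{(\lambda,\boldsymbol\mu)}(\mathbb D)$ be the Hilbert space of $\mathbb C^3$-valued functions on $\mathbb D$ with reproducing kernel $K=K^{(\lambda,\boldsymbol\mu)}$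 and $M^{(\lambda,\boldsymbol\mu)}$ the operator $(Mf)(z)=zf(z)$ on it. Let $$\tilde K(z,w)=K(0,0)^{1/2}K(z,0)^{-1}K(z,w)K(0,w)^{-1}K(0,0)^{1/2},\quad \tilde h(z)=\tilde K(z,z)^{t},\quad \mathcal K_{\lambda,\boldsymbol\mu}(z)=\frac{\partial}{\partial\bar z}\Big(\tilde h^{-1}\frac{\partial}{\partial z}\tilde h\Big)(z).$$ The matrix $\mathcal K_{\lambda,\boldsymbol\mu}(z)$ is regarded as an operator on $\mathbb C^3$ with the inner product $\langle x,y\rangle=y^*\tilde h(z)x$; two such matrices are unitarily equivalent at $z$ if they are intertwined by a unitary between the corresponding two inner product spaces. A bounded operator $T$ is homogeneous if its spectrum lies in $\overline{\mathbb D}$ and $\varphi(T)$ is unitarily equivalent to $T$ for every biholomorphic automorphism $\varphi$ of $\mathbb D$; it is irreducible if it has no nontrivial reducing subspace. \textbf{Theorem.} Let $\delta_1,\delta_2,\delta_3>0$. (i) Suppose $\delta_1\ne\delta_2$ and $2(\delta_1+\delta_2)>\delta_3-6>\max\{2\delta_1-\delta_2,\,2\delta_2-\delta_1\}$. Then there are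 $(\lambda,\boldsymbol\mu)$ and $(\tilde\lambda,\tilde{\boldsymbol\mu})$ as above with $\mathcal K_{\lambda,\boldsymbol\mu}(0)=\mathrm{diag}(\delta_1,\delta_2,\delta_3)$ and $\mathcal K_{\tilde\lambda,\tilde{\boldsymbol\mu}}(0)=\mathrm{diag}(\delta_2,\delta_1,\delta_3)$. For all such $(\lambda,\boldsymbol\mu)$, $(\tilde\lambda,\tilde{\boldsymbol\mu})$ the kernels are positive semidefinite, the operators $M^{(\lambda,\boldsymbol\mu)}$ and $M^{(\tilde\lambda,\tilde{\boldsymbol\mu})}$ are bounded, homogeneous and irreducible, and they are not unitarily equivalent, although $\mathcal K_{\lambda,\boldsymbol\mu}(z)$ and $\mathcal K_{\tilde\lambda,\tilde{\boldsymbol\mu}}(z)$ are unitarily equivalent for every $z\in\mathbb D$. (ii) Suppose $\delta_3>\delta_2>3+\frac{\delta_3}{2}$ and $\delta_1<\min\{2\delta_3-\delta_2,\,2\delta_2-\delta_3\}-6$. Then there are $(\lambda,\boldsymbol\mu)$ and $(\widehat\lambda,\widehat{\boldsymbol\mu})$ as above with $\mathcal K_{\lambda,\boldsymbol\mu}(0)=\mathrm{diag}(\delta_1,\delta_2,\delta_3)$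 and $\mathcal K_{\widehat\lambda,\widehat{\boldsymbol\mu}}(0)=\mathrm{diag}(\delta_1,\delta_3,\delta_2)$. For all such $(\lambda,\boldsymbol\mu)$, $(\widehat\lambda,\widehat{\boldsymbol\mu})$ the kernels are positive semidefinite, the operators $M^{(\lambda,\boldsymbol\mu)}$ and $M^{(\widehat\lambda,\widehat{\boldsymbol\mu})}$ are bounded, homogeneous and irreducible, and they are not unitarily equivalent, although $\mathcal K_{\lambda,\boldsymbol\mu}(z)$ and $\mathcal K_{\widehat\lambda,\widehat{\boldsymbol\mu}}(z)$ are unitarily equivalent for every $z\in\mathbb D$. -/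

import Mathlib

open scoped Complex.UnitDisc ComplexConjugate Matrix Nat

noncomputable section

namespace KoranyiMisra

/-! ### The kernels `K^(lam, μ)` -/

/-- The parameters: `2 * lam > m`, `μ₀ = 1` and `μ_ℓ > 0` for all `ℓ`. -/
def Admissible (m : ℕ) (lam : ℝ) (μ : Fin (m + 1) → ℝ) : Prop :=
  (m : ℝ) < 2 * lam ∧ μ 0 = 1 ∧ ∀ l, 0 < μ l

/-- The lower triangular matrix with entries
`(ℓ choose j)² (ℓ - j)! / (2 lam_j)_{ℓ - j}` for `j ≤ ℓ`, where `2 lam_j = 2 lam - m + 2 j` and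
`(x)_n = x (x + 1) ⋯ (x + n - 1)`. -/
def matL (m : ℕ) (lam : ℝ) : Matrix (Fin (m + 1)) (Fin (m + 1)) ℝ :=
  Matrix.of fun l j =>
    if j ≤ l then
      ((l : ℕ).choose j : ℝ) ^ 2 * (((l : ℕ) - (j : ℕ))! : ℝ) /
        (ascPochhammer ℝ ((l : ℕ) - (j : ℕ))).eval (2 * lam - m + 2 * (j : ℕ))
    else 0

/-- The vector `d = L(lam) (μ₀², …, μ_m²)ᵗ`. -/
def vecD (m : ℕ) (lam : ℝ) (μ : Fin (m + 1) → ℝ) : Fin (m + 1) → ℝ :=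
  matL m lam *ᵥ fun j => μ j ^ 2

/-- `B = diag (d₀, …, d_m)`. -/
def matB (m : ℕ) (lam : ℝ) (μ : Fin (m + 1) → ℝ) : Matrix (Fin (m + 1)) (Fin (m + 1)) ℂ :=
  Matrix.diagonal fun l => (vecD m lam μ l : ℂ)

/-- `B^{1/2}`. -/
def sqrtB (m : ℕ) (lam : ℝ) (μ : Fin (m + 1) → ℝ) : Matrix (Fin (m + 1)) (Fin (m + 1)) ℂ :=
  Matrix.diagonal fun l => (Real.sqrt (vecD m lam μ l) : ℂ)

/-- The forward shift with weights `1, …, m`: the entry `(ℓ, p)` is `ℓ` if `p + 1 = ℓ`. -/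
def shift (m : ℕ) : Matrix (Fin (m + 1)) (Fin (m + 1)) ℂ :=
  Matrix.of fun l p => if (p : ℕ) + 1 = l then ((l : ℕ) : ℂ) else 0

/-- `D(x) = diag ((1 - x)^m, …, 1 - x, 1)`. -/
def matD (m : ℕ) (x : ℂ) : Matrix (Fin (m + 1)) (Fin (m + 1)) ℂ :=
  Matrix.diagonal fun l => (1 - x) ^ (m - (l : ℕ))

/-- `K^(lam, μ)(z, w) =
(1 - z w̄)^(-2 lam - m) D(z w̄) exp(w̄ S) B exp(z S*) D(z w̄)`,
with the principal branch of the power (`Re (1 - z w̄) > 0` on the disc). -/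
def kernel (m : ℕ) (lam : ℝ) (μ : Fin (m + 1) → ℝ) (z w : ℂ) :
    Matrix (Fin (m + 1)) (Fin (m + 1)) ℂ :=
  (1 - z * conj w) ^ (-2 * (lam : ℂ) - m) •
    (matD m (z * conj w) * NormedSpace.exp (conj w • shift m) * matB m lam μ *
      NormedSpace.exp (z • (shift m)ᴴ) * matD m (z * conj w))

/-- The normalization at the origin uses `K(0, 0) = B`. -/
lemma kernel_zero_zero (m : ℕ) (lam : ℝ) (μ : Fin (m + 1) → ℝ) :
    kernel m lam μ 0 0 = matB m lam μ := by
  simp [kernel, matD]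

/-! ### The curvature -/

/-- The Wirtinger derivative `∂f = (∂ₓ f - i ∂_y f) / 2`. -/
def wirtinger (f : ℂ → ℂ) (z : ℂ) : ℂ :=
  (fderiv ℝ f z 1 - Complex.I * fderiv ℝ f z Complex.I) / 2

/-- The Wirtinger derivative `∂̄f = (∂ₓ f + i ∂_y f) / 2`. -/
def wirtingerBar (f : ℂ → ℂ) (z : ℂ) : ℂ :=
  (fderiv ℝ f z 1 + Complex.I * fderiv ℝ f z Complex.I) / 2

/-- `∂F`, entry by entry, for a matrix-valued function. -/
def matWirtinger {n : Type*} (F : ℂ → Matrix n n ℂ) (z : ℂ) : Matrix n n ℂ :=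
  Matrix.of fun i j => wirtinger (fun u => F u i j) z

/-- `∂̄F`, entry by entry, for a matrix-valued function. -/
def matWirtingerBar {n : Type*} (F : ℂ → Matrix n n ℂ) (z : ℂ) : Matrix n n ℂ :=
  Matrix.of fun i j => wirtingerBar (fun u => F u i j) z

/-- The curvature `∂̄ (h⁻¹ ∂h)` of a Hermitian metric `h`. -/
def curvatureOf {n : Type*} [Fintype n] [DecidableEq n] (h : ℂ → Matrix n n ℂ) :
    ℂ → Matrix n n ℂ :=
  matWirtingerBar fun u => (h u)⁻¹ * matWirtinger h u

/-- The normalized kernel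
`K(0,0)^{1/2} K(z,0)⁻¹ K(z,w) K(0,w)⁻¹ K(0,0)^{1/2}`. -/
def normalizedKernel (m : ℕ) (lam : ℝ) (μ : Fin (m + 1) → ℝ) (z w : ℂ) :
    Matrix (Fin (m + 1)) (Fin (m + 1)) ℂ :=
  sqrtB m lam μ * (kernel m lam μ z 0)⁻¹ * kernel m lam μ z w * (kernel m lam μ 0 w)⁻¹ *
    sqrtB m lam μ

/-- The metric `h(z)`: the transpose of the normalized kernel at `(z, z)`. -/
def metric (m : ℕ) (lam : ℝ) (μ : Fin (m + 1) → ℝ) (z : ℂ) :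
    Matrix (Fin (m + 1)) (Fin (m + 1)) ℂ :=
  (normalizedKernel m lam μ z z)ᵀ

/-- The curvature of the metric `h`. -/
def curvature (m : ℕ) (lam : ℝ) (μ : Fin (m + 1) → ℝ) :
    ℂ → Matrix (Fin (m + 1)) (Fin (m + 1)) ℂ :=
  curvatureOf (metric m lam μ)

/-- Unitary equivalence of the endomorphism `A₁` of the fibre `(ℂⁿ, h₁)` and the endomorphism `A₂`
of the fibre `(ℂⁿ, h₂)`, where `(ℂⁿ, h)` carries the inner product `⟨x, y⟩ = y* h x`: there is a
unitary `U : (ℂⁿ, h₁) → (ℂⁿ, h₂)` (that is, `U` is invertible and `U* h₂ U = h₁`) with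
`U A₁ = A₂ U`. -/
def FibreUnitarilyEquivalent {n : Type*} [Fintype n] [DecidableEq n]
    (h₁ A₁ h₂ A₂ : Matrix n n ℂ) : Prop :=
  ∃ U : Matrix n n ℂ, IsUnit U ∧ Uᴴ * h₂ * U = h₁ ∧ U * A₁ = A₂ * U

/-! ### Operators on Hilbert spaces -/

/-- Unitary equivalence of bounded operators. -/
def UnitarilyEquivalent {H₁ H₂ : Type*}
    [NormedAddCommGroup H₁] [InnerProductSpace ℂ H₁]
    [NormedAddCommGroup H₂] [InnerProductSpace ℂ H₂]
    (T₁ : H₁ →L[ℂ] H₁) (T₂ : H₂ →L[ℂ] H₂) : Prop :=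
  ∃ U : H₁ ≃ₗᵢ[ℂ] H₂, ∀ x, U (T₁ x) = T₂ (U x)

/-- `T` is irreducible: no reducing subspaces other than `0` and `H`. -/
def IsIrreducibleOperator {H : Type*}
    [NormedAddCommGroup H] [InnerProductSpace ℂ H] [CompleteSpace H] (T : H →L[ℂ] H) : Prop :=
  ∀ P : H →L[ℂ] H, IsStarProjection P → Commute P T → P = 0 ∨ P = 1

/-- `T` is homogeneous: its spectrum lies in the closed unit disc, and `φ(T)` is unitarily
equivalent to `T` for every biholomorphic automorphism `φ(z) = c (z - a) / (1 - ā z)` of the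
unit disc (`|c| = 1`, `|a| < 1`). -/
def IsHomogeneousOperator {H : Type*}
    [NormedAddCommGroup H] [InnerProductSpace ℂ H] (T : H →L[ℂ] H) : Prop :=
  spectrum ℂ T ⊆ Metric.closedBall 0 1 ∧
    ∀ c a : ℂ, ‖c‖ = 1 → ‖a‖ < 1 →
      UnitarilyEquivalent (c • ((T - a • (1 : H →L[ℂ] H)) * Ring.inverse (1 - conj a • T))) T

/-! ### The Hilbert space and the multiplication operator -/

/-- The kernel `K^(lam, μ)` as an operator-valued kernel on the unit disc. -/
def kernelOp (m : ℕ) (lam : ℝ) (μ : Fin (m + 1) → ℝ) :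
    Matrix 𝔻 𝔻 (EuclideanSpace ℂ (Fin (m + 1)) →L[ℂ] EuclideanSpace ℂ (Fin (m + 1))) :=
  Matrix.of fun z w => Matrix.toEuclideanCLM (𝕜 := ℂ) (kernel m lam μ (z : ℂ) (w : ℂ))

/-- The Hilbert space of `ℂ^(m+1)`-valued functions on the unit disc with reproducing kernel
`K^(lam, μ)`. -/
abbrev Space (m : ℕ) (lam : ℝ) (μ : Fin (m + 1) → ℝ) [Fact (kernelOp m lam μ).PosSemidef] : Type :=
  RKHS.OfKernel (kernelOp m lam μ)

/-- `M` is the operator of multiplication by the coordinate function, `(M f)(z) = z f(z)`. -/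
def IsMultiplication (m : ℕ) (lam : ℝ) (μ : Fin (m + 1) → ℝ) [Fact (kernelOp m lam μ).PosSemidef]
    (M : Space m lam μ →L[ℂ] Space m lam μ) : Prop :=
  ∀ (f : Space m lam μ) (z : 𝔻), (M f) z = (z : ℂ) • f z

/-- The diagonal matrix `diag (x, y, t)` with real entries. -/
def diag3 (x y t : ℝ) : Matrix (Fin 3) (Fin 3) ℂ :=
  Matrix.diagonal ![(x : ℂ), (y : ℂ), (t : ℂ)]

end KoranyiMisra

end

/-!
The kernel `K = K^(lam, μ)` is the sum of the images of three weighted Bergman kernels under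
differential operators, `K(z, w) = ∑ₙ Aₙ(z) Aₙ(w)*` with explicit matrices of monomials
(`hasSum_columns`). Hence it is positive semidefinite, the constants belong to its Hilbert space,
and they are a cyclic set for the multiplication operator `M` (`exists_constants`). For small
`ε > 0` the kernel is `(1 - z w̄)^(-ε)` times a kernel of the same family, so that
`(1/ε - z w̄) K(z, w)` is again positive semidefinite, and `M` is bounded
(`exists_isMultiplication`).

*Homogeneity.* For every automorphism `φ` of the disc there is a holomorphic matrix function `J`
with `J(z) K(φ z, φ w) J(w)* = K(z, w)` (`kernel_moebius`). The weighted composition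
`f ↦ J (f ∘ φ)` is then unitary, and it intertwines `M` and `φ(M)`.

*Curvature.* The same identity exhibits the normalized metric near a point `a` as the pullback of
`z ↦ K(z, z)ᵗ` near `0`, up to a holomorphic change of frame. Therefore the curvature at `a` is
similar to a positive multiple, independent of the parameters, of the curvature at `0`
(`curvature_eq`). With `b = 2 lam`, the latter is the diagonal matrix with entries
`b - 2 - 1 / d₁`, `b + 1 / d₁ - 4 d₁ / d₂` and `b + 2 + 4 d₁ / d₂` (`curvature_zero`). The change
of frame is an isometry between the metrics at `a` and at `0`. So the curvatures for two
parameters are unitarily equivalent at every point as soon as these entries agree up to a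
permutation (`fibreUnitarilyEquivalent_of_perm`). Parameters with prescribed entries are found by
solving for `b`, `d₁`, `d₂` and then for `μ₁²`, `μ₂²`; the hypotheses on the `δᵢ` are what makes
these squares positive (`exists_admissible_of_curvature`).

*Irreducibility and inequivalence.* Since the constants are cyclic, an operator intertwining two
of the multiplication operators is the multiplication by a matrix function
(`exists_matrix_of_intertwines`). If it is a projection commuting with `M`, or a unitary
equivalence for two parameters with the same `lam`, then it amounts to a constant matrix `X` with
`X T = T' X`, where `T(z, w) = K(z, 0)⁻¹ K(z, w) K(0, w)⁻¹ K(0, 0)` is taken without its scalar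
factor. Averaging over the rotations separates the entries of this relation
(`apply_mul_reducedKernel`). Up to a common shift, the coefficient of `|z|²` in the `i`-th
diagonal entry of `T` is the `i`-th curvature eigenvalue, so `Xᵢⱼ = 0` unless the `j`-th
eigenvalue for `T` is the `i`-th one for `T'`. Moreover `X₀₀ T₀₂ = T'₀₂ X₂₂`, where `T₀₂` and
`T'₀₂` do not vanish identically. For a single kernel with distinct eigenvalues this forces `X` to
be a scalar, and `M` is irreducible. For two parameters whose eigenvalues differ by the
transposition of the first two, or of the last two, `X` can only be nonzero at the places of the
corresponding permutation matrix; the one of `X₀₀`, `X₂₂` which this allows vanishes together with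
the other, and `X` has a zero row. Such parameters have the same `lam`, which is determined by the
trace of the curvature at the origin, so the two operators are not unitarily equivalent.
-/

noncomputable section

namespace RKHS

/-! ### Feature maps and operators on reproducing kernel Hilbert spaces -/

section Generic

variable {X V H H₁ : Type*}
  [NormedAddCommGroup V] [InnerProductSpace ℂ V]
  [NormedAddCommGroup H₁] [InnerProductSpace ℂ H₁]

/-- The finite combinations `∑ e x v` of a family of linear maps `e x`. -/
def comb (e : X → V →L[ℂ] H₁) : (X →₀ V) →ₗ[ℂ] H₁ :=
  Finsupp.lsum ℂ fun x => (e x : V →ₗ[ℂ] H₁)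

lemma comb_single (e : X → V →L[ℂ] H₁) (x : X) (v : V) :
    comb e (Finsupp.single x v) = e x v := by
  simp [comb]

lemma norm_sq_comb (e : X → V →L[ℂ] H₁) (f : X →₀ V) :
    ‖comb e f‖ ^ 2 =
      (∑ x ∈ f.support, ∑ y ∈ f.support, inner ℂ (e x (f x)) (e y (f y))).re := by
  have : comb e f = ∑ x ∈ f.support, e x (f x) := by simp [comb, Finsupp.sum]
  rw [this, ← inner_self_eq_norm_sq (𝕜 := ℂ), sum_inner]
  simp_rw [inner_sum]
  rfl

variable [CompleteSpace V] [CompleteSpace H₁]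
  [NormedAddCommGroup H] [InnerProductSpace ℂ H] [CompleteSpace H] [RKHS ℂ H X V]

variable (H) in
lemma denseRange_comb_kerFun : DenseRange (comb (kerFun (𝕜 := ℂ) (X := X) (V := V) H)) := by
  have h := kerFun_dense (𝕜 := ℂ) (X := X) (V := V) H
  rw [← Submodule.dense_iff_topologicalClosure_eq_top] at h
  refine h.mono ?_
  rw [← LinearMap.coe_range]
  refine SetLike.coe_subset_coe.mpr (Submodule.span_le.mpr ?_)
  rintro _ ⟨x, v, rfl⟩
  exact ⟨Finsupp.single x v, comb_single _ x v⟩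

/-- A family `e x : V → H₁` which is dominated by the kernel functions of `H` defines a bounded
operator `f ↦ (x ↦ (e x)† f)` from `H₁` to `H`; it is the adjoint of the extension of
`K(·, x) v ↦ e x v`. -/
theorem exists_adjoint_feature (e : X → V →L[ℂ] H₁) (C : ℝ)
    (h : ∀ f : X →₀ V, ‖comb e f‖ ≤ C * ‖comb (kerFun H) f‖) :
    ∃ T : H₁ →L[ℂ] H, (∀ f x, T f x = (e x).adjoint f) ∧
      (∀ x v, T.adjoint (kerFun H x v) = e x v) ∧ ∀ f, ‖T.adjoint f‖ ≤ C * ‖f‖ := by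
  have hd := denseRange_comb_kerFun (X := X) (V := V) H
  let S : H →L[ℂ] H₁ := (comb e).extendOfNorm (comb (kerFun H))
  have hS : ∀ x v, S (kerFun H x v) = e x v := fun x v => by
    have := LinearMap.extendOfNorm_eq hd ⟨C, h⟩ (Finsupp.single x v)
    rwa [comb_single, comb_single] at this
  refine ⟨S.adjoint, fun f x => ?_, fun x v => ?_, fun f => ?_⟩
  · refine ext_inner_left ℂ fun v => ?_
    rw [← kerFun_inner, ContinuousLinearMap.adjoint_inner_right, hS,
      ContinuousLinearMap.adjoint_inner_right]
  · rw [ContinuousLinearMap.adjoint_adjoint, hS]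
  · rw [ContinuousLinearMap.adjoint_adjoint]
    exact LinearMap.norm_extendOfNorm_apply_le hd C h f

/-- If the kernel of `H` factors as `K(x, y) = (e x)† (e y)`, then `f ↦ (x ↦ (e x)† f)` is a
coisometry onto `H`. -/
theorem exists_coisometry_feature (e : X → V →L[ℂ] H₁)
    (h : ∀ x y v, (e x).adjoint (e y v) = kernel H x y v) :
    ∃ T : H₁ →L[ℂ] H, (∀ f x, T f x = (e x).adjoint f) ∧ ∀ f, T (T.adjoint f) = f := by
  have hn : ∀ f : X →₀ V, ‖comb e f‖ = ‖comb (kerFun H) f‖ := fun f => by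
    have : ‖comb e f‖ ^ 2 = ‖comb (kerFun H) f‖ ^ 2 := by
      rw [norm_sq_comb, norm_sq_comb]
      simp_rw [← kernel_inner, ← h, ContinuousLinearMap.adjoint_inner_left]
    exact (sq_eq_sq₀ (norm_nonneg _) (norm_nonneg _)).mp this
  obtain ⟨T, hT, hT', -⟩ := exists_adjoint_feature (H := H) e 1 (by simp [hn])
  refine ⟨T, hT, ?_⟩
  refine (denseRange_comb_kerFun (X := X) (V := V) H).induction ?_
    (isClosed_eq (by fun_prop) continuous_id)
  rintro _ ⟨f, rfl⟩
  induction f using Finsupp.induction_linear with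
  | zero => simp
  | add f g hf hg => simp only [map_add, hf, hg]
  | single x v =>
    rw [comb_single, hT']
    ext y
    rw [hT, h, kerFun_apply]

/-- A kernel of the form `K(x, y) = (e x)† (e y)` is positive semidefinite. -/
theorem posSemidef_of_feature {K : Matrix X X (V →L[ℂ] V)} (e : X → V →L[ℂ] H₁)
    (h : ∀ x y v, (e x).adjoint (e y v) = K x y v) : K.PosSemidef := by
  have htfae := (posSemidef_tfae (K := K)).out 0 2
  refine htfae.mpr ⟨?_, fun f => ?_⟩
  · ext x y v
    refine ext_inner_right ℂ fun w => ?_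
    rw [Matrix.conjTranspose_apply, ContinuousLinearMap.star_eq_adjoint,
      ContinuousLinearMap.adjoint_inner_left, ← h, ← h,
      ContinuousLinearMap.adjoint_inner_left, ContinuousLinearMap.adjoint_inner_right]
  -- the quadratic form of the kernel at `f` is the squared norm of `comb e f`
  · have := norm_sq_comb e f
    simp only [Finsupp.sum]
    simp_rw [← h, ContinuousLinearMap.adjoint_inner_left]
    exact (sq_nonneg _).trans_eq this

/-- Weighted composition operators: if `J(x) K(ψ x, ψ y) J(y)† = K(x, y)` and `ψ` is a bijection
then `f ↦ (x ↦ J(x) f(ψ x))` is unitary. -/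
theorem exists_weighted_composition (ψ : X ≃ X) (J : X → V ≃L[ℂ] V)
    (h : ∀ x y, (J x : V →L[ℂ] V) ∘L kernel H (ψ x) (ψ y) ∘L (J y : V →L[ℂ] V).adjoint =
      kernel H x y) :
    ∃ U : H ≃ₗᵢ[ℂ] H, ∀ f x, U f x = J x (f (ψ x)) := by
  let e : X → V →L[ℂ] H := fun x => kerFun H (ψ x) ∘L (J x : V →L[ℂ] V).adjoint
  have he : ∀ x y v, (e x).adjoint (e y v) = kernel H x y v := fun x y v => by
    rw [← h]
    simp [e, ContinuousLinearMap.adjoint_comp, kernel_apply, -adjoint_kerFun]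
  obtain ⟨T, hT, hTT⟩ := exists_coisometry_feature (H := H) e he
  have hTx : ∀ f x, T f x = J x (f (ψ x)) := fun f x => by
    rw [hT]
    simp [e, ContinuousLinearMap.adjoint_comp]
  have hinj : Function.Injective T := by
    refine (injective_iff_map_eq_zero _).mpr fun f hf => ?_
    ext x
    have := hTx f (ψ.symm x)
    rw [hf] at this
    simpa using this.symm
  have hT'T : ∀ f, T.adjoint (T f) = f := fun f => hinj (hTT (T f))
  let E : H ≃ₗ[ℂ] H := LinearEquiv.ofBijective (T : H →ₗ[ℂ] H)
    ⟨hinj, fun f => ⟨_, hTT f⟩⟩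
  refine ⟨⟨E, fun f => ?_⟩, fun f x => hTx f x⟩
  have : ‖T f‖ ^ 2 = ‖f‖ ^ 2 := by
    rw [← inner_self_eq_norm_sq (𝕜 := ℂ), ← inner_self_eq_norm_sq (𝕜 := ℂ),
      ← ContinuousLinearMap.adjoint_inner_right, hT'T]
  exact (sq_eq_sq₀ (norm_nonneg _) (norm_nonneg _)).mp this

end Generic

end RKHS

namespace RKHS

/-! ### Matrix kernels given by series -/

section MatrixSeries

variable {X ι : Type*} [Fintype ι] [DecidableEq ι]

lemma toEuclideanCLM_adjoint (A : Matrix ι ι ℂ) :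
    (Matrix.toEuclideanCLM (𝕜 := ℂ) A).adjoint = Matrix.toEuclideanCLM (𝕜 := ℂ) Aᴴ := by
  rw [← ContinuousLinearMap.star_eq_adjoint, ← map_star, Matrix.star_eq_conjTranspose]

lemma inner_toEuclideanCLM_eq_sum (A : Matrix ι ι ℂ) (v w : EuclideanSpace ℂ ι) :
    inner ℂ v (Matrix.toEuclideanCLM (𝕜 := ℂ) A w) = ∑ i, ∑ j, conj (v i) * A i j * w j := by
  rw [PiLp.inner_apply]
  refine Finset.sum_congr rfl fun i _ => ?_
  rw [Matrix.ofLp_toEuclideanCLM, Matrix.mulVec, dotProduct, RCLike.inner_apply, Finset.sum_mul]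
  exact Finset.sum_congr rfl fun j _ => by ring

lemma hasSum_inner_toEuclideanCLM {B : ℕ → Matrix ι ι ℂ} {K : Matrix ι ι ℂ}
    (h : ∀ i j, HasSum (fun n => B n i j) (K i j)) (v w : EuclideanSpace ℂ ι) :
    HasSum (fun n => inner ℂ v (Matrix.toEuclideanCLM (𝕜 := ℂ) (B n) w))
      (inner ℂ v (Matrix.toEuclideanCLM (𝕜 := ℂ) K w)) := by
  simp_rw [inner_toEuclideanCLM_eq_sum]
  exact hasSum_sum fun i _ => hasSum_sum fun j _ => ((h i j).mul_left _).mul_right _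

/-- A matrix kernel given by a convergent series `∑ₙ Aₙ(x) Aₙ(y)*` factors through the Hilbert
space `ℓ²(ℕ, ℂ^ι)`. -/
theorem exists_feature_of_hasSum (A : ℕ → X → Matrix ι ι ℂ) (K : X → X → Matrix ι ι ℂ)
    (h : ∀ x y i j, HasSum (fun n => (A n x * (A n y)ᴴ) i j) (K x y i j)) :
    ∃ e : X → EuclideanSpace ℂ ι →L[ℂ] lp (fun _ : ℕ => EuclideanSpace ℂ ι) 2,
      (∀ x y v, (e x).adjoint (e y v) = Matrix.toEuclideanCLM (𝕜 := ℂ) (K x y) v) ∧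
      ∀ x n v, (e x).adjoint (lp.single 2 n v) = Matrix.toEuclideanCLM (𝕜 := ℂ) (A n x) v := by
  -- `∑ₙ ‖Aₙ(x)* v‖² = ⟪v, K(x, x) v⟫` converges, so `n ↦ Aₙ(x)* v` is square summable
  have hmem : ∀ x (v : EuclideanSpace ℂ ι),
      Memℓp (fun n => Matrix.toEuclideanCLM (𝕜 := ℂ) (A n x)ᴴ v) 2 := fun x v => by
    refine memℓp_gen ?_
    have := (hasSum_inner_toEuclideanCLM (h x x) v v).summable
    have h2 := (Complex.reCLM.hasSum this.hasSum).summable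
    refine h2.congr fun n => ?_
    rw [map_mul, mul_apply_eq_comp, ← ContinuousLinearMap.adjoint_inner_left,
      toEuclideanCLM_adjoint]
    simp only [Complex.reCLM_apply, ENNReal.toReal_ofNat, Real.rpow_ofNat]
    exact (inner_self_eq_norm_sq (𝕜 := ℂ) _)
  let e : X → EuclideanSpace ℂ ι →L[ℂ] lp (fun _ : ℕ => EuclideanSpace ℂ ι) 2 := fun x =>
    LinearMap.toContinuousLinearMap
      { toFun := fun v => ⟨_, hmem x v⟩
        map_add' := fun v w => Subtype.ext (funext fun n => map_add _ v w)
        map_smul' := fun c v => Subtype.ext (funext fun n => map_smul _ c v) }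
  have he : ∀ x v n, (e x v : ∀ _ : ℕ, EuclideanSpace ℂ ι) n =
      Matrix.toEuclideanCLM (𝕜 := ℂ) (A n x)ᴴ v := fun x v n => rfl
  refine ⟨e, fun x y v => ?_, fun x n v => ?_⟩
  · refine ext_inner_left ℂ fun w => ?_
    rw [ContinuousLinearMap.adjoint_inner_right]
    refine (lp.hasSum_inner _ _).unique ?_
    have hs := hasSum_inner_toEuclideanCLM (h x y) w v
    have hn : ∀ n, inner ℂ w (Matrix.toEuclideanCLM (𝕜 := ℂ) (A n x * (A n y)ᴴ) v) =
        inner ℂ ((e x w : ∀ _ : ℕ, EuclideanSpace ℂ ι) n)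
          ((e y v : ∀ _ : ℕ, EuclideanSpace ℂ ι) n) := fun n => by
      rw [he, he, map_mul, mul_apply_eq_comp, ← toEuclideanCLM_adjoint (A n x),
        ContinuousLinearMap.adjoint_inner_left]
    exact (funext hn) ▸ hs
  · refine ext_inner_left ℂ fun w => ?_
    rw [ContinuousLinearMap.adjoint_inner_right, lp.inner_single_right, he,
      ← toEuclideanCLM_adjoint, ContinuousLinearMap.adjoint_inner_left]

/-- The matrix kernel `K`, viewed as an operator-valued kernel. -/
def opKernel (K : X → X → Matrix ι ι ℂ) :
    Matrix X X (EuclideanSpace ℂ ι →L[ℂ] EuclideanSpace ℂ ι) :=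
  Matrix.of fun x y => Matrix.toEuclideanCLM (𝕜 := ℂ) (K x y)

theorem posSemidef_of_hasSum (A : ℕ → X → Matrix ι ι ℂ) (K : X → X → Matrix ι ι ℂ)
    (h : ∀ x y i j, HasSum (fun n => (A n x * (A n y)ᴴ) i j) (K x y i j)) :
    (opKernel K).PosSemidef := by
  obtain ⟨e, he, -⟩ := exists_feature_of_hasSum A K h
  exact posSemidef_of_feature e he

/-- If `K = ∑ₙ Aₙ(x) Aₙ(y)*`, then the columns of the `Aₙ` belong to the space with kernel `K` and
span a dense subspace; the density is stated as the fact that bounded operators which agree on the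
columns are equal. -/
theorem exists_dense_columns {H : Type*} [NormedAddCommGroup H] [InnerProductSpace ℂ H]
    [CompleteSpace H] [RKHS ℂ H X (EuclideanSpace ℂ ι)]
    (A : ℕ → X → Matrix ι ι ℂ) (K : X → X → Matrix ι ι ℂ) (hK : kernel H = opKernel K)
    (h : ∀ x y i j, HasSum (fun n => (A n x * (A n y)ᴴ) i j) (K x y i j)) :
    ∃ Φ : ℕ → EuclideanSpace ℂ ι → H,
      (∀ n v x, Φ n v x = Matrix.toEuclideanCLM (𝕜 := ℂ) (A n x) v) ∧
      ∀ {F : Type} [NormedAddCommGroup F] [NormedSpace ℂ F] (g₁ g₂ : H →L[ℂ] F),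
        (∀ n v, g₁ (Φ n v) = g₂ (Φ n v)) → g₁ = g₂ := by
  obtain ⟨e, he, he'⟩ := exists_feature_of_hasSum A K h
  obtain ⟨T, hT, hTT⟩ := exists_coisometry_feature (H := H) e (fun x y v => by rw [he, hK]; rfl)
  refine ⟨fun n v => T (lp.single 2 n v), fun n v x => by rw [hT, he'], fun g₁ g₂ hg => ?_⟩
  have : g₁ ∘L T = g₂ ∘L T := by
    ext f
    have hs := lp.hasSum_single (E := fun _ : ℕ => EuclideanSpace ℂ ι) (p := 2) (by simp) f
    refine ((g₁ ∘L T).hasSum hs).unique ?_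
    simpa [hg] using (g₂ ∘L T).hasSum hs
  ext f
  rw [← hTT f]
  exact DFunLike.congr_fun this (T.adjoint f)

end MatrixSeries

end RKHS

namespace KoranyiMisra

/-! ### Binomial series -/

/-- The coefficient `(β)_n / n!` of `xⁿ` in the binomial series of `(1 - x)^(-β)`. -/
def binomCoeff (β : ℝ) (n : ℕ) : ℝ :=
  (ascPochhammer ℝ n).eval β / n !

lemma binomCoeff_nonneg {β : ℝ} (hβ : 0 < β) (n : ℕ) : 0 ≤ binomCoeff β n :=
  div_nonneg (ascPochhammer_pos n β hβ).le (by positivity)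

lemma binomCoeff_zero (β : ℝ) : binomCoeff β 0 = 1 := by simp [binomCoeff]

lemma succ_mul_binomCoeff (β : ℝ) (n : ℕ) :
    (n + 1) * binomCoeff β (n + 1) = (β + n) * binomCoeff β n := by
  have : (n ! : ℝ) ≠ 0 := by positivity
  rw [binomCoeff, binomCoeff, ascPochhammer_succ_eval, Nat.factorial_succ]
  push_cast
  field_simp

lemma succ_mul_binomCoeff' (β : ℝ) (n : ℕ) :
    (n + 1) * binomCoeff β (n + 1) = β * binomCoeff (β + 1) n := by
  have : (n ! : ℝ) ≠ 0 := by positivity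
  rw [binomCoeff, binomCoeff, ascPochhammer_succ_left, Nat.factorial_succ]
  simp only [Polynomial.eval_mul, Polynomial.eval_X, Polynomial.eval_comp, Polynomial.eval_add,
    Polynomial.eval_one]
  push_cast
  field_simp

/-- The principal branch of `(1 - x)^(-γ)`. -/
def invPow (γ : ℝ) (x : ℂ) : ℂ := (1 - x) ^ (-(γ : ℂ))

lemma invPow_eq_mul {x : ℂ} (hx : 1 - x ≠ 0) (γ : ℝ) (k : ℕ) :
    invPow γ x = (1 - x) ^ k * invPow (γ + k) x := by
  rw [invPow, invPow, ← Complex.cpow_natCast, ← Complex.cpow_add _ _ hx]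
  congr 1
  push_cast
  ring

lemma one_sub_ne_zero_of_norm_lt {x : ℂ} (hx : ‖x‖ < 1) : 1 - x ≠ 0 := by
  intro h
  rw [sub_eq_zero] at h
  simp [← h] at hx

lemma hasSum_binomCoeff (β : ℝ) {x : ℂ} (hx : ‖x‖ < 1) :
    HasSum (fun n => (binomCoeff β n : ℂ) * x ^ n) (invPow β x) := by
  have h := (Complex.one_div_one_sub_cpow_hasFPowerSeriesOnBall_zero (β : ℂ)).hasSum (y := x)
    (by simpa [Metric.mem_eball, edist_eq_enorm_sub, ← ofReal_norm] using hx)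
  have hc : ∀ n : ℕ, Ring.choose ((β : ℂ) + n - 1) n = (binomCoeff β n : ℂ) := fun n => by
    have h1 := Ring.factorial_nsmul_multichoose_eq_ascPochhammer β n
    rw [Polynomial.ascPochhammer_smeval_eq_eval, Ring.multichoose_eq, nsmul_eq_mul] at h1
    have h2 : binomCoeff β n = Ring.choose (β + n - 1) n := by
      rw [binomCoeff, ← h1]
      field_simp
    rw [h2, Complex.ofReal_choose]
    push_cast
    rfl
  simpa [invPow, FormalMultilinearSeries.ofScalars_apply_eq, hc, Complex.cpow_neg, mul_comm] using h

section Sums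

variable {β : ℝ} {z c : ℂ}

lemma hasSum_binom_shift {f : ℕ → ℂ} {a : ℂ} (k : ℕ) (h0 : ∀ n < k, f n = 0)
    (h : HasSum (fun n => f (n + k)) a) : HasSum f a := by
  have := (hasSum_nat_add_iff k).mp h
  rwa [Finset.sum_eq_zero fun i hi => h0 i (Finset.mem_range.mp hi), add_zero] at this

lemma cast_succ_mul_binomCoeff (β : ℝ) (n : ℕ) :
    ((n : ℂ) + 1) * binomCoeff β (n + 1) = β * binomCoeff (β + 1) n := by
  exact_mod_cast succ_mul_binomCoeff' β n

lemma cast_succ_succ_mul_binomCoeff (β : ℝ) (n : ℕ) :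
    ((n : ℂ) + 2) * (n + 1) * binomCoeff β (n + 2) = β * (β + 1) * binomCoeff (β + 2) n := by
  have h1 := cast_succ_mul_binomCoeff β (n + 1)
  have h2 := cast_succ_mul_binomCoeff (β + 1) n
  rw [show β + 1 + 1 = β + 2 by ring] at h2
  push_cast at h1 h2
  linear_combination ((n : ℂ) + 1) * h1 + (β : ℂ) * h2

lemma hasSum_binom_zero (hx : ‖z * c‖ < 1) :
    HasSum (fun n : ℕ => (binomCoeff β n : ℂ) * (z ^ n * c ^ n)) (invPow β (z * c)) := by
  simpa only [mul_pow] using hasSum_binomCoeff β hx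

/-- `∑ n (β)_n / n! xⁿ`. -/
lemma hasSum_mul_binom (hx : ‖z * c‖ < 1) :
    HasSum (fun n : ℕ => n * ((binomCoeff β n : ℂ) * (z ^ n * c ^ n)))
      (β * (z * c) * invPow (β + 1) (z * c)) := by
  refine hasSum_binom_shift 1 (by simp) ?_
  refine ((hasSum_binom_zero (β := β + 1) hx).mul_left ((β : ℂ) * (z * c))).congr_fun fun n => ?_
  have := cast_succ_mul_binomCoeff β n
  push_cast
  linear_combination (z ^ (n + 1) * c ^ (n + 1)) * this

/-- `∑ n (n - 1) (β)_n / n! xⁿ`. -/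
lemma hasSum_mul_mul_binom (hx : ‖z * c‖ < 1) :
    HasSum (fun n : ℕ => n * (n - 1 : ℂ) * ((binomCoeff β n : ℂ) * (z ^ n * c ^ n)))
      (β * (β + 1) * (z * c) ^ 2 * invPow (β + 2) (z * c)) := by
  refine hasSum_binom_shift 2 (fun n hn => by interval_cases n <;> simp) ?_
  refine ((hasSum_binom_zero (β := β + 2) hx).mul_left
    ((β : ℂ) * (β + 1) * (z * c) ^ 2)).congr_fun fun n => ?_
  have := cast_succ_succ_mul_binomCoeff β n
  push_cast
  linear_combination (z ^ (n + 2) * c ^ (n + 2)) * this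

/-- `∑ (β)_n / n! (∂_z zⁿ) cⁿ`. -/
lemma hasSum_deriv_zero (hx : ‖z * c‖ < 1) :
    HasSum (fun n : ℕ => (binomCoeff β n : ℂ) * ((n * z ^ (n - 1)) * c ^ n))
      (β * c * invPow (β + 1) (z * c)) := by
  refine hasSum_binom_shift 1 (by simp) ?_
  refine ((hasSum_binom_zero (β := β + 1) hx).mul_left ((β : ℂ) * c)).congr_fun fun n => ?_
  have := cast_succ_mul_binomCoeff β n
  simp only [Nat.add_sub_cancel]
  push_cast
  linear_combination (z ^ n * c ^ (n + 1)) * this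

/-- `∑ (β)_n / n! (∂_z² zⁿ) cⁿ`. -/
lemma hasSum_deriv_deriv_zero (hx : ‖z * c‖ < 1) :
    HasSum (fun n : ℕ => (binomCoeff β n : ℂ) * ((n * (n - 1) * z ^ (n - 2)) * c ^ n))
      (β * (β + 1) * c ^ 2 * invPow (β + 2) (z * c)) := by
  refine hasSum_binom_shift 2 (fun n hn => by interval_cases n <;> simp) ?_
  refine ((hasSum_binom_zero (β := β + 2) hx).mul_left
    ((β : ℂ) * (β + 1) * c ^ 2)).congr_fun fun n => ?_
  have := cast_succ_succ_mul_binomCoeff β n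
  simp only [Nat.add_sub_cancel]
  push_cast
  linear_combination (z ^ n * c ^ (n + 2)) * this

/-- `∑ (β)_n / n! (∂_z zⁿ) (∂_c cⁿ)`. -/
lemma hasSum_deriv_deriv (hx : ‖z * c‖ < 1) :
    HasSum (fun n : ℕ => (binomCoeff β n : ℂ) * ((n * z ^ (n - 1)) * (n * c ^ (n - 1))))
      (β * ((β + 1) * (z * c) * invPow (β + 2) (z * c) + invPow (β + 1) (z * c))) := by
  refine hasSum_binom_shift 1 (by simp) ?_
  have h0 := hasSum_binom_zero (β := β + 1) hx
  have h1 := hasSum_mul_binom (β := β + 1) hx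
  rw [show β + 1 + 1 = β + 2 by ring] at h1
  push_cast at h1
  refine ((h1.add h0).mul_left (β : ℂ)).congr_fun fun n => ?_
  have := cast_succ_mul_binomCoeff β n
  simp only [Nat.add_sub_cancel]
  push_cast
  linear_combination (((n : ℂ) + 1) * z ^ n * c ^ n) * this

/-- `∑ (β)_n / n! (∂_z² zⁿ) (∂_c cⁿ)`. -/
lemma hasSum_deriv_deriv_deriv (hx : ‖z * c‖ < 1) :
    HasSum (fun n : ℕ => (binomCoeff β n : ℂ) *
        ((n * (n - 1) * z ^ (n - 2)) * (n * c ^ (n - 1))))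
      (β * (β + 1) * c *
        ((β + 2) * (z * c) * invPow (β + 3) (z * c) + 2 * invPow (β + 2) (z * c))) := by
  refine hasSum_binom_shift 2 (fun n hn => by interval_cases n <;> simp) ?_
  have h0 := hasSum_binom_zero (β := β + 2) hx
  have h1 := hasSum_mul_binom (β := β + 2) hx
  rw [show β + 2 + 1 = β + 3 by ring] at h1
  push_cast at h1
  refine ((h1.add (h0.mul_left 2)).mul_left ((β : ℂ) * (β + 1) * c)).congr_fun fun n => ?_
  have := cast_succ_succ_mul_binomCoeff β n
  simp only [Nat.add_sub_cancel, show n + 2 - 1 = n + 1 by omega]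
  push_cast
  linear_combination (((n : ℂ) + 2) * z ^ n * c ^ (n + 1)) * this

/-- `∑ (β)_n / n! (∂_z² zⁿ) (∂_c² cⁿ)`. -/
lemma hasSum_deriv_deriv_deriv_deriv (hx : ‖z * c‖ < 1) :
    HasSum (fun n : ℕ => (binomCoeff β n : ℂ) *
        ((n * (n - 1) * z ^ (n - 2)) * (n * (n - 1) * c ^ (n - 2))))
      (β * (β + 1) * ((β + 2) * (β + 3) * (z * c) ^ 2 * invPow (β + 4) (z * c) +
        4 * ((β + 2) * (z * c) * invPow (β + 3) (z * c)) + 2 * invPow (β + 2) (z * c))) := by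
  refine hasSum_binom_shift 2 (fun n hn => by interval_cases n <;> simp) ?_
  have h0 := hasSum_binom_zero (β := β + 2) hx
  have h1 := hasSum_mul_binom (β := β + 2) hx
  have h2 := hasSum_mul_mul_binom (β := β + 2) hx
  rw [show β + 2 + 1 = β + 3 by ring] at h1
  rw [show β + 2 + 2 = β + 4 by ring] at h2
  push_cast at h1 h2
  rw [show (β : ℂ) + 2 + 1 = β + 3 by ring] at h2
  refine (((h2.add (h1.mul_left 4)).add (h0.mul_left 2)).mul_left
    ((β : ℂ) * (β + 1))).congr_fun fun n => ?_
  have := cast_succ_succ_mul_binomCoeff β n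
  simp only [Nat.add_sub_cancel]
  push_cast
  linear_combination (((n : ℂ) + 2) * (n + 1) * z ^ n * c ^ n) * this

end Sums

/-! ### Explicit form of the kernel -/

/-- `D(z w̄) exp(w̄ S)`. -/
def leftFactor (z w : ℂ) : Matrix (Fin 3) (Fin 3) ℂ :=
  !![(1 - z * conj w) ^ 2, 0, 0;
    (1 - z * conj w) * conj w, 1 - z * conj w, 0;
    conj w ^ 2, 2 * conj w, 1]

/-- The polynomial part `D(z w̄) exp(w̄ S) diag(d) exp(z S*) D(z w̄)` of the kernel. -/
def polyKernel (d : Fin 3 → ℝ) (z w : ℂ) : Matrix (Fin 3) (Fin 3) ℂ :=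
  leftFactor z w * Matrix.diagonal (fun l => (d l : ℂ)) * (leftFactor w z)ᴴ

/-- `exp(t S)`. -/
def expShift (t : ℂ) : Matrix (Fin 3) (Fin 3) ℂ :=
  !![1, 0, 0; t, 1, 0; t ^ 2, 2 * t, 1]

lemma exp_smul_shift (t : ℂ) : NormedSpace.exp (t • shift 2) = expShift t := by
  have h3 : (t • shift 2) ^ 3 = 0 := by
    ext i j
    fin_cases i <;> fin_cases j <;>
      simp [pow_succ, Matrix.mul_apply, Fin.sum_univ_three, shift]
  rw [NormedSpace.exp_eq_tsum ℂ]
  simp only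
  rw [tsum_eq_sum (s := Finset.range 3) (fun n hn => by
    obtain ⟨k, rfl⟩ := Nat.exists_eq_add_of_le (Nat.le_of_not_lt (Finset.mem_range.not.mp hn))
    rw [pow_add, h3, zero_mul, smul_zero])]
  ext i j
  fin_cases i <;> fin_cases j <;>
    simp [Finset.sum_range_succ, pow_succ, Matrix.mul_apply, Fin.sum_univ_three, shift, expShift,
      Nat.factorial] <;> ring

lemma matD_mul_expShift (z w : ℂ) :
    matD 2 (z * conj w) * expShift (conj w) = leftFactor z w := by
  ext i j
  fin_cases i <;> fin_cases j <;>
    simp [matD, expShift, leftFactor, Matrix.mul_apply, Matrix.diagonal_apply]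

lemma kernel_eq (lam : ℝ) (μ : Fin 3 → ℝ) (z w : ℂ) :
    kernel 2 lam μ z w =
      invPow (2 * lam + 2) (z * conj w) • polyKernel (vecD 2 lam μ) z w := by
  have h1 : NormedSpace.exp (z • (shift 2)ᴴ) = (expShift (conj z))ᴴ := by
    rw [← exp_smul_shift, ← Matrix.exp_conjTranspose, Matrix.conjTranspose_smul]
    simp
  have h2 : (matD 2 (z * conj w))ᴴ = matD 2 (w * conj z) := by
    rw [matD, matD, Matrix.diagonal_conjTranspose]
    congr 1
    ext l
    simp [mul_comm]
  have h3 : (leftFactor w z)ᴴ = NormedSpace.exp (z • (shift 2)ᴴ) * matD 2 (z * conj w) := by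
    rw [← matD_mul_expShift, Matrix.conjTranspose_mul, h1, ← h2, Matrix.conjTranspose_conjTranspose]
  rw [kernel, polyKernel, h3, ← matD_mul_expShift, exp_smul_shift, invPow, matB]
  congr 1
  · congr 1
    push_cast
    ring
  · simp only [Matrix.mul_assoc]

end KoranyiMisra

namespace KoranyiMisra

/-! ### Expansion of the kernel -/

lemma vecD_zero {lam : ℝ} {μ : Fin 3 → ℝ} (h : Admissible 2 lam μ) : vecD 2 lam μ 0 = 1 := by
  simp [vecD, matL, Matrix.mulVec, dotProduct, h.2.1]

lemma vecD_one {lam : ℝ} {μ : Fin 3 → ℝ} (h : Admissible 2 lam μ) :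
    vecD 2 lam μ 1 = 1 / (2 * lam - 2) + μ 1 ^ 2 := by
  simp [vecD, matL, Matrix.mulVec, dotProduct, Fin.sum_univ_three, h.2.1]

lemma vecD_two {lam : ℝ} {μ : Fin 3 → ℝ} (h : Admissible 2 lam μ) :
    vecD 2 lam μ 2 = 2 / ((2 * lam - 2) * (2 * lam - 1)) + 4 / (2 * lam) * μ 1 ^ 2 + μ 2 ^ 2 := by
  have : (2 * lam - 2 + 1 : ℝ) = 2 * lam - 1 := by ring
  simp [vecD, matL, Matrix.mulVec, dotProduct, Fin.sum_univ_three, h.2.1,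
    ascPochhammer_succ_eval, Nat.choose, this]
  norm_num

/-- The images of `zⁿ` under the three operators `Γ_j` which intertwine scalar weighted Bergman
spaces with vector-valued functions: for `j ≤ ℓ`, the component `ℓ` of the column `j` is the
derivative of order `ℓ - j` of `zⁿ`, multiplied by `binom(ℓ, j) / (b - 2 + 2 j)_(ℓ - j)`. Here
`b = 2 lam`. -/
def gammaMatrix (b : ℂ) (n : ℕ) (z : ℂ) : Matrix (Fin 3) (Fin 3) ℂ :=
  !![z ^ n, 0, 0;
    (b - 2)⁻¹ * (n * z ^ (n - 1)), z ^ n, 0;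
    (b - 2)⁻¹ * (b - 1)⁻¹ * (n * (n - 1) * z ^ (n - 2)), 2 * b⁻¹ * (n * z ^ (n - 1)), z ^ n]

/-- The weights of the columns of `gammaMatrix`: `√((β)_n / n!) zⁿ` is an orthonormal basis of the
space with kernel `(1 - z w̄)^(-β)`, for `β = b - 2 + 2 j`, and the `j`-th space is scaled by
`μ_j`. -/
def gammaWeight (b : ℝ) (μ : Fin 3 → ℝ) (n : ℕ) : Fin 3 → ℝ :=
  ![√(binomCoeff (b - 2) n), μ 1 * √(binomCoeff b n), μ 2 * √(binomCoeff (b + 2) n)]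

/-- The matrix whose columns are the images of the three basis vectors of degree `n` in the space
with kernel `K^(lam, μ)`. -/
def columns (lam : ℝ) (μ : Fin 3 → ℝ) (n : ℕ) (z : ℂ) : Matrix (Fin 3) (Fin 3) ℂ :=
  gammaMatrix (2 * lam) n z * Matrix.diagonal fun j => (gammaWeight (2 * lam) μ n j : ℂ)

lemma columns_mul_conjTranspose {lam : ℝ} {μ : Fin 3 → ℝ} (h : Admissible 2 lam μ) (n : ℕ)
    (z w : ℂ) :
    columns lam μ n z * (columns lam μ n w)ᴴ =
      gammaMatrix (2 * lam) n z *
        Matrix.diagonal ![(binomCoeff (2 * lam - 2) n : ℂ), (μ 1 : ℂ) ^ 2 * binomCoeff (2 * lam) n,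
          (μ 2 : ℂ) ^ 2 * binomCoeff (2 * lam + 2) n] * (gammaMatrix (2 * lam) n w)ᴴ := by
  have hb : 2 < 2 * lam := by simpa using h.1
  have hs : ∀ {x : ℝ}, 0 < x → (√(binomCoeff x n) : ℂ) * √(binomCoeff x n) = binomCoeff x n :=
    fun hx => by exact_mod_cast Real.mul_self_sqrt (binomCoeff_nonneg hx n)
  have hd : Matrix.diagonal (fun j => (gammaWeight (2 * lam) μ n j : ℂ)) *
      (Matrix.diagonal fun j => (gammaWeight (2 * lam) μ n j : ℂ))ᴴ =
      Matrix.diagonal ![(binomCoeff (2 * lam - 2) n : ℂ), (μ 1 : ℂ) ^ 2 * binomCoeff (2 * lam) n,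
          (μ 2 : ℂ) ^ 2 * binomCoeff (2 * lam + 2) n] := by
    rw [Matrix.diagonal_conjTranspose, Matrix.diagonal_mul_diagonal]
    congr 1
    ext j
    fin_cases j
    · simpa [gammaWeight] using hs (by linarith)
    · have := hs (x := 2 * lam) (by linarith)
      simp [gammaWeight]
      linear_combination (μ 1 : ℂ) ^ 2 * this
    · have := hs (x := 2 * lam + 2) (by linarith)
      simp [gammaWeight]
      linear_combination (μ 2 : ℂ) ^ 2 * this
  rw [columns, columns, Matrix.conjTranspose_mul, ← hd]
  simp only [Matrix.mul_assoc]

lemma mul_diagonal_mul_conjTranspose_apply (A B : Matrix (Fin 3) (Fin 3) ℂ) (d : Fin 3 → ℂ)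
    (i j : Fin 3) :
    (A * Matrix.diagonal d * Bᴴ) i j =
      A i 0 * d 0 * conj (B j 0) + A i 1 * d 1 * conj (B j 1) + A i 2 * d 2 * conj (B j 2) := by
  simp [Matrix.mul_apply, Fin.sum_univ_three]

lemma hasSum_of_eq {f g : ℕ → ℂ} {a b : ℂ} (h : HasSum f a) (hf : ∀ n, g n = f n) (hb : b = a) :
    HasSum g b :=
  hb ▸ h.congr_fun hf

/-- The kernel is the sum over `n` of `columns n z * (columns n w)*`, that is, the sum of the
images of three weighted Bergman kernels under the operators `Γ_j`. Each entry is a combination of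
series of derivatives, and all of them are expressed through the single power
`(1 - z w̄)^(-2 lam - 2)`. -/
theorem hasSum_columns {lam : ℝ} {μ : Fin 3 → ℝ} (h : Admissible 2 lam μ) {z w : ℂ}
    (hx : ‖z * conj w‖ < 1) (i j : Fin 3) :
    HasSum (fun n => (columns lam μ n z * (columns lam μ n w)ᴴ) i j) (kernel 2 lam μ z w i j) := by
  have hb : 2 < 2 * lam := by simpa using h.1
  have hb0 : (2 * lam - 2 : ℂ) ≠ 0 := by
    have : (2 * lam - 2 : ℝ) ≠ 0 := by linarith
    exact_mod_cast this
  have hb0' : (lam - 1 : ℂ) ≠ 0 := by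
    have : (lam - 1 : ℝ) ≠ 0 := by linarith
    exact_mod_cast this
  have hb1 : (2 * lam - 1 : ℂ) ≠ 0 := by
    have : (2 * lam - 1 : ℝ) ≠ 0 := by linarith
    exact_mod_cast this
  have hb2 : (lam : ℂ) ≠ 0 := by
    have : (lam : ℝ) ≠ 0 := by linarith
    exact_mod_cast this
  have hx' : ‖conj w * z‖ < 1 := by rwa [mul_comm]
  have ne := one_sub_ne_zero_of_norm_lt hx
  have hp : ∀ (γ : ℝ) (k : ℕ), γ + k = 2 * lam + 2 → invPow γ (z * conj w) =
      (1 - z * conj w) ^ k * invPow (2 * lam + 2) (z * conj w) := fun γ k hk => by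
    rw [invPow_eq_mul ne γ k, hk]
  have hp0 := hp (2 * lam - 2) 4 (by push_cast; ring)
  have hp1 := hp (2 * lam - 2 + 1) 3 (by push_cast; ring)
  have hp2 := hp (2 * lam - 2 + 2) 2 (by push_cast; ring)
  have hp3 := hp (2 * lam - 2 + 3) 1 (by push_cast; ring)
  have hp4 := hp (2 * lam - 2 + 4) 0 (by push_cast; ring)
  have hq0 := hp (2 * lam) 2 (by push_cast; ring)
  have hq1 := hp (2 * lam + 1) 1 (by push_cast; ring)
  have hq2 := hp (2 * lam + 2) 0 (by push_cast; ring)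
  have a00 := hasSum_binom_zero (β := 2 * lam - 2) hx
  have a10 := hasSum_deriv_zero (β := 2 * lam - 2) hx
  have a01 := hasSum_deriv_zero (β := 2 * lam - 2) hx'
  have a20 := hasSum_deriv_deriv_zero (β := 2 * lam - 2) hx
  have a02 := hasSum_deriv_deriv_zero (β := 2 * lam - 2) hx'
  have a11 := hasSum_deriv_deriv (β := 2 * lam - 2) hx
  have a21 := hasSum_deriv_deriv_deriv (β := 2 * lam - 2) hx
  have a12 := hasSum_deriv_deriv_deriv (β := 2 * lam - 2) hx'
  have a22 := hasSum_deriv_deriv_deriv_deriv (β := 2 * lam - 2) hx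
  have b00 := hasSum_binom_zero (β := 2 * lam) hx
  have b10 := hasSum_deriv_zero (β := 2 * lam) hx
  have b01 := hasSum_deriv_zero (β := 2 * lam) hx'
  have b11 := hasSum_deriv_deriv (β := 2 * lam) hx
  have c00 := hasSum_binom_zero (β := 2 * lam + 2) hx
  rw [mul_comm (conj w) z] at a01 a02 a12 b01
  rw [hp0] at a00
  rw [hp1] at a10 a01
  rw [hp2] at a20 a02
  rw [hp1, hp2] at a11
  rw [hp2, hp3] at a21 a12
  rw [hp2, hp3, hp4] at a22
  rw [hq0] at b00
  rw [hq1] at b10 b01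
  rw [hq1, hq2] at b11
  have hv : vecD 2 lam μ = ![1, 1 / (2 * lam - 2) + μ 1 ^ 2,
      2 / ((2 * lam - 2) * (2 * lam - 1)) + 4 / (2 * lam) * μ 1 ^ 2 + μ 2 ^ 2] := by
    funext l
    fin_cases l
    · exact vecD_zero h
    · exact vecD_one h
    · exact vecD_two h
  rw [kernel_eq, hv]
  simp_rw [columns_mul_conjTranspose h, mul_diagonal_mul_conjTranspose_apply]
  rw [Matrix.smul_apply, polyKernel, mul_diagonal_mul_conjTranspose_apply]
  set P := invPow (2 * lam + 2) (z * conj w)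
  fin_cases i <;> fin_cases j
  · refine hasSum_of_eq (a00) (fun n => ?_) ?_
    · simp [gammaMatrix]; ring
    · simp [leftFactor]
      ring
  · refine hasSum_of_eq (a01.mul_left ((2 * lam - 2 : ℂ)⁻¹)) (fun n => ?_) ?_
    · simp [gammaMatrix, map_ofNat]; ring
    · simp [leftFactor]
      field_simp
  · refine hasSum_of_eq (a02.mul_left ((2 * lam - 2 : ℂ)⁻¹ * (2 * lam - 1 : ℂ)⁻¹)) (fun n => ?_) ?_
    · simp [gammaMatrix, map_ofNat]; ring
    · simp [leftFactor, map_ofNat]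
      field_simp
      ring
  · refine hasSum_of_eq (a10.mul_left ((2 * lam - 2 : ℂ)⁻¹)) (fun n => ?_) ?_
    · simp [gammaMatrix]; ring
    · simp [leftFactor]
      field_simp
  · refine hasSum_of_eq ((a11.mul_left ((2 * lam - 2 : ℂ)⁻¹ * (2 * lam - 2 : ℂ)⁻¹)).add
      (b00.mul_left ((μ 1 : ℂ) ^ 2))) (fun n => ?_) ?_
    · simp [gammaMatrix, map_ofNat]; ring
    · simp [leftFactor]
      field_simp
      ring
  · refine hasSum_of_eq ((a12.mul_left
      ((2 * lam - 2 : ℂ)⁻¹ * (2 * lam - 2 : ℂ)⁻¹ * (2 * lam - 1 : ℂ)⁻¹)).add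
      (b01.mul_left (2 * (μ 1 : ℂ) ^ 2 / (2 * lam)))) (fun n => ?_) ?_
    · simp [gammaMatrix, map_ofNat]; ring
    · simp [leftFactor, map_ofNat]
      field_simp
      ring
  · refine hasSum_of_eq (a20.mul_left ((2 * lam - 2 : ℂ)⁻¹ * (2 * lam - 1 : ℂ)⁻¹)) (fun n => ?_) ?_
    · simp [gammaMatrix]; ring
    · simp [leftFactor]
      field_simp
      ring
  · refine hasSum_of_eq ((a21.mul_left
      ((2 * lam - 2 : ℂ)⁻¹ * (2 * lam - 2 : ℂ)⁻¹ * (2 * lam - 1 : ℂ)⁻¹)).add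
      (b10.mul_left (2 * (μ 1 : ℂ) ^ 2 / (2 * lam)))) (fun n => ?_) ?_
    · simp [gammaMatrix, map_ofNat]; ring
    · simp [leftFactor]
      field_simp
      ring
  · refine hasSum_of_eq (((a22.mul_left (((2 * lam - 2 : ℂ)⁻¹ * (2 * lam - 1 : ℂ)⁻¹) ^ 2)).add
      (b11.mul_left (4 * (μ 1 : ℂ) ^ 2 / (2 * lam) ^ 2))).add
        (c00.mul_left ((μ 2 : ℂ) ^ 2))) (fun n => ?_) ?_
    · simp [gammaMatrix, map_ofNat]; ring
    · simp [leftFactor, map_ofNat]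
      field_simp
      ring

end KoranyiMisra

namespace RKHS

/-! ### Bounded multiplication operators -/

/-- Multiplication by `g` is bounded, of norm at most `C`, as soon as
`(C² - g(x) g(y)‾) K(x, y)` is positive semidefinite. Here this kernel is the product of a
positive semidefinite kernel `(e x)† (e y)` and a power series with nonnegative coefficients in
`g(x) g(y)‾`. -/
theorem exists_multiplication {X V H H₁ : Type*}
    [NormedAddCommGroup V] [InnerProductSpace ℂ V] [CompleteSpace V]
    [NormedAddCommGroup H₁] [InnerProductSpace ℂ H₁] [CompleteSpace H₁]
    [NormedAddCommGroup H] [InnerProductSpace ℂ H] [CompleteSpace H] [RKHS ℂ H X V]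
    (g : X → ℂ) {C : ℝ} (hC : 0 ≤ C) (a : ℕ → ℝ) (ha : ∀ n, 0 ≤ a n) (F : X → X → ℂ)
    (hF : ∀ x y, HasSum (fun n => (a n : ℂ) * (g x * conj (g y)) ^ n) (F x y))
    (e : X → V →L[ℂ] H₁)
    (hK : ∀ x y v, ((C : ℂ) ^ 2 - g x * conj (g y)) • kernel H x y v =
      F x y • (e x).adjoint (e y v)) :
    ∃ M : H →L[ℂ] H, ∀ f x, M f x = g x • f x := by
  let e₂ : X → V →L[ℂ] H := fun x => conj (g x) • kerFun H x
  obtain ⟨M, hM, -⟩ := exists_adjoint_feature (H := H) e₂ C fun f => by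
    rw [← sq_le_sq₀ (norm_nonneg _) (mul_nonneg hC (norm_nonneg _)), mul_pow, norm_sq_comb,
      norm_sq_comb, ← sub_nonneg, ← Complex.re_ofReal_mul, ← Complex.sub_re]
    have hs : ((C ^ 2 : ℝ) : ℂ) * ∑ x ∈ f.support, ∑ y ∈ f.support,
          inner ℂ (kerFun H x (f x)) (kerFun H y (f y)) -
        ∑ x ∈ f.support, ∑ y ∈ f.support, inner ℂ (e₂ x (f x)) (e₂ y (f y)) =
        ∑ x ∈ f.support, ∑ y ∈ f.support, conj (F y x) * inner ℂ (e x (f x)) (e y (f y)) := by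
      rw [Finset.mul_sum, ← Finset.sum_sub_distrib]
      refine Finset.sum_congr rfl fun x _ => ?_
      rw [Finset.mul_sum, ← Finset.sum_sub_distrib]
      refine Finset.sum_congr rfl fun y _ => ?_
      have h := congrArg (fun u => inner ℂ u (f y)) (hK y x (f x))
      simp only [inner_smul_left, ContinuousLinearMap.adjoint_inner_left] at h
      rw [← h, kernel_inner]
      simp only [e₂, smul_apply, inner_smul_left, inner_smul_right, map_sub,
        map_mul, map_pow, Complex.conj_ofReal, Complex.conj_conj]
      push_cast
      ring
    rw [hs]
    -- the difference is the sum of the squared norms of the combinations of `(g x)‾ⁿ e x`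
    have hsum : HasSum (fun n => ((a n * ‖comb (fun x => conj (g x) ^ n • e x) f‖ ^ 2 : ℝ) : ℂ))
        (∑ x ∈ f.support, ∑ y ∈ f.support, conj (F y x) * inner ℂ (e x (f x)) (e y (f y))) := by
      have h2 : HasSum (fun n => ∑ x ∈ f.support, ∑ y ∈ f.support,
          conj ((a n : ℂ) * (g y * conj (g x)) ^ n) * inner ℂ (e x (f x)) (e y (f y)))
          (∑ x ∈ f.support, ∑ y ∈ f.support, conj (F y x) * inner ℂ (e x (f x)) (e y (f y))) :=
        hasSum_sum fun x _ => hasSum_sum fun y _ =>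
          (Complex.conjCLE.toContinuousLinearMap.hasSum (hF y x)).mul_right _
      refine h2.congr_fun fun n => ?_
      have : comb (fun x => conj (g x) ^ n • e x) f =
          ∑ x ∈ f.support, conj (g x) ^ n • e x (f x) := by simp [comb, Finsupp.sum]
      rw [this, Complex.ofReal_mul, Complex.ofReal_pow]
      have h3 : inner ℂ (∑ x ∈ f.support, conj (g x) ^ n • e x (f x))
          (∑ x ∈ f.support, conj (g x) ^ n • e x (f x)) =
          ((‖∑ x ∈ f.support, conj (g x) ^ n • e x (f x)‖ : ℝ) : ℂ) ^ 2 :=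
        inner_self_eq_norm_sq_to_K _
      rw [← h3, sum_inner, Finset.mul_sum]
      refine Finset.sum_congr rfl fun x _ => ?_
      rw [inner_sum, Finset.mul_sum]
      refine Finset.sum_congr rfl fun y _ => ?_
      simp only [inner_smul_left, inner_smul_right, map_mul, map_pow, Complex.conj_ofReal,
        Complex.conj_conj]
      ring
    refine HasSum.nonneg (fun n => ?_) (Complex.reCLM.hasSum hsum)
    rw [Complex.reCLM_apply, Complex.ofReal_re]
    exact mul_nonneg (ha n) (sq_nonneg _)
  refine ⟨M, fun f x => ?_⟩
  refine ext_inner_left ℂ fun v => ?_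
  rw [hM, ContinuousLinearMap.adjoint_inner_right, smul_apply, inner_smul_left, kerFun_inner,
    Complex.conj_conj, inner_smul_right]

end RKHS

namespace KoranyiMisra

open RKHS

lemma norm_mul_conj_lt_one (z w : 𝔻) : ‖(z : ℂ) * conj (w : ℂ)‖ < 1 := by
  rw [norm_mul, Complex.norm_conj]
  exact mul_lt_one_of_nonneg_of_lt_one_left (norm_nonneg _) z.norm_lt_one w.norm_lt_one.le

theorem posSemidef_kernelOp {lam : ℝ} {μ : Fin 3 → ℝ} (h : Admissible 2 lam μ) :
    (kernelOp 2 lam μ).PosSemidef :=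
  posSemidef_of_hasSum (fun n (z : 𝔻) => columns lam μ n z) (fun z w => kernel 2 lam μ z w)
    fun z w => hasSum_columns h (norm_mul_conj_lt_one z w)

/-- For small `ε`, the coefficient vector `d` is also attained by parameters with `2 lam` replaced
by `2 lam - ε`. -/
lemma exists_admissible_sub {lam : ℝ} {μ : Fin 3 → ℝ} (h : Admissible 2 lam μ) :
    ∃ ε : ℝ, 0 < ε ∧ ε ≤ 1 ∧ ∃ μ' : Fin 3 → ℝ,
      Admissible 2 (lam - ε / 2) μ' ∧ vecD 2 (lam - ε / 2) μ' = vecD 2 lam μ := by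
  have hb : 1 < lam := by have := h.1; push_cast at this; linarith
  have h1 := vecD_one h
  have h2 := vecD_two h
  have hμ1 := pow_pos (h.2.2 1) 2
  have hμ2 := pow_pos (h.2.2 2) 2
  -- the squares of the new `μ₁` and `μ₂`, as functions of `ε`
  let f₁ : ℝ → ℝ := fun ε => vecD 2 lam μ 1 - 1 / (2 * (lam - ε / 2) - 2)
  let f₂ : ℝ → ℝ := fun ε => vecD 2 lam μ 2 -
    2 / ((2 * (lam - ε / 2) - 2) * (2 * (lam - ε / 2) - 1)) - 4 / (2 * (lam - ε / 2)) * f₁ ε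
  have hc₁ : ContinuousAt f₁ 0 := by
    refine continuousAt_const.sub (continuousAt_const.div (by fun_prop) ?_)
    linarith
  have hc₂ : ContinuousAt f₂ 0 := by
    refine (continuousAt_const.sub (continuousAt_const.div (by fun_prop) ?_)).sub
      ((continuousAt_const.div (by fun_prop) ?_).mul hc₁)
    · have : 0 < (2 * (lam - 0 / 2) - 2) * (2 * (lam - 0 / 2) - 1) :=
        mul_pos (by linarith) (by linarith)
      exact this.ne'
    · linarith
  have hf₁ : 0 < f₁ 0 := by simp only [f₁, h1, zero_div, sub_zero]; linarith
  have hf₂ : 0 < f₂ 0 := by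
    simp only [f₂, f₁, h1, h2, zero_div, sub_zero]
    ring_nf
    ring_nf at hμ2
    exact hμ2
  have hev := ((hc₁.eventually (lt_mem_nhds hf₁)).and (hc₂.eventually (lt_mem_nhds hf₂))).and
    (gt_mem_nhds (show (0 : ℝ) < min 1 (lam - 1) from lt_min one_pos (by linarith)))
  obtain ⟨ε, hε, hpos⟩ := ((hev.filter_mono nhdsWithin_le_nhds).and
    (self_mem_nhdsWithin (s := Set.Ioi (0 : ℝ)) (a := 0))).exists
  obtain ⟨⟨hε₁, hε₂⟩, hε₃⟩ := hε
  have hε0 : 0 < ε := hpos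
  have ha : Admissible 2 (lam - ε / 2) ![1, √(f₁ ε), √(f₂ ε)] := by
    refine ⟨?_, rfl, fun l => ?_⟩
    · have := hε₃.trans_le (min_le_right _ _)
      push_cast
      linarith
    · fin_cases l
      · exact one_pos
      · exact Real.sqrt_pos.mpr hε₁
      · exact Real.sqrt_pos.mpr hε₂
  refine ⟨ε, hε0, (hε₃.trans_le (min_le_left _ _)).le, _, ha, ?_⟩
  have e1 : √(f₁ ε) ^ 2 = f₁ ε := Real.sq_sqrt hε₁.le
  have e2 : √(f₂ ε) ^ 2 = f₂ ε := Real.sq_sqrt hε₂.le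
  funext l
  fin_cases l
  · exact (vecD_zero ha).trans (vecD_zero h).symm
  · refine (vecD_one ha).trans ?_
    simp only [Matrix.cons_val_one, Matrix.cons_val_zero, e1, f₁]
    change _ = vecD 2 lam μ 1
    ring
  · refine (vecD_two ha).trans ?_
    simp only [Matrix.cons_val_one, Matrix.cons_val_zero, Matrix.cons_val, e1, e2, f₂]
    change _ = vecD 2 lam μ 2
    ring

/-- The coefficients of `(1/ε - x) (1 - x)^(-ε)`, which are nonnegative for `0 < ε ≤ 1`. -/
def bergmanCoeff (ε : ℝ) : ℕ → ℝ
  | 0 => 1 / ε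
  | n + 1 => 1 / ε * binomCoeff ε (n + 1) - binomCoeff ε n

lemma bergmanCoeff_nonneg {ε : ℝ} (h0 : 0 < ε) (h1 : ε ≤ 1) (n : ℕ) : 0 ≤ bergmanCoeff ε n := by
  cases n with
  | zero => exact (one_div_pos.mpr h0).le
  | succ n =>
    have h := succ_mul_binomCoeff ε n
    have hn := binomCoeff_nonneg h0 n
    have hn' : (0 : ℝ) < n + 1 := by positivity
    have e : bergmanCoeff ε (n + 1) = n * (1 - ε) / (ε * (n + 1)) * binomCoeff ε n := by
      have : binomCoeff ε (n + 1) = (ε + n) * binomCoeff ε n / (n + 1) := by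
        rw [← h]; field_simp
      rw [bergmanCoeff, this]
      field_simp
      ring
    rw [e]
    have : 0 ≤ 1 - ε := by linarith
    positivity

lemma hasSum_bergmanCoeff (ε : ℝ) {x : ℂ} (hx : ‖x‖ < 1) :
    HasSum (fun n => (bergmanCoeff ε n : ℂ) * x ^ n) ((1 / ε - x) * invPow ε x) := by
  have h := hasSum_binomCoeff ε hx
  rw [← hasSum_nat_add_iff' 1]
  have h1 := (hasSum_nat_add_iff' 1).mpr h
  refine hasSum_of_eq ((h1.mul_left (1 / (ε : ℂ))).sub (h.mul_left x)) (fun n => ?_) ?_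
  · simp only [bergmanCoeff]
    push_cast
    ring
  · simp [bergmanCoeff, binomCoeff_zero]
    ring

/-- Multiplication by `z` is bounded on the space with kernel `K^(lam, μ)`, of norm at most
`ε^(-1/2)` for small `ε`: the kernel is the product of `(1 - z w̄)^(-ε)` and a kernel of the same
family with `2 lam` replaced by `2 lam - ε`, and the coefficients of `(1/ε - x) (1 - x)^(-ε)` are
nonnegative. -/
theorem exists_isMultiplication {lam : ℝ} {μ : Fin 3 → ℝ} (h : Admissible 2 lam μ)
    [Fact (kernelOp 2 lam μ).PosSemidef] :
    ∃ M : Space 2 lam μ →L[ℂ] Space 2 lam μ, IsMultiplication 2 lam μ M := by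
  obtain ⟨ε, h0, h1, μ', h', hd⟩ := exists_admissible_sub h
  obtain ⟨e, he, -⟩ := exists_feature_of_hasSum (fun n (z : 𝔻) => columns (lam - ε / 2) μ' n z)
    (fun z w => kernel 2 (lam - ε / 2) μ' z w)
    fun z w => hasSum_columns h' (norm_mul_conj_lt_one z w)
  refine exists_multiplication (H := Space 2 lam μ) (fun z : 𝔻 => (z : ℂ))
    (Real.sqrt_nonneg (1 / ε)) (bergmanCoeff ε) (bergmanCoeff_nonneg h0 h1) _
    (fun z w => hasSum_bergmanCoeff ε (norm_mul_conj_lt_one z w)) e fun z w v => ?_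
  rw [he, RKHS.OfKernel.kernel_ofKernel, kernelOp, Matrix.of_apply, kernel_eq, kernel_eq, hd]
  have hs : ((√(1 / ε) : ℝ) : ℂ) ^ 2 = 1 / ε := by
    rw [← Complex.ofReal_pow, Real.sq_sqrt (one_div_pos.mpr h0).le]
    push_cast
    rfl
  have hp : invPow (2 * lam + 2) ((z : ℂ) * conj (w : ℂ)) =
      invPow ε ((z : ℂ) * conj (w : ℂ)) *
        invPow (2 * (lam - ε / 2) + 2) ((z : ℂ) * conj (w : ℂ)) := by
    rw [invPow, invPow, invPow, ← Complex.cpow_add _ _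
      (one_sub_ne_zero_of_norm_lt (norm_mul_conj_lt_one z w))]
    congr 1
    push_cast
    ring
  rw [hs, hp, map_smul, map_smul, smul_apply, smul_apply, smul_smul, smul_smul]
  congr 1
  ring

end KoranyiMisra

namespace KoranyiMisra

open RKHS

/-! ### Intertwiners of multiplication operators -/

section Space

variable {lam : ℝ} {μ : Fin 3 → ℝ} [Fact (kernelOp 2 lam μ).PosSemidef]
  {M : Space 2 lam μ →L[ℂ] Space 2 lam μ}

lemma IsMultiplication.pow_apply (hM : IsMultiplication 2 lam μ M) (n : ℕ) (f : Space 2 lam μ)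
    (z : 𝔻) : (M ^ n) f z = (z : ℂ) ^ n • f z := by
  induction n with
  | zero => simp
  | succ n ih => rw [pow_succ', mul_apply_eq_comp, hM, ih, smul_smul, pow_succ']

/-- The constants belong to the space, and together they are a cyclic set for the multiplication
operator: bounded operators which agree on all `zⁿ` times a constant are equal. -/
theorem exists_constants (h : Admissible 2 lam μ) (hM : IsMultiplication 2 lam μ M) :
    ∃ c : Fin 3 → Space 2 lam μ, (∀ i z, c i z = EuclideanSpace.single i 1) ∧
      ∀ {F : Type} [NormedAddCommGroup F] [NormedSpace ℂ F] (g₁ g₂ : Space 2 lam μ →L[ℂ] F),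
        (∀ n i, g₁ ((M ^ n) (c i)) = g₂ ((M ^ n) (c i))) → g₁ = g₂ := by
  obtain ⟨Φ, hΦ, hd⟩ := exists_dense_columns (H := Space 2 lam μ)
    (fun n (z : 𝔻) => columns lam μ n z) (fun z w => kernel 2 lam μ z w)
    (OfKernel.kernel_ofKernel (K := kernelOp 2 lam μ))
    fun z w => hasSum_columns h (norm_mul_conj_lt_one z w)
  have hw : ∀ i, (gammaWeight (2 * lam) μ 0 i : ℂ) ≠ 0 := fun i => by
    have h1 := (h.2.2 1).ne'
    have h2 := (h.2.2 2).ne'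
    fin_cases i <;> simp [gammaWeight, binomCoeff_zero, h1, h2]
  let c : Fin 3 → Space 2 lam μ := fun i =>
    (gammaWeight (2 * lam) μ 0 i : ℂ)⁻¹ • Φ 0 (EuclideanSpace.single i 1)
  have hc : ∀ i z, c i z = EuclideanSpace.single i 1 := fun i z => by
    have : columns lam μ 0 z = Matrix.diagonal fun j => (gammaWeight (2 * lam) μ 0 j : ℂ) := by
      have : gammaMatrix (2 * lam) 0 z = 1 := by
        ext i j
        fin_cases i <;> fin_cases j <;> simp [gammaMatrix]
      rw [columns, this, one_mul]
    have h1 := hΦ 0 (EuclideanSpace.single i 1) z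
    rw [this] at h1
    rw [coe_smul, Pi.smul_apply, h1]
    ext k
    rw [PiLp.smul_apply, Matrix.ofLp_toEuclideanCLM, Matrix.mulVec_diagonal]
    by_cases hk : k = i
    · subst hk
      simp [hw k]
    · simp [hk]
  refine ⟨c, hc, fun g₁ g₂ hg => hd g₁ g₂ fun n v => ?_⟩
  -- each column is a combination of the monomial vectors `zᵏ eᵢ = Mᵏ (c i)`
  let u : Fin 3 → ℂ := fun j => gammaWeight (2 * lam) μ n j * v j
  have hu : Φ n v = u 0 • (M ^ n) (c 0) +
      ((2 * lam - 2 : ℂ)⁻¹ * n * u 0) • (M ^ (n - 1)) (c 1) + u 1 • (M ^ n) (c 1) +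
      ((2 * lam - 2 : ℂ)⁻¹ * (2 * lam - 1 : ℂ)⁻¹ * (n * (n - 1)) * u 0) • (M ^ (n - 2)) (c 2) +
      (2 * (2 * lam : ℂ)⁻¹ * n * u 1) • (M ^ (n - 1)) (c 2) + u 2 • (M ^ n) (c 2) := by
    ext z : 1
    rw [hΦ]
    simp only [coe_add, coe_smul, Pi.add_apply, Pi.smul_apply, hM.pow_apply, hc]
    ext k
    rw [Matrix.ofLp_toEuclideanCLM, columns, ← Matrix.mulVec_mulVec]
    have : (Matrix.diagonal fun j => (gammaWeight (2 * lam) μ n j : ℂ)) *ᵥ v.ofLp = u := by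
      ext j
      rw [Matrix.mulVec_diagonal]
    rw [this]
    fin_cases k <;> simp [gammaMatrix, Matrix.mulVec, dotProduct, Fin.sum_univ_three] <;> ring
  rw [hu]
  simp only [map_add, map_smul, hg]

/-- An operator which intertwines two multiplication operators is itself the multiplication by a
matrix-valued function. -/
theorem exists_matrix_of_intertwines {lam' : ℝ} {μ' : Fin 3 → ℝ}
    [Fact (kernelOp 2 lam' μ').PosSemidef] {M' : Space 2 lam' μ' →L[ℂ] Space 2 lam' μ'}
    (h : Admissible 2 lam μ) (hM : IsMultiplication 2 lam μ M)
    (hM' : IsMultiplication 2 lam' μ' M') (U : Space 2 lam μ →L[ℂ] Space 2 lam' μ')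
    (hU : ∀ f, U (M f) = M' (U f)) :
    ∃ Φ : 𝔻 → Matrix (Fin 3) (Fin 3) ℂ,
      ∀ f z, U f z = Matrix.toEuclideanCLM (𝕜 := ℂ) (Φ z) (f z) := by
  obtain ⟨c, hc, hd⟩ := exists_constants h hM
  have hUn : ∀ n f, U ((M ^ n) f) = (M' ^ n) (U f) := fun n f => by
    induction n with
    | zero => simp
    | succ n ih => rw [pow_succ', mul_apply_eq_comp, hU, ih, pow_succ', mul_apply_eq_comp]
  let Φ : 𝔻 → Matrix (Fin 3) (Fin 3) ℂ := fun z => Matrix.of fun i j => U (c j) z i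
  refine ⟨Φ, fun f z => ?_⟩
  let g₁ : Space 2 lam μ →L[ℂ] EuclideanSpace ℂ (Fin 3) :=
    (RKHS.kerFun (Space 2 lam' μ') z).adjoint ∘L U
  let g₂ : Space 2 lam μ →L[ℂ] EuclideanSpace ℂ (Fin 3) :=
    Matrix.toEuclideanCLM (𝕜 := ℂ) (Φ z) ∘L (RKHS.kerFun (Space 2 lam μ) z).adjoint
  have : g₁ = g₂ := by
    refine hd g₁ g₂ fun n i => ?_
    simp only [g₁, g₂, ContinuousLinearMap.comp_apply, adjoint_kerFun, hUn, hM.pow_apply,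
      hM'.pow_apply, hc, map_smul]
    congr 1
    ext k
    simp [Matrix.ofLp_toEuclideanCLM, Φ]
  simpa [g₁, g₂] using DFunLike.congr_fun this f

end Space

end KoranyiMisra

namespace KoranyiMisra

open RKHS

/-! ### Quasi-invariance of the kernel -/

lemma mul_conj_of_norm_eq_one {c : ℂ} (hc : ‖c‖ = 1) : c * conj c = 1 := by
  rw [Complex.mul_conj, Complex.normSq_eq_norm_sq, hc]; norm_num

/-- The automorphism `z ↦ c (z - a) / (1 - ā z)` of the unit disc. -/
def moebius (c a z : ℂ) : ℂ := c * ((z - a) / (1 - conj a * z))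

/-- The matrix part of the cocycle of the automorphism `moebius c a`: with `t = ā / (1 - ā z)` and
`u` the derivative of the automorphism, it is `exp(t S) diag(1, u, u²)`. -/
def cocycleMatrix (c a z : ℂ) : Matrix (Fin 3) (Fin 3) ℂ :=
  let t := conj a / (1 - conj a * z)
  let u := c * ((1 - a * conj a) / (1 - conj a * z) ^ 2)
  !![1, 0, 0; t, u, 0; t ^ 2, 2 * t * u, u ^ 2]

lemma one_sub_moebius_mul_conj {c a z w : ℂ} (hc : c * conj c = 1) (hz : 1 - conj a * z ≠ 0)
    (hw : 1 - conj a * w ≠ 0) :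
    1 - moebius c a z * conj (moebius c a w) =
      (1 - a * conj a) * (1 - z * conj w) / ((1 - conj a * z) * conj (1 - conj a * w)) := by
  have hw' : 1 - a * conj w ≠ 0 := by
    have := (map_ne_zero (starRingEnd ℂ)).mpr hw
    simpa using this
  have hc0 : c ≠ 0 := left_ne_zero_of_mul_eq_one hc
  have hcc : conj c = c⁻¹ := eq_inv_of_mul_eq_one_right hc
  simp only [moebius, map_mul, map_div₀, map_sub, map_one, Complex.conj_conj, hcc]
  generalize conj a = A at *
  generalize conj w = W at *
  obtain ⟨q, hq⟩ : ∃ q, q = 1 - A * z := ⟨_, rfl⟩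
  obtain ⟨r, hr⟩ : ∃ r, r = 1 - a * W := ⟨_, rfl⟩
  rw [← hq] at hz ⊢
  rw [← hr] at hw' ⊢
  field_simp
  rw [hq, hr]
  ring

/-- The matrix cocycle carries the left factor of the kernel into itself, up to a scalar and a
diagonal matrix of the form `diag(1, v, v²)`. -/
lemma cocycleMatrix_mul_leftFactor {c a z w : ℂ} (hc : c * conj c = 1)
    (ha : 1 - a * conj a ≠ 0) (hz : 1 - conj a * z ≠ 0) (hw : 1 - conj a * w ≠ 0) :
    cocycleMatrix c a z * leftFactor (moebius c a z) (moebius c a w) =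
      ((1 - a * conj a) / ((1 - conj a * z) * conj (1 - conj a * w))) ^ 2 •
        (leftFactor z w * Matrix.diagonal fun l : Fin 3 =>
          (c * (conj (1 - conj a * w) / (1 - conj a * z))) ^ (l : ℕ)) := by
  have hw' : 1 - a * conj w ≠ 0 := by
    have := (map_ne_zero (starRingEnd ℂ)).mpr hw
    simpa using this
  have hX := one_sub_moebius_mul_conj hc hz hw
  have hc0 : c ≠ 0 := left_ne_zero_of_mul_eq_one hc
  have hcc : conj c = c⁻¹ := eq_inv_of_mul_eq_one_right hc
  have hm : conj (moebius c a w) = c⁻¹ * ((conj w - conj a) / (1 - a * conj w)) := by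
    simp only [moebius, map_mul, map_div₀, map_sub, map_one, Complex.conj_conj, hcc]
  have hL : leftFactor (moebius c a z) (moebius c a w) =
      !![(1 - moebius c a z * conj (moebius c a w)) ^ 2, 0, 0;
        (1 - moebius c a z * conj (moebius c a w)) * conj (moebius c a w),
          1 - moebius c a z * conj (moebius c a w), 0;
        conj (moebius c a w) ^ 2, 2 * conj (moebius c a w), 1] := rfl
  rw [hX, hm] at hL
  rw [hL]
  ext i j
  rw [Matrix.smul_apply, Matrix.mul_diagonal, Matrix.mul_apply, Fin.sum_univ_three]
  simp only [cocycleMatrix, leftFactor, map_sub, map_one, map_mul, Complex.conj_conj]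
  generalize conj a = A at *
  generalize conj w = W at *
  obtain ⟨q, hq⟩ : ∃ q, q = 1 - A * z := ⟨_, rfl⟩
  obtain ⟨r, hr⟩ : ∃ r, r = 1 - a * W := ⟨_, rfl⟩
  obtain ⟨s, hs⟩ : ∃ s, s = 1 - a * A := ⟨_, rfl⟩
  rw [← hq] at hz ⊢
  rw [← hr] at hw' ⊢
  rw [← hs] at ha ⊢
  fin_cases i <;> fin_cases j <;> simp <;> field_simp <;> simp only [hq] <;> ring

/-- Quasi-invariance of the polynomial part of the kernel. The diagonal matrices `diag(1, v, v²)`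
produced by the two left factors commute with `diag(d)` and cancel, one being the inverse adjoint of
the other. -/
lemma polyKernel_moebius (d : Fin 3 → ℝ) {c a z w : ℂ} (hc : c * conj c = 1)
    (ha : 1 - a * conj a ≠ 0) (hz : 1 - conj a * z ≠ 0) (hw : 1 - conj a * w ≠ 0) :
    cocycleMatrix c a z * polyKernel d (moebius c a z) (moebius c a w) * (cocycleMatrix c a w)ᴴ =
      ((1 - a * conj a) / ((1 - conj a * z) * conj (1 - conj a * w))) ^ 4 •
        polyKernel d z w := by
  have h1 := cocycleMatrix_mul_leftFactor hc ha hz hw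
  have h2 := cocycleMatrix_mul_leftFactor hc ha hw hz
  have e : cocycleMatrix c a z * polyKernel d (moebius c a z) (moebius c a w) *
        (cocycleMatrix c a w)ᴴ =
      (cocycleMatrix c a z * leftFactor (moebius c a z) (moebius c a w)) *
        Matrix.diagonal (fun l => (d l : ℂ)) *
        (cocycleMatrix c a w * leftFactor (moebius c a w) (moebius c a z))ᴴ := by
    rw [polyKernel, Matrix.conjTranspose_mul]
    simp only [Matrix.mul_assoc]
  have hz' := (map_ne_zero (starRingEnd ℂ)).mpr hz
  have hw' := (map_ne_zero (starRingEnd ℂ)).mpr hw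
  have hE : (Matrix.diagonal fun l : Fin 3 =>
        (c * (conj (1 - conj a * w) / (1 - conj a * z))) ^ (l : ℕ)) *
        Matrix.diagonal (fun l => (d l : ℂ)) *
        (Matrix.diagonal fun l : Fin 3 =>
          (c * (conj (1 - conj a * z) / (1 - conj a * w))) ^ (l : ℕ))ᴴ =
      Matrix.diagonal (fun l => (d l : ℂ)) := by
    rw [Matrix.diagonal_conjTranspose, Matrix.diagonal_mul_diagonal,
      Matrix.diagonal_mul_diagonal]
    congr 1
    funext l
    have : c * (conj (1 - conj a * w) / (1 - conj a * z)) *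
        conj (c * (conj (1 - conj a * z) / (1 - conj a * w))) = 1 := by
      rw [map_mul, map_div₀, Complex.conj_conj]
      calc _ = (c * conj c) * ((conj (1 - conj a * w) / conj (1 - conj a * w)) *
            ((1 - conj a * z) / (1 - conj a * z))) := by ring
        _ = 1 := by rw [hc, div_self hw', div_self hz]; ring
    have h3 := congrArg (fun u => u ^ (l : ℕ)) this
    simp only [mul_pow, one_pow] at h3
    simp only [Pi.star_apply, RCLike.star_def, mul_pow, map_mul, map_pow] at h3 ⊢
    linear_combination (d l : ℂ) * h3
  rw [e, h1, h2, Matrix.conjTranspose_smul, Matrix.conjTranspose_mul]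
  simp only [Matrix.smul_mul, Matrix.mul_smul, smul_smul, polyKernel]
  congr 1
  · simp only [star_pow, RCLike.star_def, map_div₀, map_mul, map_sub, map_one, Complex.conj_conj]
    ring
  · conv_rhs => rw [← hE]
    simp only [Matrix.mul_assoc]

lemma re_one_sub_pos {x : ℂ} (hx : ‖x‖ < 1) : 0 < (1 - x).re := by
  have := (Complex.abs_re_le_norm x).trans_lt hx
  rw [Complex.sub_re, Complex.one_re]
  linarith [le_abs_self x.re]

/-- Two numbers with the same exponential are equal if their imaginary parts differ by less
than `2 π`. -/
lemma eq_of_exp_eq_of_abs_im_lt {u v : ℂ} (h : Complex.exp u = Complex.exp v)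
    (him : |u.im - v.im| < 2 * Real.pi) : u = v := by
  obtain ⟨n, hn⟩ := Complex.exp_eq_exp_iff_exists_int.mp h
  have h1 : u.im - v.im = n * (2 * Real.pi) := by
    rw [hn]
    simp
  rw [h1, abs_mul, abs_of_pos Real.two_pi_pos] at him
  have h2 : |(n : ℝ)| < 1 := by
    by_contra hcon
    push Not at hcon
    nlinarith [Real.two_pi_pos]
  have h3 : n = 0 := by
    rw [← Int.cast_abs] at h2
    exact Int.abs_lt_one_iff.mp (by exact_mod_cast h2)
  simpa [h3] using hn

lemma abs_log_im_lt {x : ℂ} (hx : ‖x‖ < 1) : |(Complex.log (1 - x)).im| < Real.pi / 2 := by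
  rw [Complex.log_im]
  exact Complex.abs_arg_lt_pi_div_two_iff.mpr (Or.inl (re_one_sub_pos hx))

/-- The scalar part `(1 - a ā)^(β/2) (1 - ā z)^(-β)` of the cocycle of `moebius c a`. -/
def cocycleScalar (β : ℝ) (a z : ℂ) : ℂ :=
  Complex.exp (β / 2 * Complex.log (1 - a * conj a) - β * Complex.log (1 - conj a * z))

lemma norm_conj_mul_lt {a z : ℂ} (ha : ‖a‖ < 1) (hz : ‖z‖ < 1) : ‖conj a * z‖ < 1 := by
  rw [norm_mul, Complex.norm_conj]
  exact mul_lt_one_of_nonneg_of_lt_one_left (norm_nonneg _) ha hz.le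

lemma one_sub_mul_conj_ne_zero {a : ℂ} (ha : ‖a‖ < 1) : 1 - a * conj a ≠ 0 :=
  one_sub_ne_zero_of_norm_lt (by
    rw [mul_comm]
    exact norm_conj_mul_lt ha ha)

lemma one_sub_mul_conj_eq (a : ℂ) : 1 - a * conj a = ((1 - ‖a‖ ^ 2 : ℝ) : ℂ) := by
  rw [Complex.mul_conj, Complex.normSq_eq_norm_sq]
  push_cast
  rfl

lemma norm_moebius_lt_one {c a z : ℂ} (hc : ‖c‖ = 1) (ha : ‖a‖ < 1) (hz : ‖z‖ < 1) :
    ‖moebius c a z‖ < 1 := by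
  have hq := one_sub_ne_zero_of_norm_lt (norm_conj_mul_lt ha hz)
  have hcc := mul_conj_of_norm_eq_one hc
  have h := one_sub_moebius_mul_conj hcc hq hq
  rw [one_sub_mul_conj_eq, one_sub_mul_conj_eq, one_sub_mul_conj_eq, Complex.mul_conj,
    Complex.normSq_eq_norm_sq] at h
  have h' : 1 - ‖moebius c a z‖ ^ 2 = (1 - ‖a‖ ^ 2) * (1 - ‖z‖ ^ 2) / ‖1 - conj a * z‖ ^ 2 := by
    exact_mod_cast h
  have h1 : 0 < 1 - ‖a‖ ^ 2 := by nlinarith [norm_nonneg a]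
  have h2 : 0 < 1 - ‖z‖ ^ 2 := by nlinarith [norm_nonneg z]
  have h3 : 0 < ‖1 - conj a * z‖ := norm_pos_iff.mpr hq
  have h4 : 0 < 1 - ‖moebius c a z‖ ^ 2 := by rw [h']; positivity
  nlinarith [norm_nonneg (moebius c a z)]

/-- The identity `one_sub_moebius_mul_conj`, in terms of principal logarithms. It holds without a
multiple of `2 π i`, since the logarithm of `1 - a ā` is real and each of the other four has an
imaginary part of absolute value less than `π / 2`. -/
lemma log_one_sub_moebius {c a z w : ℂ} (hc : ‖c‖ = 1) (ha : ‖a‖ < 1) (hz : ‖z‖ < 1)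
    (hw : ‖w‖ < 1) :
    Complex.log (1 - moebius c a z * conj (moebius c a w)) +
        (Complex.log (1 - conj a * z) + conj (Complex.log (1 - conj a * w))) =
      Complex.log (1 - a * conj a) + Complex.log (1 - z * conj w) := by
  have hq := one_sub_ne_zero_of_norm_lt (norm_conj_mul_lt ha hz)
  have hr := one_sub_ne_zero_of_norm_lt (norm_conj_mul_lt ha hw)
  have hcc := mul_conj_of_norm_eq_one hc
  have hX : ‖moebius c a z * conj (moebius c a w)‖ < 1 := by
    rw [mul_comm]
    exact norm_conj_mul_lt (norm_moebius_lt_one hc ha hw) (norm_moebius_lt_one hc ha hz)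
  have hx : ‖z * conj w‖ < 1 := by
    rw [mul_comm]
    exact norm_conj_mul_lt hw hz
  have haa := one_sub_mul_conj_ne_zero ha
  refine eq_of_exp_eq_of_abs_im_lt ?_ ?_
  · rw [Complex.exp_add, Complex.exp_add, Complex.exp_add, Complex.exp_conj,
      Complex.exp_log (one_sub_ne_zero_of_norm_lt hX), Complex.exp_log hq, Complex.exp_log hr,
      Complex.exp_log haa,
      Complex.exp_log (one_sub_ne_zero_of_norm_lt hx), one_sub_moebius_mul_conj hcc hq hr]
    exact div_mul_cancel₀ _ (mul_ne_zero hq ((map_ne_zero (starRingEnd ℂ)).mpr hr))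
  · have h1 := abs_log_im_lt hX
    have h2 := abs_log_im_lt (norm_conj_mul_lt ha hz)
    have h3 := abs_log_im_lt (norm_conj_mul_lt ha hw)
    have h4 := abs_log_im_lt hx
    have h5 : (Complex.log (1 - a * conj a)).im = 0 := by
      rw [one_sub_mul_conj_eq, ← Complex.ofReal_log (by nlinarith [norm_nonneg a]),
        Complex.ofReal_im]
    simp only [Complex.add_im, Complex.conj_im, h5]
    rw [abs_lt] at *
    constructor <;> linarith

/-- Quasi-invariance of the scalar factor of the kernel. The fourth power on the left is the scalar
produced by `polyKernel_moebius`. -/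
lemma cocycleScalar_mul {β : ℝ} {c a z w : ℂ} (hc : ‖c‖ = 1) (ha : ‖a‖ < 1) (hz : ‖z‖ < 1)
    (hw : ‖w‖ < 1) :
    cocycleScalar β a z * invPow (β + 4) (moebius c a z * conj (moebius c a w)) *
        conj (cocycleScalar β a w) *
        ((1 - a * conj a) / ((1 - conj a * z) * conj (1 - conj a * w))) ^ 4 =
      invPow (β + 4) (z * conj w) := by
  have hq := one_sub_ne_zero_of_norm_lt (norm_conj_mul_lt ha hz)
  have hr := one_sub_ne_zero_of_norm_lt (norm_conj_mul_lt ha hw)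
  have hX : ‖moebius c a z * conj (moebius c a w)‖ < 1 := by
    rw [mul_comm]
    exact norm_conj_mul_lt (norm_moebius_lt_one hc ha hw) (norm_moebius_lt_one hc ha hz)
  have hx : ‖z * conj w‖ < 1 := by
    rw [mul_comm]
    exact norm_conj_mul_lt hw hz
  have haa := one_sub_mul_conj_ne_zero ha
  have hl := log_one_sub_moebius hc ha hz hw
  have hf : (1 - a * conj a) / ((1 - conj a * z) * conj (1 - conj a * w)) =
      Complex.exp (Complex.log (1 - a * conj a) -
        (Complex.log (1 - conj a * z) + conj (Complex.log (1 - conj a * w)))) := by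
    rw [Complex.exp_sub, Complex.exp_add, Complex.exp_conj,
      Complex.exp_log haa, Complex.exp_log hq, Complex.exp_log hr]
  have h5 : conj (Complex.log (1 - a * conj a)) = Complex.log (1 - a * conj a) := by
    rw [one_sub_mul_conj_eq, ← Complex.ofReal_log (by nlinarith [norm_nonneg a]),
      Complex.conj_ofReal]
  have h6 : conj (cocycleScalar β a w) = Complex.exp (β / 2 * Complex.log (1 - a * conj a) -
      β * conj (Complex.log (1 - conj a * w))) := by
    rw [cocycleScalar, ← Complex.exp_conj]
    simp only [map_sub, map_mul, map_div₀, h5, Complex.conj_ofReal, map_ofNat]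
  rw [hf, h6, cocycleScalar, invPow, invPow,
    Complex.cpow_def_of_ne_zero (one_sub_ne_zero_of_norm_lt hX),
    Complex.cpow_def_of_ne_zero (one_sub_ne_zero_of_norm_lt hx), ← Complex.exp_nat_mul,
    ← Complex.exp_add, ← Complex.exp_add, ← Complex.exp_add]
  congr 1
  push_cast
  linear_combination (-(β : ℂ) - 4) * hl

/-- The cocycle of the automorphism `moebius c a` for the kernel `K^(lam, μ)`; it does not depend
on `μ`. -/
def cocycle (lam : ℝ) (c a z : ℂ) : Matrix (Fin 3) (Fin 3) ℂ :=
  cocycleScalar (2 * lam - 2) a z • cocycleMatrix c a z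

/-- Quasi-invariance of the kernel under the automorphisms of the disc. -/
theorem kernel_moebius (lam : ℝ) (μ : Fin 3 → ℝ) {c a z w : ℂ} (hc : ‖c‖ = 1) (ha : ‖a‖ < 1)
    (hz : ‖z‖ < 1) (hw : ‖w‖ < 1) :
    cocycle lam c a z * kernel 2 lam μ (moebius c a z) (moebius c a w) * (cocycle lam c a w)ᴴ =
      kernel 2 lam μ z w := by
  have hq := one_sub_ne_zero_of_norm_lt (norm_conj_mul_lt ha hz)
  have hr := one_sub_ne_zero_of_norm_lt (norm_conj_mul_lt ha hw)
  have haa := one_sub_mul_conj_ne_zero ha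
  have hcc := mul_conj_of_norm_eq_one hc
  have h1 := polyKernel_moebius (vecD 2 lam μ) hcc haa hq hr
  have h2 := cocycleScalar_mul (β := 2 * lam - 2) hc ha hz hw
  rw [show 2 * lam - 2 + 4 = 2 * lam + 2 by ring] at h2
  rw [kernel_eq, kernel_eq, cocycle, cocycle, Matrix.conjTranspose_smul]
  simp only [Matrix.smul_mul, Matrix.mul_smul, h1, smul_smul]
  rw [← h2]
  congr 1
  simp only [RCLike.star_def]
  ring

end KoranyiMisra

namespace KoranyiMisra

open RKHS

/-! ### Homogeneity -/

lemma moebius_inverse {c a z : ℂ} (hc : ‖c‖ = 1) (ha : ‖a‖ < 1) (hz : ‖z‖ < 1) :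
    moebius (conj c) (-(c * a)) (moebius c a z) = z := by
  have hq := one_sub_ne_zero_of_norm_lt (norm_conj_mul_lt ha hz)
  have hs := one_sub_mul_conj_ne_zero ha
  have hcc := mul_conj_of_norm_eq_one hc
  simp only [moebius, map_neg, map_mul]
  have h1 : c * ((z - a) / (1 - conj a * z)) - -(c * a) =
      c * z * ((1 - a * conj a) / (1 - conj a * z)) := by
    rw [← mul_div_assoc, ← mul_div_assoc, sub_neg_eq_add, div_add' _ _ _ hq]
    congr 1
    ring
  have h2 : 1 - -(conj c * conj a) * (c * ((z - a) / (1 - conj a * z))) =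
      (1 - a * conj a) / (1 - conj a * z) := by
    rw [show 1 - -(conj c * conj a) * (c * ((z - a) / (1 - conj a * z))) =
      1 + (c * conj c) * conj a * ((z - a) / (1 - conj a * z)) by ring, hcc]
    field_simp
    ring
  rw [h1, h2, mul_div_cancel_right₀ _ (div_ne_zero hs hq)]
  linear_combination z * hcc

/-- The automorphism `moebius c a` as a permutation of the unit disc. -/
def moebiusEquiv (c a : ℂ) (hc : ‖c‖ = 1) (ha : ‖a‖ < 1) : 𝔻 ≃ 𝔻 where
  toFun z := Complex.UnitDisc.mk (moebius c a z) (norm_moebius_lt_one hc ha z.norm_lt_one)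
  invFun z := Complex.UnitDisc.mk (moebius (conj c) (-(c * a)) z)
    (norm_moebius_lt_one (by rwa [Complex.norm_conj]) (by simpa [hc] using ha) z.norm_lt_one)
  left_inv z := by
    ext
    simpa using moebius_inverse hc ha z.norm_lt_one
  right_inv z := by
    ext
    have h := moebius_inverse (c := conj c) (a := -(c * a)) (by rwa [Complex.norm_conj])
      (by simpa [hc] using ha) z.norm_lt_one
    rw [Complex.conj_conj, mul_neg, neg_neg, ← mul_assoc, mul_comm (conj c),
      mul_conj_of_norm_eq_one hc, one_mul] at h
    simpa using h

lemma coe_moebiusEquiv {c a : ℂ} (hc : ‖c‖ = 1) (ha : ‖a‖ < 1) (z : 𝔻) :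
    (moebiusEquiv c a hc ha z : ℂ) = moebius c a z := rfl

lemma isUnit_cocycle (lam : ℝ) {c a z : ℂ} (hc : ‖c‖ = 1) (ha : ‖a‖ < 1) (hz : ‖z‖ < 1) :
    IsUnit (cocycle lam c a z) := by
  have hq := one_sub_ne_zero_of_norm_lt (norm_conj_mul_lt ha hz)
  have hs := one_sub_mul_conj_ne_zero ha
  have hc0 : c ≠ 0 := left_ne_zero_of_mul_eq_one (mul_conj_of_norm_eq_one hc)
  rw [Matrix.isUnit_iff_isUnit_det, isUnit_iff_ne_zero, cocycle, Matrix.det_smul]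
  refine mul_ne_zero (pow_ne_zero _ (Complex.exp_ne_zero _)) ?_
  have : (cocycleMatrix c a z).det = (c * ((1 - a * conj a) / (1 - conj a * z) ^ 2)) ^ 3 := by
    rw [cocycleMatrix, Matrix.det_fin_three]
    simp
    ring
  rw [this]
  exact pow_ne_zero _ (mul_ne_zero hc0 (div_ne_zero hs (pow_ne_zero _ hq)))

section Space

variable {lam : ℝ} {μ : Fin 3 → ℝ} [Fact (kernelOp 2 lam μ).PosSemidef]
  {M : Space 2 lam μ →L[ℂ] Space 2 lam μ}

/-- Every automorphism of the disc defines a unitary weighted composition operator. -/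
theorem exists_unitary_moebius (lam : ℝ) (μ : Fin 3 → ℝ) [Fact (kernelOp 2 lam μ).PosSemidef]
    {c a : ℂ} (hc : ‖c‖ = 1) (ha : ‖a‖ < 1) :
    ∃ (U : Space 2 lam μ ≃ₗᵢ[ℂ] Space 2 lam μ)
      (J : 𝔻 → EuclideanSpace ℂ (Fin 3) →L[ℂ] EuclideanSpace ℂ (Fin 3)),
      ∀ f z, U f z = J z (f (moebiusEquiv c a hc ha z)) := by
  have hu : ∀ z : 𝔻, IsUnit (Matrix.toEuclideanCLM (𝕜 := ℂ) (cocycle lam c a z)) := fun z =>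
    (isUnit_cocycle lam hc ha z.norm_lt_one).map (Matrix.toEuclideanCLM (𝕜 := ℂ))
  have hJ : ∀ z : 𝔻, ((ContinuousLinearEquiv.ofUnit (hu z).unit :
      EuclideanSpace ℂ (Fin 3) ≃L[ℂ] EuclideanSpace ℂ (Fin 3)) :
      EuclideanSpace ℂ (Fin 3) →L[ℂ] EuclideanSpace ℂ (Fin 3)) =
      Matrix.toEuclideanCLM (𝕜 := ℂ) (cocycle lam c a z) := fun z => rfl
  obtain ⟨U, hU⟩ := exists_weighted_composition (H := Space 2 lam μ) (moebiusEquiv c a hc ha)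
    (fun z => ContinuousLinearEquiv.ofUnit (hu z).unit) fun z w => by
      simp only [hJ]
      rw [OfKernel.kernel_ofKernel, kernelOp, Matrix.of_apply, Matrix.of_apply,
        toEuclideanCLM_adjoint, coe_moebiusEquiv, coe_moebiusEquiv,
        ← kernel_moebius lam μ hc ha z.norm_lt_one w.norm_lt_one, map_mul, map_mul]
      rfl
  exact ⟨U, _, hU⟩

/-- `1 - ā M` is invertible. The unitary of the automorphism `ψ = moebius 1 a` conjugates `M` to the
multiplication by `ψ`, and `(1 + ā ψ) (1 - ā z) = 1 - |a|²`. -/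
lemma IsMultiplication.isUnit_one_sub (hM : IsMultiplication 2 lam μ M) {a : ℂ} (ha : ‖a‖ < 1) :
    IsUnit (1 - conj a • M) := by
  obtain ⟨U, J, hU⟩ := exists_unitary_moebius lam μ norm_one ha
  have hs := one_sub_mul_conj_ne_zero ha
  let T : Space 2 lam μ →L[ℂ] Space 2 lam μ :=
    (U : Space 2 lam μ →L[ℂ] Space 2 lam μ) ∘L M ∘L
      (U.symm : Space 2 lam μ →L[ℂ] Space 2 lam μ)
  have hT : ∀ f z, T f z = moebius 1 a z • f z := fun f z => by
    have h1 : T f z = U (M (U.symm f)) z := rfl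
    have h2 : f z = U (U.symm f) z := by rw [U.apply_symm_apply]
    rw [h1, h2, hU, hU, hM, map_smul, coe_moebiusEquiv]
  have key : ∀ z : 𝔻, (1 - a * conj a)⁻¹ * (1 + conj a * moebius 1 a z) * (1 - conj a * z) = 1 :=
    fun z => by
      have hq := one_sub_ne_zero_of_norm_lt (norm_conj_mul_lt ha z.norm_lt_one)
      rw [moebius]
      field_simp
      ring
  let N : Space 2 lam μ →L[ℂ] Space 2 lam μ := (1 - a * conj a)⁻¹ • (1 + conj a • T)
  have hN : ∀ f z, N f z = ((1 - a * conj a)⁻¹ * (1 + conj a * moebius 1 a z)) • f z :=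
    fun f z => by
      simp only [N, smul_apply, add_apply, one_apply_eq_self, coe_smul, coe_add, Pi.smul_apply,
        Pi.add_apply, hT]
      module
  have hL : ∀ f z, (1 - conj a • M) f z = (1 - conj a * z) • f z := fun f z => by
    simp only [smul_apply, sub_apply, one_apply_eq_self, coe_smul, coe_sub, Pi.smul_apply,
      Pi.sub_apply, hM f z]
    module
  refine isUnit_iff_exists.mpr ⟨N, ?_, ?_⟩
  · ext f z : 2
    rw [mul_apply_eq_comp, hL, hN, smul_smul, mul_comm, key, one_smul]
    rfl
  · ext f z : 2
    rw [mul_apply_eq_comp, hN, hL, smul_smul, key, one_smul]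
    rfl

/-- The multiplication operator is homogeneous: the spectrum is in the closed disc because
`1 - ā M` is invertible for `|a| < 1`, and the weighted composition operator of an automorphism
`φ` intertwines `M` and `φ(M)`, the multiplication by `φ`. -/
theorem IsMultiplication.isHomogeneousOperator (hM : IsMultiplication 2 lam μ M) :
    IsHomogeneousOperator M := by
  refine ⟨fun k hk => ?_, fun c a hc ha => ?_⟩
  · by_contra hcon
    rw [mem_closedBall_zero_iff, not_le] at hcon
    have hk0 : k ≠ 0 := norm_pos_iff.mp (one_pos.trans hcon)
    have h := hM.isUnit_one_sub (a := conj k⁻¹) (by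
      rw [Complex.norm_conj, norm_inv]
      exact inv_lt_one_of_one_lt₀ hcon)
    refine hk ?_
    have h2 : algebraMap ℂ (Space 2 lam μ →L[ℂ] Space 2 lam μ) k - M =
        algebraMap ℂ (Space 2 lam μ →L[ℂ] Space 2 lam μ) k * (1 - conj (conj k⁻¹) • M) := by
      rw [Complex.conj_conj, Algebra.algebraMap_eq_smul_one, mul_sub, mul_one, smul_one_mul,
        smul_smul, mul_inv_cancel₀ hk0, one_smul]
    rw [spectrum.mem_resolventSet_iff, h2]
    exact ((isUnit_iff_ne_zero.mpr hk0).map _).mul h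
  · obtain ⟨U, J, hU⟩ := exists_unitary_moebius lam μ hc ha
    have hu := hM.isUnit_one_sub ha
    set R := Ring.inverse (1 - conj a • M)
    have hR : (1 - conj a • M) * R = 1 := Ring.mul_inverse_cancel _ hu
    refine ⟨U.symm, fun f => U.injective ?_⟩
    rw [U.apply_symm_apply]
    ext z : 1
    have hq := one_sub_ne_zero_of_norm_lt (norm_conj_mul_lt ha z.norm_lt_one)
    have h1 : f z = (1 - conj a * z) • R f z := by
      conv_lhs => rw [← one_apply_eq_self (F := Space 2 lam μ →L[ℂ] Space 2 lam μ) f, ← hR]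
      simp only [mul_apply_eq_comp, smul_apply, sub_apply, one_apply_eq_self, coe_smul, coe_sub,
        Pi.smul_apply, Pi.sub_apply, hM _ z]
      module
    rw [hU, hM, map_smul, coe_moebiusEquiv, ← hU, U.apply_symm_apply]
    simp only [mul_apply_eq_comp, smul_apply, sub_apply, one_apply_eq_self, coe_smul, coe_sub,
        Pi.smul_apply, Pi.sub_apply, hM _ z]
    rw [h1, ← sub_smul, smul_smul, smul_smul]
    congr 1
    rw [moebius, mul_assoc, div_mul_cancel₀ _ hq]

end Space

end KoranyiMisra

namespace KoranyiMisra

/-! ### The normalized kernel and its intertwiners -/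

/-- The kernel `K(z, 0)⁻¹ K(z, w) K(0, w)⁻¹ K(0, 0)` without its scalar factor
`(1 - z w̄)^(-2 lam - 2)`. It is similar, through `K(0, 0)^(1/2)`, to the normalized kernel, and a
matrix function which transforms one kernel into another acts on it through a constant matrix. -/
def reducedKernel (d : Fin 3 → ℝ) (z w : ℂ) : Matrix (Fin 3) (Fin 3) ℂ :=
  (polyKernel d z 0)⁻¹ * polyKernel d z w * (polyKernel d 0 w)⁻¹ *
    Matrix.diagonal fun l => (d l : ℂ)

/-- `exp(z S*)`. -/
def expBackward (z : ℂ) : Matrix (Fin 3) (Fin 3) ℂ :=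
  !![1, z, z ^ 2; 0, 1, 2 * z; 0, 0, 1]

lemma expBackward_neg_mul (z : ℂ) : expBackward (-z) * expBackward z = 1 := by
  ext i j
  fin_cases i <;> fin_cases j <;> simp [expBackward, Matrix.mul_apply, Fin.sum_univ_three]
  ring

lemma polyKernel_conjTranspose (d : Fin 3 → ℝ) (z w : ℂ) :
    (polyKernel d z w)ᴴ = polyKernel d w z := by
  simp only [polyKernel, Matrix.conjTranspose_mul, Matrix.conjTranspose_conjTranspose,
    Matrix.diagonal_conjTranspose, Matrix.mul_assoc]
  congr 3
  ext l
  simp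

lemma polyKernel_zero_right (d : Fin 3 → ℝ) (z : ℂ) :
    polyKernel d z 0 = Matrix.diagonal (fun l => (d l : ℂ)) * expBackward z := by
  ext i j
  fin_cases i <;> fin_cases j <;>
    simp [polyKernel, leftFactor, expBackward, Matrix.mul_apply, Fin.sum_univ_three,
      Matrix.vecMul_diagonal, map_ofNat]

lemma polyKernel_zero_zero (d : Fin 3 → ℝ) :
    polyKernel d 0 0 = Matrix.diagonal (fun l => (d l : ℂ)) := by
  rw [polyKernel_zero_right]
  have : expBackward 0 = 1 := by
    ext i j
    fin_cases i <;> fin_cases j <;> simp [expBackward]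
  rw [this, mul_one]

lemma inv_mul_polyKernel {d : Fin 3 → ℝ} (hd : ∀ l, 0 < d l) (z : ℂ) :
    (expBackward (-z) * Matrix.diagonal fun l => (d l : ℂ)⁻¹) * polyKernel d z 0 = 1 := by
  have h : (Matrix.diagonal fun l => (d l : ℂ)⁻¹) * (Matrix.diagonal fun l => (d l : ℂ)) = 1 := by
    rw [Matrix.diagonal_mul_diagonal, ← Matrix.diagonal_one]
    congr 1
    funext l
    exact inv_mul_cancel₀ (by exact_mod_cast (hd l).ne')
  rw [polyKernel_zero_right, Matrix.mul_assoc, ← Matrix.mul_assoc (Matrix.diagonal _), h, one_mul,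
    expBackward_neg_mul]

lemma inv_polyKernel {d : Fin 3 → ℝ} (hd : ∀ l, 0 < d l) (z : ℂ) :
    (polyKernel d z 0)⁻¹ = expBackward (-z) * Matrix.diagonal fun l => (d l : ℂ)⁻¹ :=
  Matrix.inv_eq_left_inv (inv_mul_polyKernel hd z)

lemma inv_polyKernel_mul_leftFactor {d : Fin 3 → ℝ} (hd : ∀ l, 0 < d l) (z w : ℂ) :
    (polyKernel d z 0)⁻¹ * leftFactor z w =
      !![(d 0 : ℂ)⁻¹ * (1 - z * conj w) ^ 2 - (d 1 : ℂ)⁻¹ * (z * conj w) * (1 - z * conj w) +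
          (d 2 : ℂ)⁻¹ * (z * conj w) ^ 2,
        z * (2 * (d 2 : ℂ)⁻¹ * (z * conj w) - (d 1 : ℂ)⁻¹ * (1 - z * conj w)), z ^ 2 * (d 2 : ℂ)⁻¹;
        conj w * ((d 1 : ℂ)⁻¹ * (1 - z * conj w) - 2 * (d 2 : ℂ)⁻¹ * (z * conj w)),
        (d 1 : ℂ)⁻¹ * (1 - z * conj w) - 4 * (d 2 : ℂ)⁻¹ * (z * conj w), -(2 * z * (d 2 : ℂ)⁻¹);
        (conj w) ^ 2 * (d 2 : ℂ)⁻¹, 2 * conj w * (d 2 : ℂ)⁻¹, (d 2 : ℂ)⁻¹] := by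
  rw [inv_polyKernel hd]
  ext i j
  fin_cases i <;> fin_cases j <;>
    simp [leftFactor, expBackward, Matrix.mul_apply, Fin.sum_univ_three,
      Matrix.vecMul_diagonal] <;>
    ring

lemma reducedKernel_eq (d : Fin 3 → ℝ) (z w : ℂ) :
    reducedKernel d z w =
      ((polyKernel d z 0)⁻¹ * leftFactor z w) * Matrix.diagonal (fun l => (d l : ℂ)) *
        ((polyKernel d w 0)⁻¹ * leftFactor w z)ᴴ * Matrix.diagonal fun l => (d l : ℂ) := by
  rw [reducedKernel, Matrix.conjTranspose_mul, Matrix.conjTranspose_nonsing_inv,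
    polyKernel_conjTranspose, polyKernel.eq_1 d z w]
  simp only [Matrix.mul_assoc]

section Entries

variable {d : Fin 3 → ℝ}

lemma reducedKernel_apply (d : Fin 3 → ℝ) (t : ℝ) (i j : Fin 3) :
    reducedKernel d t t i j =
      ∑ k, ((polyKernel d t 0)⁻¹ * leftFactor t t) i k * d k *
        conj (((polyKernel d t 0)⁻¹ * leftFactor t t) j k) * d j := by
  rw [reducedKernel_eq, Matrix.mul_diagonal, Matrix.mul_apply, Finset.sum_mul]
  refine Finset.sum_congr rfl fun k _ => ?_
  rw [Matrix.mul_diagonal, Matrix.conjTranspose_apply]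
  rfl

lemma reducedKernel_zero_zero (hd : ∀ l, 0 < d l) (h0 : d 0 = 1) (t : ℝ) :
    reducedKernel d t t 0 0 = 1 + (-4 - (d 1 : ℂ)⁻¹) * t ^ 2 +
      ((2 + (d 1 : ℂ)⁻¹) ^ 2 + 2 * (1 + (d 1 : ℂ)⁻¹ + (d 2 : ℂ)⁻¹) -
        2 * ((d 1 : ℂ)⁻¹ + 2 * (d 2 : ℂ)⁻¹) + (d 2 : ℂ)⁻¹) * t ^ 4 +
      (d 1 * ((d 1 : ℂ)⁻¹ + 2 * (d 2 : ℂ)⁻¹) ^ 2 -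
        2 * (2 + (d 1 : ℂ)⁻¹) * (1 + (d 1 : ℂ)⁻¹ + (d 2 : ℂ)⁻¹)) * t ^ 6 +
      (1 + (d 1 : ℂ)⁻¹ + (d 2 : ℂ)⁻¹) ^ 2 * t ^ 8 := by
  have h1 : (d 1 : ℂ) ≠ 0 := by exact_mod_cast (hd 1).ne'
  have h2 : (d 2 : ℂ) ≠ 0 := by exact_mod_cast (hd 2).ne'
  rw [reducedKernel_apply d, inv_polyKernel_mul_leftFactor hd, Fin.sum_univ_three]
  simp [h0, map_ofNat]
  field_simp
  ring

lemma reducedKernel_one_one (hd : ∀ l, 0 < d l) (h0 : d 0 = 1) (t : ℝ) :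
    reducedKernel d t t 1 1 = 1 + ((d 1 : ℂ)⁻¹ - 2 - 4 * d 1 * (d 2 : ℂ)⁻¹) * t ^ 2 +
      (d 1 ^ 2 * ((d 1 : ℂ)⁻¹ + 4 * (d 2 : ℂ)⁻¹) ^ 2 - 2 * ((d 1 : ℂ)⁻¹ + 2 * (d 2 : ℂ)⁻¹)) *
        t ^ 4 +
      d 1 * ((d 1 : ℂ)⁻¹ + 2 * (d 2 : ℂ)⁻¹) ^ 2 * t ^ 6 + 0 * t ^ 8 := by
  have h1 : (d 1 : ℂ) ≠ 0 := by exact_mod_cast (hd 1).ne'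
  have h2 : (d 2 : ℂ) ≠ 0 := by exact_mod_cast (hd 2).ne'
  rw [reducedKernel_apply d, inv_polyKernel_mul_leftFactor hd, Fin.sum_univ_three]
  simp [h0, map_ofNat]
  field_simp
  ring

lemma reducedKernel_two_two (hd : ∀ l, 0 < d l) (h0 : d 0 = 1) (t : ℝ) :
    reducedKernel d t t 2 2 = 1 + 4 * d 1 * (d 2 : ℂ)⁻¹ * t ^ 2 + (d 2 : ℂ)⁻¹ * t ^ 4 +
      0 * t ^ 6 + 0 * t ^ 8 := by
  have h1 : (d 1 : ℂ) ≠ 0 := by exact_mod_cast (hd 1).ne'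
  have h2 : (d 2 : ℂ) ≠ 0 := by exact_mod_cast (hd 2).ne'
  rw [reducedKernel_apply d, inv_polyKernel_mul_leftFactor hd, Fin.sum_univ_three]
  simp [h0, map_ofNat]
  field_simp
  ring

lemma reducedKernel_zero_two (hd : ∀ l, 0 < d l) (h0 : d 0 = 1) (t : ℝ) :
    reducedKernel d t t 0 2 = 0 * t ^ 2 + (4 * d 1 * (d 2 : ℂ)⁻¹ - (d 1 : ℂ)⁻¹) * t ^ 4 +
      (1 + (d 1 : ℂ)⁻¹ + (d 2 : ℂ)⁻¹) * t ^ 6 + 0 * t ^ 8 := by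
  have h1 : (d 1 : ℂ) ≠ 0 := by exact_mod_cast (hd 1).ne'
  have h2 : (d 2 : ℂ) ≠ 0 := by exact_mod_cast (hd 2).ne'
  rw [reducedKernel_apply d, inv_polyKernel_mul_leftFactor hd, Fin.sum_univ_three]
  simp [h0, map_ofNat]
  field_simp
  ring

/-- The factor `t` makes the odd polynomial `T₁₂(t, t)` even, so that `coeff_eq_zero` applies to
it. -/
lemma mul_reducedKernel_one_two (hd : ∀ l, 0 < d l) (h0 : d 0 = 1) (t : ℝ) :
    t * reducedKernel d t t 1 2 = 0 * t ^ 2 + ((d 1 : ℂ)⁻¹ - 2 - 8 * d 1 * (d 2 : ℂ)⁻¹) * t ^ 4 +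
      (-((d 1 : ℂ)⁻¹ + 2 * (d 2 : ℂ)⁻¹)) * t ^ 6 + 0 * t ^ 8 := by
  have h1 : (d 1 : ℂ) ≠ 0 := by exact_mod_cast (hd 1).ne'
  have h2 : (d 2 : ℂ) ≠ 0 := by exact_mod_cast (hd 2).ne'
  rw [reducedKernel_apply d, inv_polyKernel_mul_leftFactor hd, Fin.sum_univ_three]
  simp [h0, map_ofNat]
  field_simp
  ring

/-- A polynomial which vanishes on `(0, 1)` is zero. -/
lemma coeff_eq_zero {a₁ a₂ a₃ a₄ : ℂ}
    (h : ∀ t : ℝ, 0 < t → t < 1 →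
      a₁ * (t : ℂ) ^ 2 + a₂ * (t : ℂ) ^ 4 + a₃ * (t : ℂ) ^ 6 + a₄ * (t : ℂ) ^ 8 = 0) :
    a₁ = 0 ∧ a₃ = 0 := by
  let p : Polynomial ℂ := .C a₁ * .X ^ 2 + .C a₂ * .X ^ 4 + .C a₃ * .X ^ 6 + .C a₄ * .X ^ 8
  have hp : p = 0 := by
    refine Polynomial.eq_zero_of_infinite_isRoot p ?_
    refine ((Set.Ioo_infinite one_pos).image
      (Complex.ofReal_injective.injOn (s := Set.Ioo (0 : ℝ) 1))).mono ?_
    rintro _ ⟨t, ht, rfl⟩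
    simpa [p, Polynomial.IsRoot] using h t ht.1 ht.2
  have h2 := congrArg (fun q => Polynomial.coeff q 2) hp
  have h6 := congrArg (fun q => Polynomial.coeff q 6) hp
  simp [p, Polynomial.coeff_X_pow] at h2 h6
  exact ⟨h2, h6⟩

/-- The coefficients of `|z|²` in the diagonal entries of the reduced kernel. Up to the shift by
`2 lam + 2`, they are the eigenvalues of the curvature at the origin. -/
def firstCoeff (d : Fin 3 → ℝ) : Fin 3 → ℝ :=
  ![-4 - (d 1)⁻¹, (d 1)⁻¹ - 2 - 4 * d 1 * (d 2)⁻¹, 4 * d 1 * (d 2)⁻¹]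

lemma exists_reducedKernel_diag (hd : ∀ l, 0 < d l) (h0 : d 0 = 1) (i : Fin 3) :
    ∃ a₂ a₃ a₄ : ℂ, ∀ t : ℝ, reducedKernel d t t i i =
      1 + firstCoeff d i * (t : ℂ) ^ 2 + a₂ * (t : ℂ) ^ 4 + a₃ * (t : ℂ) ^ 6 +
        a₄ * (t : ℂ) ^ 8 := by
  have h0' : (firstCoeff d 0 : ℂ) = -4 - (d 1 : ℂ)⁻¹ := by simp [firstCoeff]
  have h1' : (firstCoeff d 1 : ℂ) = (d 1 : ℂ)⁻¹ - 2 - 4 * d 1 * (d 2 : ℂ)⁻¹ := by simp [firstCoeff]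
  have h2' : (firstCoeff d 2 : ℂ) = 4 * d 1 * (d 2 : ℂ)⁻¹ := by simp [firstCoeff]
  match i with
  | 0 => rw [h0']; exact ⟨_, _, _, reducedKernel_zero_zero hd h0⟩
  | 1 => rw [h1']; exact ⟨_, _, _, reducedKernel_one_one hd h0⟩
  | 2 => rw [h2']; exact ⟨_, _, _, reducedKernel_two_two hd h0⟩

lemma firstCoeff_eq_of_reducedKernel {d' : Fin 3 → ℝ} (hd : ∀ l, 0 < d l) (h0 : d 0 = 1)
    (hd' : ∀ l, 0 < d' l) (h0' : d' 0 = 1) {i j : Fin 3}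
    (h : ∀ t : ℝ, 0 < t → t < 1 → reducedKernel d t t i i = reducedKernel d' t t j j) :
    firstCoeff d i = firstCoeff d' j := by
  obtain ⟨a₂, a₃, a₄, ha⟩ := exists_reducedKernel_diag hd h0 i
  obtain ⟨b₂, b₃, b₄, hb⟩ := exists_reducedKernel_diag hd' h0' j
  have := (coeff_eq_zero (a₁ := firstCoeff d i - firstCoeff d' j) (a₂ := a₂ - b₂) (a₃ := a₃ - b₃)
    (a₄ := a₄ - b₄) fun t ht ht' => by
      have := h t ht ht'
      rw [ha, hb] at this
      linear_combination this).1
  exact_mod_cast sub_eq_zero.mp this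

lemma exists_reducedKernel_zero_two_ne (hd : ∀ l, 0 < d l) (h0 : d 0 = 1) :
    ∃ t : ℝ, 0 < t ∧ t < 1 ∧ reducedKernel d t t 0 2 ≠ 0 := by
  by_contra! hcon
  have := (coeff_eq_zero fun t ht ht' =>
    (reducedKernel_zero_two hd h0 t).symm.trans (hcon t ht ht')).2
  have h3 : 1 + (d 1)⁻¹ + (d 2)⁻¹ = 0 := by exact_mod_cast this
  have := inv_pos.mpr (hd 1)
  have := inv_pos.mpr (hd 2)
  linarith

lemma exists_reducedKernel_one_two_ne (hd : ∀ l, 0 < d l) (h0 : d 0 = 1) :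
    ∃ t : ℝ, 0 < t ∧ t < 1 ∧ reducedKernel d t t 1 2 ≠ 0 := by
  by_contra! hcon
  have := (coeff_eq_zero fun t ht ht' =>
    (mul_reducedKernel_one_two hd h0 t).symm.trans (by rw [hcon t ht ht', mul_zero])).2
  have h3 : -((d 1)⁻¹ + 2 * (d 2)⁻¹) = 0 := by exact_mod_cast this
  have := inv_pos.mpr (hd 1)
  have := inv_pos.mpr (hd 2)
  linarith

end Entries

end KoranyiMisra

namespace KoranyiMisra

lemma vecD_pos {lam : ℝ} {μ : Fin 3 → ℝ} (h : Admissible 2 lam μ) (l : Fin 3) :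
    0 < vecD 2 lam μ l := by
  have hb : 2 < 2 * lam := by simpa using h.1
  match l with
  | 0 => rw [vecD_zero h]; exact one_pos
  | 1 =>
    rw [vecD_one h]
    have := div_pos one_pos (sub_pos.mpr hb)
    positivity
  | 2 =>
    rw [vecD_two h]
    have h1 : 0 < 2 * lam - 2 := by linarith
    have h2 : 0 < 2 * lam - 1 := by linarith
    have h3 : 0 < 2 * lam := by linarith
    positivity

lemma isUnit_polyKernel_zero_right {d : Fin 3 → ℝ} (hd : ∀ l, 0 < d l) (z : ℂ) :
    IsUnit (polyKernel d z 0) :=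
  IsUnit.of_mul_eq_one_right _ (inv_mul_polyKernel hd z)

lemma isUnit_polyKernel_zero_left {d : Fin 3 → ℝ} (hd : ∀ l, 0 < d l) (w : ℂ) :
    IsUnit (polyKernel d 0 w) := by
  rw [← polyKernel_conjTranspose]
  exact (isUnit_polyKernel_zero_right hd w).star

/-- Quasi-invariance of the polynomial part of the kernel under the rotation by `ζ`, which fixes
`0`. -/
lemma polyKernel_rotate (d : Fin 3 → ℝ) {ζ : ℂ} (hζ : ζ * conj ζ = 1) (z w : ℂ) :
    (Matrix.diagonal fun l : Fin 3 => ζ ^ (l : ℕ)) * polyKernel d (ζ * z) (ζ * w) =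
      polyKernel d z w * Matrix.diagonal fun l : Fin 3 => ζ ^ (l : ℕ) := by
  have h := polyKernel_moebius d (c := ζ) (a := 0) (z := z) (w := w) hζ (by simp) (by simp)
    (by simp)
  have hc : ∀ z, cocycleMatrix ζ 0 z = Matrix.diagonal fun l : Fin 3 => ζ ^ (l : ℕ) := fun z => by
    ext i j
    fin_cases i <;> fin_cases j <;> simp [cocycleMatrix]
  have hE : (Matrix.diagonal fun l : Fin 3 => ζ ^ (l : ℕ))ᴴ *
      (Matrix.diagonal fun l : Fin 3 => ζ ^ (l : ℕ)) = 1 := by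
    rw [Matrix.diagonal_conjTranspose, Matrix.diagonal_mul_diagonal, ← Matrix.diagonal_one]
    congr 1
    funext l
    rw [Pi.star_apply, star_pow, ← mul_pow, mul_comm]
    simp [hζ]
  have hm : ∀ z, moebius ζ 0 z = ζ * z := fun z => by simp [moebius]
  simp only [hc, hm, map_zero, zero_mul, sub_zero, map_one, mul_one, div_one, one_pow,
    one_smul] at h
  rw [← h, Matrix.mul_assoc, hE, mul_one]

lemma mul_inv_eq_of_mul_eq {E P Q : Matrix (Fin 3) (Fin 3) ℂ} (hP : IsUnit P) (hQ : IsUnit Q)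
    (h : E * P = Q * E) : E * P⁻¹ = Q⁻¹ * E := by
  have hP' := (Matrix.isUnit_iff_isUnit_det _).mp hP
  have hQ' := (Matrix.isUnit_iff_isUnit_det _).mp hQ
  calc E * P⁻¹ = Q⁻¹ * Q * E * P⁻¹ := by rw [Matrix.nonsing_inv_mul _ hQ', one_mul]
    _ = Q⁻¹ * (E * P) * P⁻¹ := by rw [h, Matrix.mul_assoc Q⁻¹]
    _ = Q⁻¹ * E := by
      rw [Matrix.mul_assoc, Matrix.mul_assoc, Matrix.mul_nonsing_inv _ hP', mul_one]

/-- Rotations act on the reduced kernel through `diag(1, ζ, ζ²)`. -/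
lemma reducedKernel_rotate {d : Fin 3 → ℝ} (hd : ∀ l, 0 < d l) {ζ : ℂ} (hζ : ζ * conj ζ = 1)
    (z w : ℂ) (i j : Fin 3) :
    ζ ^ (i : ℕ) * reducedKernel d (ζ * z) (ζ * w) i j =
      reducedKernel d z w i j * ζ ^ (j : ℕ) := by
  set E := Matrix.diagonal fun l : Fin 3 => ζ ^ (l : ℕ) with hE
  have h1 : E * (polyKernel d (ζ * z) 0)⁻¹ = (polyKernel d z 0)⁻¹ * E :=
    mul_inv_eq_of_mul_eq (isUnit_polyKernel_zero_right hd _) (isUnit_polyKernel_zero_right hd _)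
      (by simpa using polyKernel_rotate d hζ z 0)
  have h2 : E * (polyKernel d 0 (ζ * w))⁻¹ = (polyKernel d 0 w)⁻¹ * E :=
    mul_inv_eq_of_mul_eq (isUnit_polyKernel_zero_left hd _) (isUnit_polyKernel_zero_left hd _)
      (by simpa using polyKernel_rotate d hζ 0 w)
  have h3 : E * polyKernel d (ζ * z) (ζ * w) = polyKernel d z w * E := polyKernel_rotate d hζ z w
  have h4 : E * (Matrix.diagonal fun l => (d l : ℂ)) = (Matrix.diagonal fun l => (d l : ℂ)) * E :=
    by simp only [hE, Matrix.diagonal_mul_diagonal, mul_comm]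
  have h : E * reducedKernel d (ζ * z) (ζ * w) = reducedKernel d z w * E := by
    calc E * reducedKernel d (ζ * z) (ζ * w) =
        E * (polyKernel d (ζ * z) 0)⁻¹ * polyKernel d (ζ * z) (ζ * w) *
          (polyKernel d 0 (ζ * w))⁻¹ * Matrix.diagonal fun l => (d l : ℂ) := by
          simp only [reducedKernel, Matrix.mul_assoc]
      _ = (polyKernel d z 0)⁻¹ * (E * polyKernel d (ζ * z) (ζ * w)) *
          (polyKernel d 0 (ζ * w))⁻¹ * Matrix.diagonal fun l => (d l : ℂ) := by
          rw [h1, Matrix.mul_assoc _ E]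
      _ = (polyKernel d z 0)⁻¹ * polyKernel d z w * (E * (polyKernel d 0 (ζ * w))⁻¹) *
          Matrix.diagonal fun l => (d l : ℂ) := by
          rw [h3]; simp only [Matrix.mul_assoc]
      _ = (polyKernel d z 0)⁻¹ * polyKernel d z w * (polyKernel d 0 w)⁻¹ *
          (E * Matrix.diagonal fun l => (d l : ℂ)) := by
          rw [h2]; simp only [Matrix.mul_assoc]
      _ = reducedKernel d z w * E := by
          rw [h4]; simp only [reducedKernel, Matrix.mul_assoc]
  have := congrFun (congrFun h i) j
  rwa [hE, Matrix.diagonal_mul, Matrix.mul_diagonal] at this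

lemma sum_I_pow (k j : Fin 3) :
    ∑ m : Fin 4, (Complex.I ^ (m : ℕ)) ^ (8 - (k : ℕ) + (j : ℕ)) = if k = j then 4 else 0 := by
  have h2 : Complex.I ^ 2 = -1 := Complex.I_sq
  have h3 : Complex.I ^ 3 = -Complex.I := by rw [pow_succ, h2]; ring
  fin_cases k <;> fin_cases j <;> simp [Fin.sum_univ_four, h3, pow_succ] <;> norm_num

/-- The consequences of the intertwining relation `X T = T' X` obtained by averaging over the
rotations of order dividing four. Under a rotation by `ζ` the entry `(k, j)` of `T` and of `T'` is
multiplied by `ζ ^ (j - k)`, and the average over the fourth roots of unity removes the terms whose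
weight is one of `±1`, `±2`. -/
lemma apply_mul_reducedKernel {d d' : Fin 3 → ℝ} (hd : ∀ l, 0 < d l) (hd' : ∀ l, 0 < d' l)
    {X : Matrix (Fin 3) (Fin 3) ℂ}
    (h : ∀ z w : ℂ, ‖z‖ < 1 → ‖w‖ < 1 → X * reducedKernel d z w = reducedKernel d' z w * X)
    {z w : ℂ} (hz : ‖z‖ < 1) (hw : ‖w‖ < 1) (i j : Fin 3) :
    X i j * reducedKernel d z w j j = reducedKernel d' z w i i * X i j ∧
      X i i * reducedKernel d z w i j = reducedKernel d' z w i j * X j j := by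
  have hn : ∀ m : ℕ, ‖Complex.I ^ m‖ = 1 := fun m => by simp
  have h8 : ∀ m : ℕ, (Complex.I ^ m) ^ 8 = 1 := fun m => by
    rw [← pow_mul, mul_comm, pow_mul, show 8 = 4 * 2 from rfl, pow_mul, Complex.I_pow_four]
    simp
  -- the weight `j - k` is written as `8 - k + j`, which is a natural number
  have hr : ∀ {d : Fin 3 → ℝ}, (∀ l, 0 < d l) → ∀ (m : ℕ) (k j : Fin 3),
      reducedKernel d (Complex.I ^ m * z) (Complex.I ^ m * w) k j =
        (Complex.I ^ m) ^ (8 - (k : ℕ) + (j : ℕ)) * reducedKernel d z w k j := by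
    intro d hd m k j
    have h1 := reducedKernel_rotate hd (mul_conj_of_norm_eq_one (hn m)) z w k j
    have h2 : (Complex.I ^ m) ^ (8 - (k : ℕ)) * (Complex.I ^ m) ^ (k : ℕ) = 1 := by
      rw [← pow_add, Nat.sub_add_cancel (by omega), h8]
    rw [pow_add]
    linear_combination (Complex.I ^ m) ^ (8 - (k : ℕ)) * h1 -
      reducedKernel d (Complex.I ^ m * z) (Complex.I ^ m * w) k j * h2
  have key : ∀ m : ℕ, ∑ k : Fin 3, (Complex.I ^ m) ^ (8 - (k : ℕ) + (j : ℕ)) *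
      (X i k * reducedKernel d z w k j) =
      ∑ k : Fin 3, (Complex.I ^ m) ^ (8 - (i : ℕ) + (k : ℕ)) *
        (reducedKernel d' z w i k * X k j) := by
    intro m
    have h1 := congrFun (congrFun (h (Complex.I ^ m * z) (Complex.I ^ m * w)
      (by rwa [norm_mul, hn, one_mul]) (by rwa [norm_mul, hn, one_mul])) i) j
    simp only [Matrix.mul_apply, hr hd, hr hd'] at h1
    calc _ = _ := Finset.sum_congr rfl fun k _ => by ring
      _ = _ := h1
      _ = _ := Finset.sum_congr rfl fun k _ => by ring
  constructor
  · have hsum := Finset.sum_congr rfl fun (m : Fin 4) (_ : m ∈ Finset.univ) => key m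
    rw [Finset.sum_comm, Finset.sum_comm (s := (Finset.univ : Finset (Fin 4)))] at hsum
    simp only [← Finset.sum_mul, sum_I_pow, ite_mul, zero_mul, Finset.sum_ite_eq,
      Finset.sum_ite_eq', Finset.mem_univ, if_true] at hsum
    linear_combination hsum / 4
  · -- multiplying by `ζ ^ (i - j)` shifts the weights
    have key' : ∀ m : ℕ, ∑ k : Fin 3, (Complex.I ^ m) ^ (8 - (k : ℕ) + (i : ℕ)) *
        (X i k * reducedKernel d z w k j) =
        ∑ k : Fin 3, (Complex.I ^ m) ^ (8 - (j : ℕ) + (k : ℕ)) *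
          (reducedKernel d' z w i k * X k j) := by
      intro m
      have hi : (Complex.I ^ m) ^ (8 - (i : ℕ)) * (Complex.I ^ m) ^ (i : ℕ) = 1 := by
        rw [← pow_add, Nat.sub_add_cancel (by omega), h8]
      have hj : (Complex.I ^ m) ^ (8 - (j : ℕ)) * (Complex.I ^ m) ^ (j : ℕ) = 1 := by
        rw [← pow_add, Nat.sub_add_cancel (by omega), h8]
      have h1 := congrArg (fun x => (Complex.I ^ m) ^ (i : ℕ) * (Complex.I ^ m) ^ (8 - (j : ℕ)) * x)
        (key m)
      simp only [Finset.mul_sum] at h1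
      calc _ = _ := Finset.sum_congr rfl fun k _ => by
            rw [pow_add, pow_add]
            linear_combination (-(Complex.I ^ m) ^ (8 - (k : ℕ)) * (Complex.I ^ m) ^ (i : ℕ) *
              (X i k * reducedKernel d z w k j)) * hj
        _ = _ := h1
        _ = _ := Finset.sum_congr rfl fun k _ => by
            rw [pow_add, pow_add]
            linear_combination ((Complex.I ^ m) ^ (8 - (j : ℕ)) * (Complex.I ^ m) ^ (k : ℕ) *
              (reducedKernel d' z w i k * X k j)) * hi
    have hsum := Finset.sum_congr rfl fun (m : Fin 4) (_ : m ∈ Finset.univ) => key' m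
    rw [Finset.sum_comm, Finset.sum_comm (s := (Finset.univ : Finset (Fin 4)))] at hsum
    simp only [← Finset.sum_mul, sum_I_pow, ite_mul, zero_mul, Finset.sum_ite_eq,
      Finset.sum_ite_eq', Finset.mem_univ, if_true] at hsum
    linear_combination hsum / 4

section Intertwiner

variable {d d' : Fin 3 → ℝ} {X : Matrix (Fin 3) (Fin 3) ℂ}

/-- An intertwiner of two reduced kernels only connects coordinates with equal first
coefficients. -/
lemma apply_eq_zero_of_firstCoeff_ne (hd : ∀ l, 0 < d l) (h0 : d 0 = 1) (hd' : ∀ l, 0 < d' l)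
    (h0' : d' 0 = 1)
    (h : ∀ z w : ℂ, ‖z‖ < 1 → ‖w‖ < 1 → X * reducedKernel d z w = reducedKernel d' z w * X)
    {i j : Fin 3} (hij : firstCoeff d j ≠ firstCoeff d' i) : X i j = 0 := by
  by_contra hX
  refine hij (firstCoeff_eq_of_reducedKernel hd h0 hd' h0' fun t ht ht' => ?_)
  have hn : ‖(t : ℂ)‖ < 1 := by rwa [Complex.norm_real, Real.norm_of_nonneg ht.le]
  have := (apply_mul_reducedKernel hd hd' h hn hn i j).1
  exact mul_left_cancel₀ hX (this.trans (mul_comm _ _))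

/-- The corner entries of an intertwiner satisfy `X₀₀ T₀₂ = T'₀₂ X₂₂`, and neither `T₀₂` nor `T'₀₂`
vanishes identically. -/
lemma apply_zero_zero_eq_zero_iff (hd : ∀ l, 0 < d l) (h0 : d 0 = 1) (hd' : ∀ l, 0 < d' l)
    (h0' : d' 0 = 1)
    (h : ∀ z w : ℂ, ‖z‖ < 1 → ‖w‖ < 1 → X * reducedKernel d z w = reducedKernel d' z w * X) :
    X 0 0 = 0 ↔ X 2 2 = 0 := by
  constructor <;> intro hX
  · obtain ⟨t, ht, ht', hT⟩ := exists_reducedKernel_zero_two_ne hd' h0'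
    have hn : ‖(t : ℂ)‖ < 1 := by rwa [Complex.norm_real, Real.norm_of_nonneg ht.le]
    have := (apply_mul_reducedKernel hd hd' h hn hn 0 2).2
    rw [hX, zero_mul] at this
    exact (mul_eq_zero.mp this.symm).resolve_left hT
  · obtain ⟨t, ht, ht', hT⟩ := exists_reducedKernel_zero_two_ne hd h0
    have hn : ‖(t : ℂ)‖ < 1 := by rwa [Complex.norm_real, Real.norm_of_nonneg ht.le]
    have := (apply_mul_reducedKernel hd hd' h hn hn 0 2).2
    rw [hX, mul_zero] at this
    exact (mul_eq_zero.mp this).resolve_right hT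

/-- If the first coefficients are distinct, the commutant of the reduced kernel is trivial: a
commuting matrix is diagonal, and its diagonal entries agree because `T₀₂` and `T₁₂` do not vanish
identically. -/
lemma eq_smul_one_of_commutes (hd : ∀ l, 0 < d l) (h0 : d 0 = 1)
    (hinj : Function.Injective (firstCoeff d))
    (h : ∀ z w : ℂ, ‖z‖ < 1 → ‖w‖ < 1 → X * reducedKernel d z w = reducedKernel d z w * X) :
    X = X 2 2 • 1 := by
  have h02 : X 0 0 = X 2 2 := by
    obtain ⟨t, ht, ht', hT⟩ := exists_reducedKernel_zero_two_ne hd h0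
    have hn : ‖(t : ℂ)‖ < 1 := by rwa [Complex.norm_real, Real.norm_of_nonneg ht.le]
    exact mul_right_cancel₀ hT
      ((apply_mul_reducedKernel hd hd h hn hn 0 2).2.trans (mul_comm _ _))
  have h12 : X 1 1 = X 2 2 := by
    obtain ⟨t, ht, ht', hT⟩ := exists_reducedKernel_one_two_ne hd h0
    have hn : ‖(t : ℂ)‖ < 1 := by rwa [Complex.norm_real, Real.norm_of_nonneg ht.le]
    exact mul_right_cancel₀ hT
      ((apply_mul_reducedKernel hd hd h hn hn 1 2).2.trans (mul_comm _ _))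
  ext i j
  rw [Matrix.smul_apply, Matrix.one_apply]
  split_ifs with hij
  · subst hij
    match i with
    | 0 => simpa using h02
    | 1 => simpa using h12
    | 2 => simp
  · rw [smul_zero]
    exact apply_eq_zero_of_firstCoeff_ne hd h0 hd h0 h fun hc => hij (hinj hc).symm

end Intertwiner

end KoranyiMisra

namespace KoranyiMisra

open RKHS

/-! ### Irreducibility and unitary equivalence -/

lemma eq_of_invPow_smul_eq {b : ℝ} {z w : 𝔻} {A B : Matrix (Fin 3) (Fin 3) ℂ}
    (h : invPow b ((z : ℂ) * conj (w : ℂ)) • A = invPow b ((z : ℂ) * conj (w : ℂ)) • B) :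
    A = B := by
  refine smul_right_injective _ (r := invPow b ((z : ℂ) * conj (w : ℂ))) ?_ h
  rw [invPow, Complex.cpow_def_of_ne_zero (one_sub_ne_zero_of_norm_lt (norm_mul_conj_lt_one z w))]
  exact Complex.exp_ne_zero _

/-- If a matrix-valued function `Φ` transforms one polynomial kernel into another, then `Φ(0)*`
intertwines the reduced kernels. -/
lemma intertwines_of_transforms {d d' : Fin 3 → ℝ} (hd' : ∀ l, 0 < d' l)
    {Φ : 𝔻 → Matrix (Fin 3) (Fin 3) ℂ}
    (h : ∀ z w : 𝔻, Φ z * polyKernel d z w * (Φ w)ᴴ = polyKernel d' z w) :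
    IsUnit (Φ 0)ᴴ ∧ ∀ z w : ℂ, ‖z‖ < 1 → ‖w‖ < 1 →
      (Φ 0)ᴴ * reducedKernel d' z w = reducedKernel d z w * (Φ 0)ᴴ := by
  have hz : ∀ z : 𝔻, Φ z * polyKernel d z 0 * (Φ 0)ᴴ = polyKernel d' z 0 := fun z => h z 0
  have hw : ∀ w : 𝔻, Φ 0 * polyKernel d 0 w * (Φ w)ᴴ = polyKernel d' 0 w := fun w => h 0 w
  have hu : ∀ z : 𝔻, IsUnit (Φ z) := fun z => by
    refine IsUnit.of_mul_eq_one (polyKernel d z 0 * (Φ 0)ᴴ * (polyKernel d' z 0)⁻¹) ?_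
    rw [← Matrix.mul_assoc, ← Matrix.mul_assoc, hz, Matrix.mul_nonsing_inv]
    exact (Matrix.isUnit_iff_isUnit_det _).mp (isUnit_polyKernel_zero_right hd' _)
  have hud : ∀ z : 𝔻, IsUnit (Φ z).det := fun z => (Matrix.isUnit_iff_isUnit_det _).mp (hu z)
  have hud' : ∀ z : 𝔻, IsUnit ((Φ z)ᴴ).det := fun z =>
    (Matrix.isUnit_iff_isUnit_det _).mp (hu z).star
  refine ⟨(hu 0).star, fun z w hz1 hw1 => ?_⟩
  lift z to 𝔻 using hz1
  lift w to 𝔻 using hw1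
  have h0 := h 0 0
  rw [Complex.UnitDisc.coe_zero, polyKernel_zero_zero, polyKernel_zero_zero] at h0
  rw [reducedKernel, ← h, ← hz, ← hw, ← h0, Matrix.mul_inv_rev, Matrix.mul_inv_rev,
    Matrix.mul_inv_rev, Matrix.mul_inv_rev, reducedKernel]
  simp only [Matrix.mul_assoc]
  rw [Matrix.mul_nonsing_inv_cancel_left _ _ (hud' 0),
    Matrix.nonsing_inv_mul_cancel_left _ _ (hud z),
    Matrix.mul_nonsing_inv_cancel_left _ _ (hud' w),
    Matrix.nonsing_inv_mul_cancel_left _ _ (hud 0)]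

/-- If `Φ(z) K(z, w) = K(z, w) Φ(w)*`, then `Φ` is determined by `Φ(0)`, and `Φ(0)*` commutes with
the reduced kernel. -/
lemma commutes_of_selfAdjoint {d : Fin 3 → ℝ} (hd : ∀ l, 0 < d l)
    {Φ : 𝔻 → Matrix (Fin 3) (Fin 3) ℂ}
    (h : ∀ z w : 𝔻, Φ z * polyKernel d z w = polyKernel d z w * (Φ w)ᴴ) :
    (∀ z, Φ z = polyKernel d z 0 * (Φ 0)ᴴ * (polyKernel d z 0)⁻¹) ∧
    ∀ z w : ℂ, ‖z‖ < 1 → ‖w‖ < 1 →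
      (Φ 0)ᴴ * reducedKernel d z w = reducedKernel d z w * (Φ 0)ᴴ := by
  have hz : ∀ z : 𝔻, Φ z * polyKernel d z 0 = polyKernel d z 0 * (Φ 0)ᴴ := fun z => h z 0
  have hw : ∀ w : 𝔻, Φ 0 * polyKernel d 0 w = polyKernel d 0 w * (Φ w)ᴴ := fun w => h 0 w
  refine ⟨fun z => ?_, fun z w hz1 hw1 => ?_⟩
  · rw [← hz, Matrix.mul_assoc, Matrix.mul_nonsing_inv, mul_one]
    exact (Matrix.isUnit_iff_isUnit_det _).mp (isUnit_polyKernel_zero_right hd _)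
  lift z to 𝔻 using hz1
  lift w to 𝔻 using hw1
  have h0 := h 0 0
  rw [Complex.UnitDisc.coe_zero, polyKernel_zero_zero] at h0
  have e1 : (Φ 0)ᴴ * (polyKernel d z 0)⁻¹ = (polyKernel d z 0)⁻¹ * Φ z := by
    have hu := (Matrix.isUnit_iff_isUnit_det _).mp (isUnit_polyKernel_zero_right hd z)
    rw [← Matrix.nonsing_inv_mul_cancel_left _ ((Φ 0)ᴴ * (polyKernel d z 0)⁻¹) hu,
      ← Matrix.mul_assoc _ (Φ 0)ᴴ, ← hz, Matrix.mul_nonsing_inv_cancel_right _ _ hu]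
  have e2 : (Φ w)ᴴ * (polyKernel d 0 w)⁻¹ = (polyKernel d 0 w)⁻¹ * Φ 0 := by
    have hu := (Matrix.isUnit_iff_isUnit_det _).mp (isUnit_polyKernel_zero_left hd w)
    rw [← Matrix.nonsing_inv_mul_cancel_left _ ((Φ w)ᴴ * (polyKernel d 0 w)⁻¹) hu,
      ← Matrix.mul_assoc _ (Φ w)ᴴ, ← hw, Matrix.mul_nonsing_inv_cancel_right _ _ hu]
  rw [reducedKernel, Matrix.mul_assoc _ _ (Φ 0)ᴴ, ← h0, ← Matrix.mul_assoc _ (Φ 0),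
    Matrix.mul_assoc _ _ (Φ 0), ← e2, ← Matrix.mul_assoc, ← Matrix.mul_assoc,
    ← Matrix.mul_assoc, e1, Matrix.mul_assoc _ (Φ z), h]
  simp only [Matrix.mul_assoc]

section Space

variable {lam : ℝ} {μ : Fin 3 → ℝ} [Fact (kernelOp 2 lam μ).PosSemidef]
  {M : Space 2 lam μ →L[ℂ] Space 2 lam μ}

lemma kerFun_apply_eq (z w : 𝔻) (v : EuclideanSpace ℂ (Fin 3)) :
    kerFun (Space 2 lam μ) w v z = Matrix.toEuclideanCLM (𝕜 := ℂ) (kernel 2 lam μ z w) v := by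
  rw [kerFun_apply, OfKernel.kernel_ofKernel]
  rfl

/-- The multiplication operator is irreducible if the first coefficients are distinct. A
projection which commutes with it is the multiplication by a matrix function `Φ` with
`Φ(z) K(z, w) = K(z, w) Φ(w)*`, hence by a scalar. -/
theorem IsMultiplication.isIrreducibleOperator (h : Admissible 2 lam μ)
    (hM : IsMultiplication 2 lam μ M) (hinj : Function.Injective (firstCoeff (vecD 2 lam μ))) :
    IsIrreducibleOperator M := by
  intro P hP hPM
  have hd := vecD_pos h
  obtain ⟨Φ, hΦ⟩ := exists_matrix_of_intertwines h hM hM P fun f =>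
    DFunLike.congr_fun hPM.eq f
  have hadj : ∀ w v, P (kerFun (Space 2 lam μ) w v) =
      kerFun (Space 2 lam μ) w (Matrix.toEuclideanCLM (𝕜 := ℂ) (Φ w)ᴴ v) := fun w v => by
    refine ext_inner_right ℂ fun f => ?_
    rw [kerFun_inner, ← toEuclideanCLM_adjoint, ContinuousLinearMap.adjoint_inner_left, ← hΦ,
      ← kerFun_inner, ← ContinuousLinearMap.adjoint_inner_right,
      (ContinuousLinearMap.isSelfAdjoint_iff'.mp hP.isSelfAdjoint)]
  have hcomm : ∀ z w : 𝔻, Φ z * polyKernel (vecD 2 lam μ) z w =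
      polyKernel (vecD 2 lam μ) z w * (Φ w)ᴴ := fun z w => by
    refine eq_of_invPow_smul_eq (b := 2 * lam + 2) (z := z) (w := w) ?_
    rw [← Matrix.mul_smul, ← Matrix.smul_mul, ← kernel_eq]
    refine EquivLike.injective (Matrix.toEuclideanCLM (n := Fin 3) (𝕜 := ℂ)) ?_
    ext v : 1
    rw [map_mul, map_mul, mul_apply_eq_comp, mul_apply_eq_comp, ← kerFun_apply_eq,
      ← kerFun_apply_eq, ← hΦ, hadj]
  obtain ⟨h1, h2⟩ := commutes_of_selfAdjoint hd hcomm
  have hX := eq_smul_one_of_commutes hd (vecD_zero h) hinj h2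
  set s := (Φ 0)ᴴ 2 2
  have hΦs : ∀ z, Φ z = s • 1 := fun z => by
    rw [h1, hX, Matrix.mul_smul, mul_one, Matrix.smul_mul, Matrix.mul_nonsing_inv]
    exact (Matrix.isUnit_iff_isUnit_det _).mp (isUnit_polyKernel_zero_right hd _)
  have hPs : ∀ f : Space 2 lam μ, P f = s • f := fun f => by
    ext z : 1
    rw [hΦ, hΦs, map_smul, map_one, smul_apply, one_apply_eq_self, coe_smul, Pi.smul_apply]
  have hidem : ∀ f : Space 2 lam μ, (s * s - s) • f = 0 := fun f => by
    have := DFunLike.congr_fun hP.isIdempotentElem.eq f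
    rw [mul_apply_eq_comp, hPs, hPs, smul_smul] at this
    rw [sub_smul, this, sub_self]
  by_cases hs0 : s = 0
  · left
    ext f : 1
    rw [hPs, hs0, zero_smul, zero_apply]
  · right
    ext f : 1
    rw [one_apply_eq_self]
    by_cases hs1 : s = 1
    · rw [hPs, hs1, one_smul]
    · have : s * s - s ≠ 0 := by
        rw [show s * s - s = s * (s - 1) by ring]
        exact mul_ne_zero hs0 (sub_ne_zero.mpr hs1)
      rw [(smul_eq_zero_iff_right this).mp (hidem f), map_zero]

/-- A unitary equivalence of two multiplication operators of the same weight gives an invertible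
intertwiner of the reduced kernels. -/
theorem exists_intertwiner_of_unitarilyEquivalent {μ' : Fin 3 → ℝ}
    [Fact (kernelOp 2 lam μ').PosSemidef] {M' : Space 2 lam μ' →L[ℂ] Space 2 lam μ'}
    (h : Admissible 2 lam μ) (h' : Admissible 2 lam μ') (hM : IsMultiplication 2 lam μ M)
    (hM' : IsMultiplication 2 lam μ' M') (hMM' : UnitarilyEquivalent M M') :
    ∃ X : Matrix (Fin 3) (Fin 3) ℂ, IsUnit X ∧ ∀ z w : ℂ, ‖z‖ < 1 → ‖w‖ < 1 →
      X * reducedKernel (vecD 2 lam μ') z w = reducedKernel (vecD 2 lam μ) z w * X := by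
  obtain ⟨U, hU⟩ := hMM'
  obtain ⟨Φ, hΦ⟩ := exists_matrix_of_intertwines h hM hM'
    (U : Space 2 lam μ →L[ℂ] Space 2 lam μ') hU
  replace hΦ : ∀ f z, U f z = Matrix.toEuclideanCLM (𝕜 := ℂ) (Φ z) (f z) := hΦ
  have hadj : ∀ w v, kerFun (Space 2 lam μ') w v = U (kerFun (Space 2 lam μ) w
      (Matrix.toEuclideanCLM (𝕜 := ℂ) (Φ w)ᴴ v)) := fun w v => by
    rw [← U.symm_apply_eq]
    refine ext_inner_right ℂ fun f => ?_
    rw [kerFun_inner, ← toEuclideanCLM_adjoint, ContinuousLinearMap.adjoint_inner_left, ← hΦ,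
      ← kerFun_inner, ← U.inner_map_map, U.apply_symm_apply]
  refine ⟨_, intertwines_of_transforms (vecD_pos h') (Φ := Φ) fun z w => ?_⟩
  refine eq_of_invPow_smul_eq (b := 2 * lam + 2) (z := z) (w := w) ?_
  rw [← kernel_eq, ← Matrix.smul_mul, ← Matrix.mul_smul, ← kernel_eq]
  refine EquivLike.injective (Matrix.toEuclideanCLM (n := Fin 3) (𝕜 := ℂ)) ?_
  ext v : 1
  rw [map_mul, map_mul, mul_apply_eq_comp, mul_apply_eq_comp, ← kerFun_apply_eq,
    ← kerFun_apply_eq, hadj, hΦ]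

end Space

end KoranyiMisra

namespace KoranyiMisra

open Filter Topology

/-! ### Wirtinger calculus -/

/-- `f` is real differentiable at `z`, with `∂f = p` and `∂̄f = q` there. -/
def HasWirtinger (f : ℂ → ℂ) (p q z : ℂ) : Prop :=
  HasFDerivAt f (p • ContinuousLinearMap.id ℝ ℂ + q • (Complex.conjCLE : ℂ →L[ℝ] ℂ)) z

namespace HasWirtinger

variable {f g : ℂ → ℂ} {p q p' q' z : ℂ}

lemma wirtinger_eq (h : HasWirtinger f p q z) : wirtinger f z = p := by
  rw [wirtinger, HasFDerivAt.fderiv h]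
  simp
  linear_combination (q - p) / 2 * Complex.I_mul_I

lemma wirtingerBar_eq (h : HasWirtinger f p q z) : wirtingerBar f z = q := by
  rw [wirtingerBar, HasFDerivAt.fderiv h]
  simp
  linear_combination (p - q) / 2 * Complex.I_mul_I

lemma congr (h : HasWirtinger f p q z) (hp : p = p') (hq : q = q') : HasWirtinger f p' q' z := by
  rwa [← hp, ← hq]

lemma congr_of_eventuallyEq (h : HasWirtinger f p q z) (hg : g =ᶠ[𝓝 z] f) :
    HasWirtinger g p q z :=
  HasFDerivAt.congr_of_eventuallyEq h hg

lemma const (c z : ℂ) : HasWirtinger (fun _ => c) 0 0 z := by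
  refine (hasFDerivAt_const (𝕜 := ℝ) c z).congr_fderiv ?_
  ext
  simp

lemma _root_.HasDerivAt.hasWirtinger {f' : ℂ} (h : HasDerivAt f f' z) :
    HasWirtinger f f' 0 z := by
  have := h.hasFDerivAt.restrictScalars ℝ
  refine this.congr_fderiv ?_
  ext
  simp [mul_comm]

lemma conjugate (h : HasWirtinger f p q z) :
    HasWirtinger (fun u => conj (f u)) (conj q) (conj p) z := by
  have := (Complex.conjCLE : ℂ →L[ℝ] ℂ).hasFDerivAt.comp z h
  refine this.congr_fderiv ?_
  ext
  simp
  ring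

lemma add (hf : HasWirtinger f p q z) (hg : HasWirtinger g p' q' z) :
    HasWirtinger (fun u => f u + g u) (p + p') (q + q') z := by
  refine (HasFDerivAt.add hf hg).congr_fderiv ?_
  module

lemma sum {ι : Type*} {s : Finset ι} {f : ι → ℂ → ℂ} {p q : ι → ℂ}
    (h : ∀ i ∈ s, HasWirtinger (f i) (p i) (q i) z) :
    HasWirtinger (fun u => ∑ i ∈ s, f i u) (∑ i ∈ s, p i) (∑ i ∈ s, q i) z := by
  refine (HasFDerivAt.fun_sum h).congr_fderiv ?_
  ext
  simp [Finset.sum_mul, Finset.sum_add_distrib]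

lemma mul (hf : HasWirtinger f p q z) (hg : HasWirtinger g p' q' z) :
    HasWirtinger (fun u => f u * g u) (p * g z + f z * p') (q * g z + f z * q') z := by
  refine (HasFDerivAt.mul hf hg).congr_fderiv ?_
  ext
  simp
  ring

/-- Composition with a holomorphic function on the outside. -/
lemma comp_left {F : ℂ → ℂ} {F' : ℂ} (hF : HasDerivAt F F' (f z)) (hf : HasWirtinger f p q z) :
    HasWirtinger (fun u => F (f u)) (F' * p) (F' * q) z := by
  refine ((hF.hasFDerivAt.restrictScalars ℝ).comp z hf).congr_fderiv ?_
  ext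
  simp
  ring

/-- Composition with a holomorphic function on the inside. -/
lemma comp_right {ψ : ℂ → ℂ} {ψ' : ℂ} (hf : HasWirtinger f p q (ψ z)) (hψ : HasDerivAt ψ ψ' z) :
    HasWirtinger (fun u => f (ψ u)) (p * ψ') (q * starRingEnd ℂ ψ') z := by
  refine (HasFDerivAt.comp z hf (hψ.hasFDerivAt.restrictScalars ℝ)).congr_fderiv ?_
  ext
  simp
  ring

lemma of_differentiableAt (h : DifferentiableAt ℝ f z) :
    HasWirtinger f (wirtinger f z) (wirtingerBar f z) z := by
  refine h.hasFDerivAt.congr_fderiv ?_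
  ext x
  have hx : x = x.re • (1 : ℂ) + x.im • Complex.I := by simp [Complex.re_add_im]
  have h1 : fderiv ℝ f z x = x.re * fderiv ℝ f z 1 + x.im * fderiv ℝ f z Complex.I := by
    conv_lhs => rw [hx, map_add, map_smul, map_smul]
    simp
  have h2 : starRingEnd ℂ x = x.re - x.im * Complex.I := by
    apply Complex.ext <;> simp
  have h3 : x = x.re + x.im * Complex.I := (Complex.re_add_im x).symm
  simp only [wirtinger, wirtingerBar, add_apply, smul_apply, ContinuousLinearMap.id_apply,
    ContinuousLinearEquiv.coe_coe, Complex.conjCLE_apply, smul_eq_mul]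
  rw [h1, h2]
  generalize fderiv ℝ f z 1 = a
  generalize fderiv ℝ f z Complex.I = b
  linear_combination -(a - Complex.I * b) / 2 * h3 + x.im * b * Complex.I_mul_I

lemma unique (h : HasWirtinger f p q z) (h' : HasWirtinger f p' q' z) : p = p' ∧ q = q' :=
  ⟨h.wirtinger_eq.symm.trans h'.wirtinger_eq, h.wirtingerBar_eq.symm.trans h'.wirtingerBar_eq⟩

end HasWirtinger

/-- The entries of `F` are real differentiable at `z`, with `∂F = P` and `∂̄F = Q` there. -/
def HasMatWirtinger {n : Type*} (F : ℂ → Matrix n n ℂ) (P Q : Matrix n n ℂ) (z : ℂ) : Prop :=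
  ∀ i j, HasWirtinger (fun u => F u i j) (P i j) (Q i j) z

namespace HasMatWirtinger

variable {n : Type*} {F G : ℂ → Matrix n n ℂ} {P Q P' Q' : Matrix n n ℂ} {z : ℂ}

lemma matWirtinger_eq (h : HasMatWirtinger F P Q z) : matWirtinger F z = P := by
  ext i j
  exact (h i j).wirtinger_eq

lemma matWirtingerBar_eq (h : HasMatWirtinger F P Q z) : matWirtingerBar F z = Q := by
  ext i j
  exact (h i j).wirtingerBar_eq

lemma congr (h : HasMatWirtinger F P Q z) (hp : P = P') (hq : Q = Q') :
    HasMatWirtinger F P' Q' z := by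
  rwa [← hp, ← hq]

lemma congr_of_eventuallyEq (h : HasMatWirtinger F P Q z) (hg : G =ᶠ[𝓝 z] F) :
    HasMatWirtinger G P Q z := fun i j =>
  (h i j).congr_of_eventuallyEq (hg.mono fun _ hu => congrFun (congrFun hu i) j)

lemma const (A : Matrix n n ℂ) (z : ℂ) : HasMatWirtinger (fun _ => A) 0 0 z := fun i j =>
  HasWirtinger.const (A i j) z

lemma of_hasDerivAt {G' : Matrix n n ℂ} (h : ∀ i j, HasDerivAt (fun u => G u i j) (G' i j) z) :
    HasMatWirtinger G G' 0 z := fun i j => (h i j).hasWirtinger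

lemma conjTranspose (h : HasMatWirtinger F P Q z) :
    HasMatWirtinger (fun u => (F u)ᴴ) Qᴴ Pᴴ z := fun i j => (h j i).conjugate

lemma add (hF : HasMatWirtinger F P Q z) (hG : HasMatWirtinger G P' Q' z) :
    HasMatWirtinger (fun u => F u + G u) (P + P') (Q + Q') z := fun i j => (hF i j).add (hG i j)

lemma smul {f : ℂ → ℂ} {p q : ℂ} (hf : HasWirtinger f p q z) (hF : HasMatWirtinger F P Q z) :
    HasMatWirtinger (fun u => f u • F u) (p • F z + f z • P) (q • F z + f z • Q) z := fun i j =>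
  hf.mul (hF i j)

lemma mul [Fintype n] (hF : HasMatWirtinger F P Q z) (hG : HasMatWirtinger G P' Q' z) :
    HasMatWirtinger (fun u => F u * G u) (P * G z + F z * P') (Q * G z + F z * Q') z :=
  fun i j => by
    simp only [Matrix.mul_apply, Matrix.add_apply, ← Finset.sum_add_distrib]
    exact HasWirtinger.sum fun k _ => (hF i k).mul (hG k j)

lemma comp_right {ψ : ℂ → ℂ} {ψ' : ℂ} (hF : HasMatWirtinger F P Q (ψ z))
    (hψ : HasDerivAt ψ ψ' z) :
    HasMatWirtinger (fun u => F (ψ u)) (ψ' • P) (conj ψ' • Q) z := fun i j =>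
  ((hF i j).comp_right hψ).congr (mul_comm _ _) (mul_comm _ _)

lemma unique (h : HasMatWirtinger F P Q z) (h' : HasMatWirtinger F P' Q' z) :
    P = P' ∧ Q = Q' :=
  ⟨h.matWirtinger_eq.symm.trans h'.matWirtinger_eq,
    h.matWirtingerBar_eq.symm.trans h'.matWirtingerBar_eq⟩

lemma differentiableAt_det [Fintype n] [DecidableEq n]
    (h : ∀ i j, DifferentiableAt ℝ (fun u => F u i j) z) :
    DifferentiableAt ℝ (fun u => (F u).det) z := by
  simp only [Matrix.det_apply]
  refine DifferentiableAt.fun_sum fun σ _ => DifferentiableAt.fun_const_smul ?_ _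
  exact (HasFDerivAt.finsetProd fun i _ => (h (σ i) i).hasFDerivAt).differentiableAt

lemma inv [Fintype n] [DecidableEq n] (h : HasMatWirtinger F P Q z) (hF : IsUnit (F z)) :
    HasMatWirtinger (fun u => (F u)⁻¹) (-((F z)⁻¹ * P * (F z)⁻¹)) (-((F z)⁻¹ * Q * (F z)⁻¹)) z := by
  have hd : ∀ i j, DifferentiableAt ℝ (fun u => F u i j) z := fun i j =>
    HasFDerivAt.differentiableAt (h i j)
  have hdet := differentiableAt_det hd
  have hF' := (Matrix.isUnit_iff_isUnit_det _).mp hF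
  have hinv : HasMatWirtinger (fun u => (F u)⁻¹) (matWirtinger (fun u => (F u)⁻¹) z)
      (matWirtingerBar (fun u => (F u)⁻¹) z) z := fun i j => by
    refine HasWirtinger.of_differentiableAt ?_
    simp only [Matrix.inv_def, Ring.inverse_eq_inv', Matrix.smul_apply, smul_eq_mul,
      Matrix.adjugate_apply]
    refine (hdet.inv hF'.ne_zero).mul (differentiableAt_det fun k l => ?_)
    by_cases hk : k = j
    · subst hk
      simp
    · simpa [Matrix.updateRow_ne hk] using hd k l
  have hone : HasMatWirtinger (fun u => F u * (F u)⁻¹) 0 0 z := by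
    refine (const 1 z).congr_of_eventuallyEq ?_
    filter_upwards [hdet.continuousAt.eventually_ne hF'.ne_zero] with u hu
    exact Matrix.mul_nonsing_inv _ (isUnit_iff_ne_zero.mpr hu)
  obtain ⟨h1, h2⟩ := (h.mul hinv).unique hone
  refine hinv.congr ?_ ?_
  · rw [add_comm, add_eq_zero_iff_eq_neg] at h1
    rw [← Matrix.nonsing_inv_mul_cancel_left _ (matWirtinger _ z) hF', h1, Matrix.mul_neg,
      Matrix.mul_assoc]
  · rw [add_comm, add_eq_zero_iff_eq_neg] at h2
    rw [← Matrix.nonsing_inv_mul_cancel_left _ (matWirtingerBar _ z) hF', h2, Matrix.mul_neg,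
      Matrix.mul_assoc]

end HasMatWirtinger

end KoranyiMisra

namespace KoranyiMisra

open Filter Topology

/-! ### The curvature -/

/-- The curvature of the pullback `G* (k ∘ ψ) G` of a metric `k`, for holomorphic `G` and `ψ`, in
terms of the value `Q` of `∂̄ (k⁻¹ ∂k)` at `ψ(a)`. The function `k'` is `∂k`. -/
theorem curvatureOf_pullback {n : Type*} [Fintype n] [DecidableEq n] {h k k' G : ℂ → Matrix n n ℂ}
    {ψ : ℂ → ℂ} {U : Set ℂ} (hU : IsOpen U) {a : ℂ} (ha : a ∈ U)
    (hh : ∀ u ∈ U, h u = (G u)ᴴ * k (ψ u) * G u)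
    (hG : ∀ i j, DifferentiableOn ℂ (fun u => G u i j) U) (hGu : ∀ u ∈ U, IsUnit (G u))
    (hψ : DifferentiableOn ℂ ψ U)
    (hk : ∀ u ∈ U, ∃ Q, HasMatWirtinger k (k' (ψ u)) Q (ψ u)) (hku : ∀ u ∈ U, IsUnit (k (ψ u)))
    {P Q : Matrix n n ℂ} (hθ : HasMatWirtinger (fun v => (k v)⁻¹ * k' v) P Q (ψ a)) :
    curvatureOf h a = (deriv ψ a * conj (deriv ψ a)) • ((G a)⁻¹ * Q * G a) := by
  let G' : ℂ → Matrix n n ℂ := fun u => Matrix.of fun i j => deriv (fun v => G v i j) u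
  have hGd : ∀ u ∈ U, HasMatWirtinger G (G' u) 0 u := fun u hu =>
    HasMatWirtinger.of_hasDerivAt fun i j =>
      ((hG i j).differentiableAt (hU.mem_nhds hu)).hasDerivAt
  have hG'd : HasMatWirtinger G' (Matrix.of fun i j => deriv (fun v => G' v i j) a) 0 a :=
    HasMatWirtinger.of_hasDerivAt fun i j =>
      (((hG i j).deriv hU).differentiableAt (hU.mem_nhds ha)).hasDerivAt
  have hψd : ∀ u ∈ U, HasDerivAt ψ (deriv ψ u) u := fun u hu =>
    (hψ.differentiableAt (hU.mem_nhds hu)).hasDerivAt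
  have hψ'd : HasWirtinger (deriv ψ) (deriv (deriv ψ) a) 0 a :=
    ((hψ.deriv hU).differentiableAt (hU.mem_nhds ha)).hasDerivAt.hasWirtinger
  have hdh : ∀ u ∈ U, matWirtinger h u =
      (G u)ᴴ * (deriv ψ u • k' (ψ u)) * G u + (G u)ᴴ * k (ψ u) * G' u := fun u hu => by
    obtain ⟨R, hR⟩ := hk u hu
    have := ((hGd u hu).conjTranspose.mul (hR.comp_right (hψd u hu))).mul (hGd u hu)
    have hev : h =ᶠ[𝓝 u] fun u => (G u)ᴴ * k (ψ u) * G u :=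
      eventually_of_mem (hU.mem_nhds hu) hh
    rw [(this.congr_of_eventuallyEq hev).matWirtinger_eq]
    simp
  have hform : ∀ u ∈ U, (h u)⁻¹ * matWirtinger h u =
      (G u)⁻¹ * (deriv ψ u • ((k (ψ u))⁻¹ * k' (ψ u))) * G u + (G u)⁻¹ * G' u := fun u hu => by
    have h1 : IsUnit ((G u)ᴴ).det := (Matrix.isUnit_iff_isUnit_det _).mp (hGu u hu).star
    have h2 := (Matrix.isUnit_iff_isUnit_det _).mp (hku u hu)
    rw [hdh u hu, hh u hu, Matrix.mul_inv_rev, Matrix.mul_inv_rev, Matrix.mul_add]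
    simp only [Matrix.mul_assoc]
    rw [Matrix.nonsing_inv_mul_cancel_left _ _ h1, Matrix.nonsing_inv_mul_cancel_left _ _ h1,
      Matrix.nonsing_inv_mul_cancel_left _ _ h2]
    simp only [Matrix.smul_mul, Matrix.mul_smul, Matrix.mul_assoc]
  have hinv := (hGd a ha).inv (hGu a ha)
  have hfin := ((hinv.mul (HasMatWirtinger.smul hψ'd (hθ.comp_right (hψd a ha)))).mul
    (hGd a ha)).add (hinv.mul hG'd)
  have hev : (fun u => (h u)⁻¹ * matWirtinger h u) =ᶠ[𝓝 a] _ :=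
    eventually_of_mem (hU.mem_nhds ha) hform
  rw [curvatureOf, (hfin.congr_of_eventuallyEq hev).matWirtingerBar_eq]
  simp [smul_smul]

/-! ### The curvature of the kernel at the origin -/

/-- The left factor of the transposed kernel on the diagonal: `K(z, z)ᵗ` is a scalar multiple of
`A(z) B A(z)*`. -/
def metricFactor (z : ℂ) : Matrix (Fin 3) (Fin 3) ℂ :=
  !![(1 - z * conj z) ^ 2, 0, 0;
    (1 - z * conj z) * z, 1 - z * conj z, 0;
    z ^ 2, 2 * z, 1]

/-- `∂A`, for `A = metricFactor`. -/
def metricFactorDz (z : ℂ) : Matrix (Fin 3) (Fin 3) ℂ :=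
  !![-2 * (1 - z * conj z) * conj z, 0, 0;
    1 - 2 * z * conj z, -conj z, 0;
    2 * z, 2, 0]

/-- `∂̄A`, for `A = metricFactor`. -/
def metricFactorDbar (z : ℂ) : Matrix (Fin 3) (Fin 3) ℂ :=
  !![-2 * (1 - z * conj z) * z, 0, 0;
    -z ^ 2, -z, 0;
    0, 0, 0]

lemma hasWirtinger_id (z : ℂ) : HasWirtinger (fun u => u) 1 0 z := (hasDerivAt_id z).hasWirtinger

lemma hasWirtinger_conj (z : ℂ) : HasWirtinger (fun u => conj u) 0 1 z := by
  simpa using (hasWirtinger_id z).conjugate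

lemma hasWirtinger_one_sub (z : ℂ) :
    HasWirtinger (fun u => 1 - u * conj u) (-conj z) (-z) z := by
  have := HasWirtinger.comp_left (F := fun x => 1 - x) (F' := -1)
    ((hasDerivAt_id _).const_sub 1) ((hasWirtinger_id z).mul (hasWirtinger_conj z))
  exact this.congr (by ring) (by ring)

lemma hasMatWirtinger_metricFactor (z : ℂ) :
    HasMatWirtinger metricFactor (metricFactorDz z) (metricFactorDbar z) z := by
  have hq := hasWirtinger_one_sub z
  have hz := hasWirtinger_id z
  have h00 : HasWirtinger (fun u => (1 - u * conj u) ^ 2) (-2 * (1 - z * conj z) * conj z)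
      (-2 * (1 - z * conj z) * z) z := by
    simpa only [sq] using (hq.mul hq).congr (by ring) (by ring)
  have h10 : HasWirtinger (fun u => (1 - u * conj u) * u) (1 - 2 * z * conj z) (-z ^ 2) z :=
    (hq.mul hz).congr (by ring) (by ring)
  have h20 : HasWirtinger (fun u => u ^ 2) (2 * z) 0 z := by
    simpa only [sq] using (hz.mul hz).congr (by ring) (by ring)
  have h21 : HasWirtinger (fun u => 2 * u) 2 0 z :=
    ((HasWirtinger.const 2 z).mul hz).congr (by ring) (by ring)
  have h0 := HasWirtinger.const 0 z
  have h1 := HasWirtinger.const 1 z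
  intro i j
  match i, j with
  | 0, 0 => exact h00
  | 0, 1 => exact h0
  | 0, 2 => exact h0
  | 1, 0 => exact h10
  | 1, 1 => exact hq
  | 1, 2 => exact h0
  | 2, 0 => exact h20
  | 2, 1 => exact h21
  | 2, 2 => exact h1

lemma hasMatWirtinger_metricFactorDz :
    HasMatWirtinger metricFactorDz !![0, 0, 0; 0, 0, 0; 2, 0, 0] !![-2, 0, 0; 0, -1, 0; 0, 0, 0]
      0 := by
  have hq := hasWirtinger_one_sub 0
  have hz := hasWirtinger_id 0
  have hz' := hasWirtinger_conj 0
  have hc := fun c => HasWirtinger.const c 0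
  have h00 : HasWirtinger (fun u => -2 * (1 - u * conj u) * conj u) 0 (-2) 0 :=
    (((hc (-2)).mul hq).mul hz').congr (by simp) (by simp)
  have h10 : HasWirtinger (fun u => 1 - 2 * u * conj u) 0 0 0 := by
    have := (hc 1).add ((hc (-2)).mul (hz.mul hz'))
    simp only [mul_zero, map_zero, add_zero, mul_one] at this
    convert this using 2
    ring
  have h11 : HasWirtinger (fun u => -conj u) 0 (-1) 0 := by
    simpa using (hc (-1)).mul hz'
  have h20 : HasWirtinger (fun u => 2 * u) 2 0 0 := by
    simpa using (hc 2).mul hz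
  intro i j
  match i, j with
  | 0, 0 => exact h00
  | 0, 1 => exact hc 0
  | 0, 2 => exact hc 0
  | 1, 0 => exact h10
  | 1, 1 => exact h11
  | 1, 2 => exact hc 0
  | 2, 0 => exact h20
  | 2, 1 => exact hc 2
  | 2, 2 => exact hc 0

lemma hasMatWirtinger_metricFactorDbar :
    HasMatWirtinger metricFactorDbar !![-2, 0, 0; 0, -1, 0; 0, 0, 0] 0 0 := by
  have hq := hasWirtinger_one_sub 0
  have hz := hasWirtinger_id 0
  have hc := fun c => HasWirtinger.const c 0
  have h00 : HasWirtinger (fun u => -2 * (1 - u * conj u) * u) (-2) 0 0 :=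
    (((hc (-2)).mul hq).mul hz).congr (by simp) (by simp)
  have h10 : HasWirtinger (fun u => -u ^ 2) 0 0 0 := by
    have := (hc (-1)).mul (hz.mul hz)
    simp only [mul_zero, add_zero, zero_mul] at this
    convert this using 2
    ring
  have h11 : HasWirtinger (fun u => -u) (-1) 0 0 := by
    simpa using (hc (-1)).mul hz
  intro i j
  match i, j with
  | 0, 0 => exact h00
  | 0, 1 => exact hc 0
  | 0, 2 => exact hc 0
  | 1, 0 => exact h10
  | 1, 1 => exact h11
  | 1, 2 => exact hc 0
  | 2, 0 => exact hc 0
  | 2, 1 => exact hc 0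
  | 2, 2 => exact hc 0

lemma transpose_polyKernel (d : Fin 3 → ℝ) (z : ℂ) :
    (polyKernel d z z)ᵀ =
      metricFactor z * Matrix.diagonal (fun l => (d l : ℂ)) * (metricFactor z)ᴴ := by
  have h1 : ((leftFactor z z)ᴴ)ᵀ = metricFactor z := by
    ext i j
    fin_cases i <;> fin_cases j <;> simp [leftFactor, metricFactor, mul_comm]
  have h2 : (leftFactor z z)ᵀ = (metricFactor z)ᴴ := by
    rw [← h1]
    ext i j
    simp
  rw [polyKernel, Matrix.transpose_mul, Matrix.transpose_mul, h1, h2, Matrix.diagonal_transpose,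
    Matrix.mul_assoc]

/-- The metric `z ↦ K(z, z)ᵗ`, with `γ = 2 lam + 2` and `d = vecD`. -/
def kernelMetric (γ : ℝ) (d : Fin 3 → ℝ) (z : ℂ) : Matrix (Fin 3) (Fin 3) ℂ :=
  invPow γ (z * conj z) •
    (metricFactor z * Matrix.diagonal (fun l => (d l : ℂ)) * (metricFactor z)ᴴ)

lemma transpose_kernel (lam : ℝ) (μ : Fin 3 → ℝ) (z : ℂ) :
    (kernel 2 lam μ z z)ᵀ = kernelMetric (2 * lam + 2) (vecD 2 lam μ) z := by
  rw [kernel_eq, kernelMetric, ← transpose_polyKernel]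
  rfl

lemma hasDerivAt_invPow (γ : ℝ) {x : ℂ} (hx : ‖x‖ < 1) :
    HasDerivAt (invPow γ) (γ * invPow (γ + 1) x) x := by
  have h := ((hasDerivAt_id x).const_sub 1).cpow_const (c := -(γ : ℂ))
    (Or.inl (re_one_sub_pos hx))
  refine h.congr_deriv ?_
  rw [invPow, show (-((γ + 1 : ℝ) : ℂ)) = -γ - 1 by push_cast; ring]
  simp

lemma invPow_zero (γ : ℝ) : invPow γ 0 = 1 := by simp [invPow]

lemma norm_mul_conj_self {z : ℂ} (hz : ‖z‖ < 1) : ‖z * conj z‖ < 1 := by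
  rw [mul_comm]
  exact norm_conj_mul_lt hz hz

lemma hasWirtinger_invPow (γ : ℝ) {z : ℂ} (hz : ‖z‖ < 1) :
    HasWirtinger (fun u => invPow γ (u * conj u)) (γ * invPow (γ + 1) (z * conj z) * conj z)
      (γ * invPow (γ + 1) (z * conj z) * z) z := by
  have := HasWirtinger.comp_left (f := fun u => u * conj u)
    (hasDerivAt_invPow γ (norm_mul_conj_self hz))
    ((hasWirtinger_id z).mul (hasWirtinger_conj z))
  exact this.congr (by ring) (by ring)

/-- `∂` of `z ↦ K(z, z)ᵗ`. -/
def kernelDz (γ : ℝ) (d : Fin 3 → ℝ) (z : ℂ) : Matrix (Fin 3) (Fin 3) ℂ :=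
  (γ * invPow (γ + 1) (z * conj z) * conj z) •
      (metricFactor z * Matrix.diagonal (fun l => (d l : ℂ)) * (metricFactor z)ᴴ) +
    invPow γ (z * conj z) •
      (metricFactorDz z * Matrix.diagonal (fun l => (d l : ℂ)) * (metricFactor z)ᴴ +
        metricFactor z * Matrix.diagonal (fun l => (d l : ℂ)) * (metricFactorDbar z)ᴴ)

lemma hasMatWirtinger_polyMetric (d : Fin 3 → ℝ) (z : ℂ) :
    HasMatWirtinger
      (fun u => metricFactor u * Matrix.diagonal (fun l => (d l : ℂ)) * (metricFactor u)ᴴ)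
      (metricFactorDz z * Matrix.diagonal (fun l => (d l : ℂ)) * (metricFactor z)ᴴ +
        metricFactor z * Matrix.diagonal (fun l => (d l : ℂ)) * (metricFactorDbar z)ᴴ)
      (metricFactorDbar z * Matrix.diagonal (fun l => (d l : ℂ)) * (metricFactor z)ᴴ +
        metricFactor z * Matrix.diagonal (fun l => (d l : ℂ)) * (metricFactorDz z)ᴴ) z := by
  have hA := hasMatWirtinger_metricFactor z
  exact ((hA.mul (HasMatWirtinger.const _ z)).mul hA.conjTranspose).congr (by simp) (by simp)

lemma hasMatWirtinger_kernelMetric (γ : ℝ) (d : Fin 3 → ℝ) {z : ℂ} (hz : ‖z‖ < 1) :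
    ∃ Q, HasMatWirtinger (kernelMetric γ d) (kernelDz γ d z) Q z :=
  ⟨_, HasMatWirtinger.smul (hasWirtinger_invPow γ hz) (hasMatWirtinger_polyMetric d z)⟩

lemma metricFactor_zero : metricFactor 0 = 1 := by
  ext i j
  fin_cases i <;> fin_cases j <;> simp [metricFactor]

lemma metricFactorDz_zero : metricFactorDz 0 = !![0, 0, 0; 1, 0, 0; 0, 2, 0] := by
  simp [metricFactorDz]

lemma metricFactorDbar_zero : metricFactorDbar 0 = 0 := by
  ext i j
  fin_cases i <;> fin_cases j <;> simp [metricFactorDbar]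

/-- `∂̄ (k⁻¹ ∂k)` at the origin, for `k(z) = K(z, z)ᵗ`. -/
lemma hasMatWirtinger_inv_mul_kernelDz (γ : ℝ) {d : Fin 3 → ℝ} (hd : ∀ l, 0 < d l)
    (h0 : d 0 = 1) :
    ∃ P, HasMatWirtinger (fun z => (kernelMetric γ d z)⁻¹ * kernelDz γ d z) P
      (Matrix.diagonal fun i => ((γ + firstCoeff d i : ℝ) : ℂ)) 0 := by
  have hz : ‖(0 : ℂ)‖ < 1 := by simp
  have hk := HasMatWirtinger.smul (hasWirtinger_invPow γ hz) (hasMatWirtinger_polyMetric d 0)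
  have hB : (Matrix.diagonal fun l => (d l : ℂ)) * (Matrix.diagonal fun l => (d l : ℂ)⁻¹) = 1 := by
    rw [Matrix.diagonal_mul_diagonal, ← Matrix.diagonal_one]
    congr 1
    funext l
    exact mul_inv_cancel₀ (by exact_mod_cast (hd l).ne')
  have hBinv : (Matrix.diagonal fun l => (d l : ℂ))⁻¹ = Matrix.diagonal fun l => (d l : ℂ)⁻¹ :=
    Matrix.inv_eq_right_inv hB
  have hinv := hk.inv (by
    simpa [invPow_zero, metricFactor_zero] using IsUnit.of_mul_eq_one _ hB)
  have hA := hasMatWirtinger_metricFactor 0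
  have hA1 := hasMatWirtinger_metricFactorDz
  have hA2 := hasMatWirtinger_metricFactorDbar
  have hB' := HasMatWirtinger.const (Matrix.diagonal fun l => (d l : ℂ)) 0
  have hs := ((HasWirtinger.const (γ : ℂ) 0).mul (hasWirtinger_invPow (γ + 1) hz)).mul
    (hasWirtinger_conj 0)
  have hdk := (HasMatWirtinger.smul hs (hasMatWirtinger_polyMetric d 0)).add
    (HasMatWirtinger.smul (hasWirtinger_invPow γ hz)
      (((hA1.mul hB').mul hA.conjTranspose).add ((hA.mul hB').mul hA2.conjTranspose)))
  refine ⟨_, (hinv.mul hdk).congr rfl ?_⟩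
  have h1 : (d 1 : ℂ) ≠ 0 := by exact_mod_cast (hd 1).ne'
  have h2 : (d 2 : ℂ) ≠ 0 := by exact_mod_cast (hd 2).ne'
  have hdiag : ∀ v : Fin 3 → ℂ, Matrix.diagonal v = !![v 0, 0, 0; 0, v 1, 0; 0, 0, v 2] :=
    fun v => by
      ext i j
      fin_cases i <;> fin_cases j <;> simp
  have hS : !![0, 0, 0; 1, 0, 0; 0, 2, (0 : ℂ)]ᴴ = !![0, 1, 0; 0, 0, 2; 0, 0, 0] := by
    ext i j
    fin_cases i <;> fin_cases j <;> simp
  have hN : !![-2, 0, 0; 0, -1, 0; 0, 0, (0 : ℂ)]ᴴ = !![-2, 0, 0; 0, -1, 0; 0, 0, 0] := by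
    ext i j
    fin_cases i <;> fin_cases j <;> simp
  simp only [map_zero, mul_zero, invPow_zero, metricFactor_zero, metricFactorDz_zero,
    metricFactorDbar_zero, one_smul, zero_smul, Matrix.conjTranspose_one, one_mul, mul_one,
    Matrix.conjTranspose_zero, zero_mul, add_zero, zero_add, hBinv, hS, hN]
  simp only [hdiag]
  ext i j
  fin_cases i <;> fin_cases j <;>
    simp [firstCoeff, h0] <;>
    try (field_simp; ring)

end KoranyiMisra

namespace KoranyiMisra

/-! ### The curvature on the disc -/

section Frame

variable {lam : ℝ} {μ : Fin 3 → ℝ}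

/-- The holomorphic change of frame which carries the metric `z ↦ K(z, z)ᵗ` into the normalized
one. -/
def normalizingFrame (lam : ℝ) (μ : Fin 3 → ℝ) (z : ℂ) : Matrix (Fin 3) (Fin 3) ℂ :=
  ((kernel 2 lam μ z 0)⁻¹)ᵀ * sqrtB 2 lam μ

/-- The holomorphic change of frame which expresses the normalized metric through the pullback of
`z ↦ K(z, z)ᵗ` under the automorphism `moebius 1 a`. -/
def moebiusFrame (lam : ℝ) (μ : Fin 3 → ℝ) (a z : ℂ) : Matrix (Fin 3) (Fin 3) ℂ :=
  (cocycle lam 1 a z)ᵀ * normalizingFrame lam μ z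

lemma kernel_zero_right (lam : ℝ) (μ : Fin 3 → ℝ) (z : ℂ) :
    kernel 2 lam μ z 0 = polyKernel (vecD 2 lam μ) z 0 := by
  rw [kernel_eq]
  simp [invPow_zero]

lemma kernel_zero_left (lam : ℝ) (μ : Fin 3 → ℝ) (w : ℂ) :
    kernel 2 lam μ 0 w = (kernel 2 lam μ w 0)ᴴ := by
  rw [kernel_eq, kernel_zero_right]
  simp [invPow_zero, polyKernel_conjTranspose]

lemma sqrtB_conjTranspose (lam : ℝ) (μ : Fin 3 → ℝ) : (sqrtB 2 lam μ)ᴴ = sqrtB 2 lam μ := by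
  rw [sqrtB, Matrix.diagonal_conjTranspose]
  congr 1
  funext l
  simp

/-- The normalized metric as a pullback, by quasi-invariance of the kernel. The automorphism
`moebius 1 a` maps `a` to the origin. -/
lemma metric_eq {a u : ℂ} (ha : ‖a‖ < 1) (hu : ‖u‖ < 1) :
    metric 2 lam μ u = (moebiusFrame lam μ a u)ᴴ *
      kernelMetric (2 * lam + 2) (vecD 2 lam μ) (moebius 1 a u) * moebiusFrame lam μ a u := by
  have e1 : ∀ A : Matrix (Fin 3) (Fin 3) ℂ, Aᵀᴴ = Aᴴᵀ := fun A => by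
    ext i j
    simp
  rw [metric, normalizedKernel, kernel_zero_left, ← kernel_moebius lam μ norm_one ha hu hu,
    ← transpose_kernel, moebiusFrame, normalizingFrame]
  simp only [Matrix.conjTranspose_mul, Matrix.transpose_mul, e1, Matrix.conjTranspose_nonsing_inv,
    sqrtB_conjTranspose, Matrix.mul_assoc]
  simp only [sqrtB, Matrix.diagonal_transpose]

lemma isUnit_sqrtB (h : Admissible 2 lam μ) : IsUnit (sqrtB 2 lam μ) := by
  rw [Matrix.isUnit_iff_isUnit_det, sqrtB, Matrix.det_diagonal, isUnit_iff_ne_zero]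
  refine Finset.prod_ne_zero_iff.mpr fun l _ => ?_
  exact_mod_cast (Real.sqrt_pos.mpr (vecD_pos h l)).ne'

lemma isUnit_moebiusFrame (h : Admissible 2 lam μ) {a u : ℂ} (ha : ‖a‖ < 1) (hu : ‖u‖ < 1) :
    IsUnit (moebiusFrame lam μ a u) := by
  refine ((Matrix.isUnit_transpose _).mpr (isUnit_cocycle lam norm_one ha hu)).mul
    (((Matrix.isUnit_transpose _).mpr ?_).mul (isUnit_sqrtB h))
  rw [Matrix.isUnit_nonsing_inv_iff, kernel_zero_right]
  exact isUnit_polyKernel_zero_right (vecD_pos h) u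

lemma differentiableOn_cocycle (lam : ℝ) {a : ℂ} (ha : ‖a‖ < 1) (i j : Fin 3) :
    DifferentiableOn ℂ (fun u => cocycle lam 1 a u i j) (Metric.ball 0 1) := by
  intro u hu
  have hq := norm_conj_mul_lt ha (mem_ball_zero_iff.mp hu)
  have hq0 := one_sub_ne_zero_of_norm_lt hq
  have hlin : DifferentiableAt ℂ (fun u => 1 - conj a * u) u := by fun_prop
  have hs : DifferentiableAt ℂ (fun u => cocycleScalar (2 * lam - 2) a u) u := by
    refine DifferentiableAt.cexp ((differentiableAt_const _).sub
      ((differentiableAt_const _).mul (hlin.clog (Or.inl (re_one_sub_pos hq)))))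
  have hm : DifferentiableAt ℂ (fun u => cocycleMatrix 1 a u i j) u := by
    fin_cases i <;> fin_cases j <;> simp [cocycleMatrix] <;> fun_prop (disch := simpa using hq0)
  exact (hs.mul hm).differentiableWithinAt

lemma differentiable_normalizingFrame (h : Admissible 2 lam μ) (i j : Fin 3) :
    Differentiable ℂ fun u => normalizingFrame lam μ u i j := by
  simp only [normalizingFrame, kernel_zero_right, inv_polyKernel (vecD_pos h), sqrtB]
  fin_cases i <;> fin_cases j <;>
    simp [expBackward, Matrix.mul_apply, Fin.sum_univ_three, Matrix.vecMul_diagonal] <;> fun_prop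

lemma differentiableOn_moebiusFrame (h : Admissible 2 lam μ) {a : ℂ} (ha : ‖a‖ < 1)
    (i j : Fin 3) :
    DifferentiableOn ℂ (fun u => moebiusFrame lam μ a u i j) (Metric.ball 0 1) := by
  simp only [moebiusFrame, Matrix.mul_apply, Matrix.transpose_apply]
  exact DifferentiableOn.fun_sum fun k _ => (differentiableOn_cocycle lam ha k i).mul
    (differentiable_normalizingFrame h k j).differentiableOn

lemma differentiableOn_moebius {a : ℂ} (ha : ‖a‖ < 1) :
    DifferentiableOn ℂ (moebius 1 a) (Metric.ball 0 1) := by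
  intro u hu
  have hq0 := one_sub_ne_zero_of_norm_lt (norm_conj_mul_lt ha (mem_ball_zero_iff.mp hu))
  refine DifferentiableAt.differentiableWithinAt ?_
  unfold moebius
  fun_prop (disch := exact hq0)

lemma isUnit_kernelMetric {γ : ℝ} {d : Fin 3 → ℝ} (hd : ∀ l, 0 < d l) {z : ℂ} (hz : ‖z‖ < 1) :
    IsUnit (kernelMetric γ d z) := by
  have hx := one_sub_ne_zero_of_norm_lt (norm_mul_conj_self hz)
  have hA : IsUnit (metricFactor z) := by
    rw [Matrix.isUnit_iff_isUnit_det, isUnit_iff_ne_zero, Matrix.det_fin_three]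
    simp [metricFactor, hx]
  rw [kernelMetric]
  refine IsUnit.smul (Units.mk0 (invPow γ (z * conj z)) ?_) ((hA.mul ?_).mul hA.star)
  · rw [invPow, Complex.cpow_def_of_ne_zero hx]
    exact Complex.exp_ne_zero _
  · rw [Matrix.isUnit_iff_isUnit_det, Matrix.det_diagonal, isUnit_iff_ne_zero]
    exact Finset.prod_ne_zero_iff.mpr fun l _ => by exact_mod_cast (hd l).ne'

/-- The eigenvalues of the curvature at the origin, in the order of the diagonal entries
(see `curvature_zero`). -/
def curvatureEigenvalue (lam : ℝ) (μ : Fin 3 → ℝ) (i : Fin 3) : ℝ :=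
  2 * lam + 2 + firstCoeff (vecD 2 lam μ) i

lemma moebius_self (c a : ℂ) : moebius c a a = 0 := by simp [moebius]

/-- The curvature at an arbitrary point, obtained by moving the point to the origin. -/
theorem curvature_eq (h : Admissible 2 lam μ) {a : ℂ} (ha : ‖a‖ < 1) :
    curvature 2 lam μ a = (deriv (moebius 1 a) a * conj (deriv (moebius 1 a) a)) •
      ((moebiusFrame lam μ a a)⁻¹ *
        Matrix.diagonal (fun i => (curvatureEigenvalue lam μ i : ℂ)) * moebiusFrame lam μ a a) := by
  obtain ⟨P, hP⟩ := hasMatWirtinger_inv_mul_kernelDz (2 * lam + 2) (vecD_pos h) (vecD_zero h)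
  have hball : ∀ u ∈ Metric.ball (0 : ℂ) 1, ‖moebius 1 a u‖ < 1 := fun u hu =>
    norm_moebius_lt_one norm_one ha (mem_ball_zero_iff.mp hu)
  refine curvatureOf_pullback (P := P) Metric.isOpen_ball (mem_ball_zero_iff.mpr ha)
    (fun u hu => metric_eq ha (mem_ball_zero_iff.mp hu)) (differentiableOn_moebiusFrame h ha)
    (fun u hu => isUnit_moebiusFrame h ha (mem_ball_zero_iff.mp hu)) (differentiableOn_moebius ha)
    (fun u hu => hasMatWirtinger_kernelMetric _ _ (hball u hu))
    (fun u hu => isUnit_kernelMetric (vecD_pos h) (hball u hu)) ?_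
  rw [moebius_self]
  exact hP

lemma metric_eq_self (lam : ℝ) (μ : Fin 3 → ℝ) {a : ℂ} (ha : ‖a‖ < 1) :
    metric 2 lam μ a =
      (moebiusFrame lam μ a a)ᴴ * matB 2 lam μ * moebiusFrame lam μ a a := by
  rw [metric_eq ha ha, moebius_self, ← transpose_kernel, kernel_zero_zero, matB,
    Matrix.diagonal_transpose]

theorem curvature_zero (h : Admissible 2 lam μ) :
    curvature 2 lam μ 0 = Matrix.diagonal fun i => (curvatureEigenvalue lam μ i : ℂ) := by
  have h0 : ‖(0 : ℂ)‖ < 1 := by simp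
  have hm : moebius 1 0 = id := by
    funext u
    simp [moebius]
  have hc : cocycle lam 1 0 0 = 1 := by
    ext i j
    fin_cases i <;> fin_cases j <;> simp [cocycle, cocycleScalar, cocycleMatrix]
  have hu := (Matrix.isUnit_iff_isUnit_det _).mp (isUnit_moebiusFrame h h0 h0)
  have hf : moebiusFrame lam μ 0 0 = Matrix.diagonal fun i =>
      (vecD 2 lam μ i : ℂ)⁻¹ * √(vecD 2 lam μ i) := by
    have hone : expBackward 0 = 1 := by
      ext i j
      fin_cases i <;> fin_cases j <;> simp [expBackward]
    rw [moebiusFrame, hc, normalizingFrame, kernel_zero_right, inv_polyKernel (vecD_pos h),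
      neg_zero, hone, one_mul, Matrix.transpose_one, one_mul, Matrix.diagonal_transpose, sqrtB,
      Matrix.diagonal_mul_diagonal]
  rw [curvature_eq h h0, hm, deriv_id, Matrix.mul_assoc]
  have hcomm : (Matrix.diagonal fun i => (curvatureEigenvalue lam μ i : ℂ)) *
      moebiusFrame lam μ 0 0 = moebiusFrame lam μ 0 0 *
        Matrix.diagonal fun i => (curvatureEigenvalue lam μ i : ℂ) := by
    rw [hf, Matrix.diagonal_mul_diagonal, Matrix.diagonal_mul_diagonal]
    simp only [mul_comm]
  rw [hcomm, Matrix.nonsing_inv_mul_cancel_left _ _ hu]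
  simp

/-- If the eigenvalues of the curvatures at the origin agree up to a permutation, then the
curvatures are unitarily equivalent at every point. -/
theorem fibreUnitarilyEquivalent_of_perm {lam' : ℝ} {μ' : Fin 3 → ℝ} (h : Admissible 2 lam μ)
    (h' : Admissible 2 lam' μ') (σ : Equiv.Perm (Fin 3))
    (hσ : ∀ j, curvatureEigenvalue lam' μ' (σ j) = curvatureEigenvalue lam μ j) {z : ℂ}
    (hz : ‖z‖ < 1) :
    FibreUnitarilyEquivalent (metric 2 lam μ z) (curvature 2 lam μ z)
      (metric 2 lam' μ' z) (curvature 2 lam' μ' z) := by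
  rw [metric_eq_self lam μ hz, metric_eq_self lam' μ' hz, curvature_eq h hz, curvature_eq h' hz]
  set d := vecD 2 lam μ
  set d' := vecD 2 lam' μ'
  have hG := isUnit_moebiusFrame h hz hz
  have hG' := isUnit_moebiusFrame h' hz hz
  set G := moebiusFrame lam μ z z
  set G' := moebiusFrame lam' μ' z z
  have hGd := (Matrix.isUnit_iff_isUnit_det _).mp hG
  have hGd' := (Matrix.isUnit_iff_isUnit_det _).mp hG'
  have hGs' : IsUnit (G'ᴴ).det := (Matrix.isUnit_iff_isUnit_det _).mp hG'.star
  -- the permutation matrix, rescaled so as to be unitary for the metrics at the origin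
  let V : Matrix (Fin 3) (Fin 3) ℂ := Matrix.of fun i j =>
    if i = σ j then (√(d j) : ℂ) / √(d' i) else 0
  have hV1 : Vᴴ * matB 2 lam' μ' * V = matB 2 lam μ := by
    ext j k
    rw [Matrix.mul_apply, Finset.sum_eq_single (σ k)]
    · have h1 : (√(d' (σ k)) : ℂ) ^ 2 = d' (σ k) := by
        exact_mod_cast Real.sq_sqrt (vecD_pos h' _).le
      have h2 : (√(d k) : ℂ) ^ 2 = d k := by exact_mod_cast Real.sq_sqrt (vecD_pos h _).le
      have h3 : (d' (σ k) : ℂ) ≠ 0 := by exact_mod_cast (vecD_pos h' _).ne'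
      have h4 : (√(d' (σ k)) : ℂ) ≠ 0 := by
        exact_mod_cast (Real.sqrt_pos.mpr (vecD_pos h' _)).ne'
      rw [matB, matB, Matrix.mul_diagonal, Matrix.conjTranspose_apply, Matrix.diagonal_apply]
      by_cases hjk : j = k
      · subst hjk
        simp only [V, Matrix.of_apply, if_true, RCLike.star_def, map_div₀, Complex.conj_ofReal]
        change _ / _ * (d' (σ j) : ℂ) * _ = (d j : ℂ)
        rw [← h2, ← h1]
        field_simp
      · have : σ k ≠ σ j := fun he => hjk (σ.injective he).symm
        simp [V, this, hjk]
    · intro i _ hi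
      simp [V, hi]
    · simp
  have hV2 : V * (Matrix.diagonal fun i => (curvatureEigenvalue lam μ i : ℂ)) =
      (Matrix.diagonal fun i => (curvatureEigenvalue lam' μ' i : ℂ)) * V := by
    ext i j
    rw [Matrix.mul_diagonal, Matrix.diagonal_mul]
    by_cases hij : i = σ j
    · rw [hij, hσ, mul_comm]
    · simp [V, hij]
  have hVu : IsUnit V := by
    rw [Matrix.isUnit_iff_isUnit_det, isUnit_iff_ne_zero]
    intro h0
    have := congrArg Matrix.det hV1
    rw [Matrix.det_mul, h0, mul_zero, matB, Matrix.det_diagonal, eq_comm,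
      Finset.prod_eq_zero_iff] at this
    obtain ⟨l, -, hl⟩ := this
    exact (vecD_pos h l).ne' (by exact_mod_cast hl)
  refine ⟨G'⁻¹ * V * G, ((Matrix.isUnit_nonsing_inv_iff.mpr hG').mul hVu).mul hG, ?_, ?_⟩
  · rw [← hV1]
    simp only [Matrix.conjTranspose_mul, Matrix.conjTranspose_nonsing_inv, Matrix.mul_assoc]
    rw [Matrix.mul_nonsing_inv_cancel_left _ _ hGd', Matrix.nonsing_inv_mul_cancel_left _ _ hGs']
  · simp only [Matrix.mul_smul, Matrix.smul_mul, Matrix.mul_assoc]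
    rw [Matrix.mul_nonsing_inv_cancel_left _ _ hGd, Matrix.mul_nonsing_inv_cancel_left _ _ hGd',
      ← Matrix.mul_assoc V, hV2, Matrix.mul_assoc]

end Frame

end KoranyiMisra

namespace KoranyiMisra

/-! ### Parameters with prescribed curvature -/

section Parameters

variable {lam : ℝ} {μ : Fin 3 → ℝ}

lemma curvature_zero_eq_diag3_iff (h : Admissible 2 lam μ) {x y t : ℝ} :
    curvature 2 lam μ 0 = diag3 x y t ↔ curvatureEigenvalue lam μ 0 = x ∧
      curvatureEigenvalue lam μ 1 = y ∧ curvatureEigenvalue lam μ 2 = t := by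
  rw [curvature_zero h, diag3]
  constructor
  · intro he
    have he' := Matrix.diagonal_injective he
    have h0 := congrFun he' 0
    have h1 := congrFun he' 1
    have h2 := congrFun he' 2
    simp only [Matrix.cons_val] at h0 h1 h2
    exact ⟨by exact_mod_cast h0, by exact_mod_cast h1, by exact_mod_cast h2⟩
  · rintro ⟨rfl, rfl, rfl⟩
    congr 1
    funext i
    fin_cases i <;> rfl

lemma curvatureEigenvalue_zero :
    curvatureEigenvalue lam μ 0 = 2 * lam - 2 - (vecD 2 lam μ 1)⁻¹ := by
  simp only [curvatureEigenvalue, firstCoeff, Matrix.cons_val]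
  ring

lemma curvatureEigenvalue_one :
    curvatureEigenvalue lam μ 1 =
      2 * lam + (vecD 2 lam μ 1)⁻¹ - 4 * vecD 2 lam μ 1 * (vecD 2 lam μ 2)⁻¹ := by
  simp only [curvatureEigenvalue, firstCoeff, Matrix.cons_val]
  ring

lemma curvatureEigenvalue_two :
    curvatureEigenvalue lam μ 2 = 2 * lam + 2 + 4 * vecD 2 lam μ 1 * (vecD 2 lam μ 2)⁻¹ := rfl

/-- The trace of the curvature at the origin determines `lam`. -/
lemma six_mul_lam (lam : ℝ) (μ : Fin 3 → ℝ) :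
    6 * lam = curvatureEigenvalue lam μ 0 + curvatureEigenvalue lam μ 1 +
      curvatureEigenvalue lam μ 2 := by
  rw [curvatureEigenvalue_zero, curvatureEigenvalue_one, curvatureEigenvalue_two]
  ring

/-- The first diagonal entry of the curvature at the origin is smaller than the last one. Applied
to both members of a pair, it separates the entries which the hypotheses do not compare. -/
lemma curvatureEigenvalue_zero_lt_two (h : Admissible 2 lam μ) :
    curvatureEigenvalue lam μ 0 < curvatureEigenvalue lam μ 2 := by
  have h1 := vecD_pos h 1
  have h2 := vecD_pos h 2
  rw [curvatureEigenvalue_zero, curvatureEigenvalue_two]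
  have h3 : 0 < (vecD 2 lam μ 1)⁻¹ := by positivity
  have h4 : 0 < 4 * vecD 2 lam μ 1 * (vecD 2 lam μ 2)⁻¹ := by positivity
  linarith

/-- Parameters with prescribed curvature `diag(x, y, t)` at the origin. The curvature determines
`b = 2 lam`, `1 / d₁ = α` and `4 d₁ / d₂ = β`. The inequalities on `x`, `y`, `t` say that
`0 < α < b - 2` and `0 < β < b`, and these make `μ₁²` and `μ₂²` positive. -/
theorem exists_admissible_of_curvature {x y t : ℝ} (hx : 0 < x) (h1 : 2 * x < y + t - 6)
    (h2 : x + y + 6 < 2 * t) (h3 : t < 2 * (x + y) + 6) :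
    ∃ (lam : ℝ) (μ : Fin 3 → ℝ), Admissible 2 lam μ ∧ curvature 2 lam μ 0 = diag3 x y t := by
  obtain ⟨b, hb⟩ : ∃ b, b = (x + y + t) / 3 := ⟨_, rfl⟩
  obtain ⟨α, hα⟩ : ∃ α, α = b - 2 - x := ⟨_, rfl⟩
  obtain ⟨β, hβ⟩ : ∃ β, β = t - b - 2 := ⟨_, rfl⟩
  have hα0 : 0 < α := by linarith
  have hαb : α < b - 2 := by linarith
  have hβ0 : 0 < β := by linarith
  have hβb : β < b := by linarith
  have hb2 : 0 < b - 2 := by linarith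
  have hb1 : 0 < b - 1 := by linarith
  have hb0 : 0 < b := by linarith
  have hm1 : 0 < 1 / α - 1 / (b - 2) := sub_pos.mpr (one_div_lt_one_div_of_lt hα0 hαb)
  have hm2 : 0 < 4 / (α * β) - 2 / ((b - 2) * (b - 1)) - 4 / b * (1 / α - 1 / (b - 2)) := by
    -- the expression decreases in `β` and is still positive for `β = b`
    have e1 : 4 / (α * b) < 4 / (α * β) :=
      div_lt_div_of_pos_left (by norm_num) (by positivity) (by gcongr)
    have e2 : 4 / (α * b) - 2 / ((b - 2) * (b - 1)) - 4 / b * (1 / α - 1 / (b - 2)) =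
        2 / (b * (b - 1)) := by
      field_simp
      ring
    have e3 : 0 < 2 / (b * (b - 1)) := by positivity
    linarith
  obtain ⟨μ, hμ⟩ : ∃ μ : Fin 3 → ℝ, μ = ![1, √(1 / α - 1 / (b - 2)),
    √(4 / (α * β) - 2 / ((b - 2) * (b - 1)) - 4 / b * (1 / α - 1 / (b - 2)))] := ⟨_, rfl⟩
  have hμ1 : μ 1 ^ 2 = 1 / α - 1 / (b - 2) := by
    rw [hμ]
    exact Real.sq_sqrt hm1.le
  have hμ2 : μ 2 ^ 2 =
      4 / (α * β) - 2 / ((b - 2) * (b - 1)) - 4 / b * (1 / α - 1 / (b - 2)) := by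
    rw [hμ]
    exact Real.sq_sqrt hm2.le
  have hadm : Admissible 2 (b / 2) μ := by
    refine ⟨by push_cast; linarith, by rw [hμ]; rfl, fun l => ?_⟩
    rw [hμ]
    match l with
    | 0 => exact one_pos
    | 1 => exact Real.sqrt_pos.mpr hm1
    | 2 => exact Real.sqrt_pos.mpr hm2
  have hbb : 2 * (b / 2) = b := by ring
  have hd1 : vecD 2 (b / 2) μ 1 = 1 / α := by
    rw [vecD_one hadm, hμ1, hbb]
    ring
  have hd2 : vecD 2 (b / 2) μ 2 = 4 / (α * β) := by
    rw [vecD_two hadm, hμ1, hμ2, hbb]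
    ring
  have hβ' : 4 * (1 / α) * (4 / (α * β))⁻¹ = β := by
    field_simp
  refine ⟨b / 2, μ, hadm, (curvature_zero_eq_diag3_iff hadm).mpr ⟨?_, ?_, ?_⟩⟩
  · rw [curvatureEigenvalue_zero, hd1, one_div, inv_inv]
    linarith
  · rw [curvatureEigenvalue_one, hd1, hd2, hβ', one_div, inv_inv]
    linarith
  · rw [curvatureEigenvalue_two, hd1, hd2, hβ']
    linarith

end Parameters

/-- Two multiplication operators whose curvatures at the origin have the same distinct eigenvalues
are homogeneous and irreducible and have pointwise unitarily equivalent curvatures. They are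
inequivalent if every intertwiner of the reduced kernels is singular. -/
theorem exists_inequivalent_multiplications {lam : ℝ} {μ μ' : Fin 3 → ℝ}
    (h : Admissible 2 lam μ) (h' : Admissible 2 lam μ')
    (hinj : Function.Injective (firstCoeff (vecD 2 lam μ))) (σ : Equiv.Perm (Fin 3))
    (hσ : ∀ j, curvatureEigenvalue lam μ' (σ j) = curvatureEigenvalue lam μ j)
    (hX : ∀ X : Matrix (Fin 3) (Fin 3) ℂ,
      (∀ z w : ℂ, ‖z‖ < 1 → ‖w‖ < 1 →
        X * reducedKernel (vecD 2 lam μ') z w = reducedKernel (vecD 2 lam μ) z w * X) →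
      X.det = 0) :
    ∃ (_ : Fact (kernelOp 2 lam μ).PosSemidef) (_ : Fact (kernelOp 2 lam μ').PosSemidef)
      (M : Space 2 lam μ →L[ℂ] Space 2 lam μ) (M' : Space 2 lam μ' →L[ℂ] Space 2 lam μ'),
      IsMultiplication 2 lam μ M ∧ IsMultiplication 2 lam μ' M' ∧
      IsHomogeneousOperator M ∧ IsHomogeneousOperator M' ∧
      IsIrreducibleOperator M ∧ IsIrreducibleOperator M' ∧
      ¬ UnitarilyEquivalent M M' ∧
      ∀ z : ℂ, ‖z‖ < 1 →
        FibreUnitarilyEquivalent (metric 2 lam μ z) (curvature 2 lam μ z)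
          (metric 2 lam μ' z) (curvature 2 lam μ' z) := by
  have i₁ : Fact (kernelOp 2 lam μ).PosSemidef := ⟨posSemidef_kernelOp h⟩
  have i₂ : Fact (kernelOp 2 lam μ').PosSemidef := ⟨posSemidef_kernelOp h'⟩
  obtain ⟨M, hM⟩ := exists_isMultiplication h
  obtain ⟨M', hM'⟩ := exists_isMultiplication h'
  have hinj' : Function.Injective (firstCoeff (vecD 2 lam μ')) := fun i j hij => by
    have h1 := hσ (σ.symm i)
    have h2 := hσ (σ.symm j)
    rw [σ.apply_symm_apply, curvatureEigenvalue, curvatureEigenvalue] at h1 h2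
    exact σ.symm.injective (hinj (by linarith))
  refine ⟨i₁, i₂, M, M', hM, hM', hM.isHomogeneousOperator, hM'.isHomogeneousOperator,
    hM.isIrreducibleOperator h hinj, hM'.isIrreducibleOperator h' hinj', fun hU => ?_,
    fun z hz => fibreUnitarilyEquivalent_of_perm h h' σ hσ hz⟩
  obtain ⟨X, hXu, hXT⟩ := exists_intertwiner_of_unitarilyEquivalent h h' hM hM' hU
  exact ((Matrix.isUnit_iff_isUnit_det _).mp hXu).ne_zero (hX X hXT)

lemma injective_firstCoeff {lam : ℝ} {μ : Fin 3 → ℝ} {x y t : ℝ}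
    (h0 : curvatureEigenvalue lam μ 0 = x) (h1 : curvatureEigenvalue lam μ 1 = y)
    (h2 : curvatureEigenvalue lam μ 2 = t) (hxy : x ≠ y) (hxt : x ≠ t) (hyt : y ≠ t) :
    Function.Injective (firstCoeff (vecD 2 lam μ)) := by
  have hinj : Function.Injective ![x, y, t] := by
    intro i j hij
    fin_cases i <;> fin_cases j <;> simp_all
  have hc : curvatureEigenvalue lam μ = ![x, y, t] := by
    funext i
    match i with
    | 0 => exact h0
    | 1 => exact h1
    | 2 => exact h2
  intro i j hij
  refine hinj ?_
  rw [← hc, curvatureEigenvalue, curvatureEigenvalue, hij]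

lemma firstCoeff_ne {lam : ℝ} {μ μ' : Fin 3 → ℝ} {i j : Fin 3}
    (h : curvatureEigenvalue lam μ i ≠ curvatureEigenvalue lam μ' j) :
    firstCoeff (vecD 2 lam μ) i ≠ firstCoeff (vecD 2 lam μ') j := fun he => h (by
  rw [curvatureEigenvalue, curvatureEigenvalue, he])

end KoranyiMisra

end

theorem mainTheorem3 (δ₁ δ₂ δ₃ : ℝ) (hδ₁ : 0 < δ₁) (hδ₂ : 0 < δ₂) (hδ₃ : 0 < δ₃) :
    -- (i)
    (δ₁ ≠ δ₂ → δ₃ - 6 < 2 * (δ₁ + δ₂) → max (2 * δ₁ - δ₂) (2 * δ₂ - δ₁) < δ₃ - 6 →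
      (∃ (lam lam' : ℝ) (μ μ' : Fin 3 → ℝ),
        KoranyiMisra.Admissible 2 lam μ ∧ KoranyiMisra.Admissible 2 lam' μ' ∧
        KoranyiMisra.curvature 2 lam μ 0 = KoranyiMisra.diag3 δ₁ δ₂ δ₃ ∧
        KoranyiMisra.curvature 2 lam' μ' 0 = KoranyiMisra.diag3 δ₂ δ₁ δ₃) ∧
      ∀ (lam lam' : ℝ) (μ μ' : Fin 3 → ℝ),
        KoranyiMisra.Admissible 2 lam μ → KoranyiMisra.Admissible 2 lam' μ' →
        KoranyiMisra.curvature 2 lam μ 0 = KoranyiMisra.diag3 δ₁ δ₂ δ₃ →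
        KoranyiMisra.curvature 2 lam' μ' 0 = KoranyiMisra.diag3 δ₂ δ₁ δ₃ →
        ∃ (_ : Fact (KoranyiMisra.kernelOp 2 lam μ).PosSemidef)
          (_ : Fact (KoranyiMisra.kernelOp 2 lam' μ').PosSemidef)
          (M : KoranyiMisra.Space 2 lam μ →L[ℂ] KoranyiMisra.Space 2 lam μ)
          (M' : KoranyiMisra.Space 2 lam' μ' →L[ℂ] KoranyiMisra.Space 2 lam' μ'),
          KoranyiMisra.IsMultiplication 2 lam μ M ∧ KoranyiMisra.IsMultiplication 2 lam' μ' M' ∧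
          KoranyiMisra.IsHomogeneousOperator M ∧ KoranyiMisra.IsHomogeneousOperator M' ∧
          KoranyiMisra.IsIrreducibleOperator M ∧ KoranyiMisra.IsIrreducibleOperator M' ∧
          ¬ KoranyiMisra.UnitarilyEquivalent M M' ∧
          ∀ z : ℂ, ‖z‖ < 1 →
            KoranyiMisra.FibreUnitarilyEquivalent
              (KoranyiMisra.metric 2 lam μ z) (KoranyiMisra.curvature 2 lam μ z)
              (KoranyiMisra.metric 2 lam' μ' z) (KoranyiMisra.curvature 2 lam' μ' z)) ∧
    -- (ii)
    (δ₂ < δ₃ → 3 + δ₃ / 2 < δ₂ → δ₁ < min (2 * δ₃ - δ₂) (2 * δ₂ - δ₃) - 6 →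
      (∃ (lam lam' : ℝ) (μ μ' : Fin 3 → ℝ),
        KoranyiMisra.Admissible 2 lam μ ∧ KoranyiMisra.Admissible 2 lam' μ' ∧
        KoranyiMisra.curvature 2 lam μ 0 = KoranyiMisra.diag3 δ₁ δ₂ δ₃ ∧
        KoranyiMisra.curvature 2 lam' μ' 0 = KoranyiMisra.diag3 δ₁ δ₃ δ₂) ∧
      ∀ (lam lam' : ℝ) (μ μ' : Fin 3 → ℝ),
        KoranyiMisra.Admissible 2 lam μ → KoranyiMisra.Admissible 2 lam' μ' →
        KoranyiMisra.curvature 2 lam μ 0 = KoranyiMisra.diag3 δ₁ δ₂ δ₃ →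
        KoranyiMisra.curvature 2 lam' μ' 0 = KoranyiMisra.diag3 δ₁ δ₃ δ₂ →
        ∃ (_ : Fact (KoranyiMisra.kernelOp 2 lam μ).PosSemidef)
          (_ : Fact (KoranyiMisra.kernelOp 2 lam' μ').PosSemidef)
          (M : KoranyiMisra.Space 2 lam μ →L[ℂ] KoranyiMisra.Space 2 lam μ)
          (M' : KoranyiMisra.Space 2 lam' μ' →L[ℂ] KoranyiMisra.Space 2 lam' μ'),
          KoranyiMisra.IsMultiplication 2 lam μ M ∧ KoranyiMisra.IsMultiplication 2 lam' μ' M' ∧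
          KoranyiMisra.IsHomogeneousOperator M ∧ KoranyiMisra.IsHomogeneousOperator M' ∧
          KoranyiMisra.IsIrreducibleOperator M ∧ KoranyiMisra.IsIrreducibleOperator M' ∧
          ¬ KoranyiMisra.UnitarilyEquivalent M M' ∧
          ∀ z : ℂ, ‖z‖ < 1 →
            KoranyiMisra.FibreUnitarilyEquivalent
              (KoranyiMisra.metric 2 lam μ z) (KoranyiMisra.curvature 2 lam μ z)
              (KoranyiMisra.metric 2 lam' μ' z) (KoranyiMisra.curvature 2 lam' μ' z)) := by
  refine ⟨fun hne h1 h2 => ⟨?_, ?_⟩, fun h1 h2 h3 => ⟨?_, ?_⟩⟩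
  · obtain ⟨h3, h4⟩ := max_lt_iff.mp h2
    obtain ⟨lam, μ, h, hc⟩ := KoranyiMisra.exists_admissible_of_curvature (x := δ₁) (y := δ₂)
      (t := δ₃) hδ₁ (by linarith) (by linarith) (by linarith)
    obtain ⟨lam', μ', h', hc'⟩ := KoranyiMisra.exists_admissible_of_curvature (x := δ₂) (y := δ₁)
      (t := δ₃) hδ₂ (by linarith) (by linarith) (by linarith)
    exact ⟨lam, lam', μ, μ', h, h', hc, hc'⟩
  · intro lam lam' μ μ' h h' hc hc'
    obtain ⟨c0, c1, c2⟩ := (KoranyiMisra.curvature_zero_eq_diag3_iff h).mp hc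
    obtain ⟨c0', c1', c2'⟩ := (KoranyiMisra.curvature_zero_eq_diag3_iff h').mp hc'
    have hl : lam' = lam := by
      have e := KoranyiMisra.six_mul_lam lam μ
      have e' := KoranyiMisra.six_mul_lam lam' μ'
      rw [c0, c1, c2] at e
      rw [c0', c1', c2'] at e'
      linarith
    subst hl
    have h13 : δ₁ < δ₃ := by
      rw [← c0, ← c2]
      exact KoranyiMisra.curvatureEigenvalue_zero_lt_two h
    have h23 : δ₂ < δ₃ := by
      rw [← c0', ← c2']
      exact KoranyiMisra.curvatureEigenvalue_zero_lt_two h'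
    refine KoranyiMisra.exists_inequivalent_multiplications h h'
      (KoranyiMisra.injective_firstCoeff c0 c1 c2 hne h13.ne h23.ne) (Equiv.swap 0 1)
      (fun j => ?_) fun X hX => ?_
    · match j with
      | 0 => exact c1'.trans c0.symm
      | 1 => exact c0'.trans c1.symm
      | 2 => exact c2'.trans c2.symm
    -- the last row of `X` vanishes
    have hz := fun {i j} => KoranyiMisra.apply_eq_zero_of_firstCoeff_ne (i := i) (j := j)
      (KoranyiMisra.vecD_pos h') (KoranyiMisra.vecD_zero h') (KoranyiMisra.vecD_pos h)
      (KoranyiMisra.vecD_zero h) hX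
    have hX00 : X 0 0 = 0 := hz (KoranyiMisra.firstCoeff_ne (by rw [c0', c0]; exact hne.symm))
    have hX20 : X 2 0 = 0 := hz (KoranyiMisra.firstCoeff_ne (by rw [c0', c2]; exact h23.ne))
    have hX21 : X 2 1 = 0 := hz (KoranyiMisra.firstCoeff_ne (by rw [c1', c2]; exact h13.ne))
    have hX22 := (KoranyiMisra.apply_zero_zero_eq_zero_iff (KoranyiMisra.vecD_pos h')
      (KoranyiMisra.vecD_zero h') (KoranyiMisra.vecD_pos h) (KoranyiMisra.vecD_zero h) hX).mp hX00
    rw [Matrix.det_fin_three, hX20, hX21, hX22]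
    ring
  · obtain ⟨h4, h5⟩ := lt_min_iff.mp (lt_sub_iff_add_lt.mp h3)
    obtain ⟨lam, μ, h, hc⟩ := KoranyiMisra.exists_admissible_of_curvature (x := δ₁) (y := δ₂)
      (t := δ₃) hδ₁ (by linarith) (by linarith) (by linarith)
    obtain ⟨lam', μ', h', hc'⟩ := KoranyiMisra.exists_admissible_of_curvature (x := δ₁) (y := δ₃)
      (t := δ₂) hδ₁ (by linarith) (by linarith) (by linarith)
    exact ⟨lam, lam', μ, μ', h, h', hc, hc'⟩
  · intro lam lam' μ μ' h h' hc hc'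
    obtain ⟨c0, c1, c2⟩ := (KoranyiMisra.curvature_zero_eq_diag3_iff h).mp hc
    obtain ⟨c0', c1', c2'⟩ := (KoranyiMisra.curvature_zero_eq_diag3_iff h').mp hc'
    have hl : lam' = lam := by
      have e := KoranyiMisra.six_mul_lam lam μ
      have e' := KoranyiMisra.six_mul_lam lam' μ'
      rw [c0, c1, c2] at e
      rw [c0', c1', c2'] at e'
      linarith
    subst hl
    have h13 : δ₁ < δ₃ := by
      rw [← c0, ← c2]
      exact KoranyiMisra.curvatureEigenvalue_zero_lt_two h
    have h12 : δ₁ < δ₂ := by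
      rw [← c0', ← c2']
      exact KoranyiMisra.curvatureEigenvalue_zero_lt_two h'
    refine KoranyiMisra.exists_inequivalent_multiplications h h'
      (KoranyiMisra.injective_firstCoeff c0 c1 c2 h12.ne h13.ne h1.ne) (Equiv.swap 1 2)
      (fun j => ?_) fun X hX => ?_
    · match j with
      | 0 => exact c0'.trans c0.symm
      | 1 => exact c2'.trans c1.symm
      | 2 => exact c1'.trans c2.symm
    -- the first row of `X` vanishes
    have hz := fun {i j} => KoranyiMisra.apply_eq_zero_of_firstCoeff_ne (i := i) (j := j)
      (KoranyiMisra.vecD_pos h') (KoranyiMisra.vecD_zero h') (KoranyiMisra.vecD_pos h)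
      (KoranyiMisra.vecD_zero h) hX
    have hX22 : X 2 2 = 0 := hz (KoranyiMisra.firstCoeff_ne (by rw [c2', c2]; exact h1.ne))
    have hX01 : X 0 1 = 0 := hz (KoranyiMisra.firstCoeff_ne (by rw [c1', c0]; exact h13.ne'))
    have hX02 : X 0 2 = 0 := hz (KoranyiMisra.firstCoeff_ne (by rw [c2', c0]; exact h12.ne'))
    have hX00 := (KoranyiMisra.apply_zero_zero_eq_zero_iff (KoranyiMisra.vecD_pos h')
      (KoranyiMisra.vecD_zero h') (KoranyiMisra.vecD_pos h) (KoranyiMisra.vecD_zero h) hX).mpr hX22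
    rw [Matrix.det_fin_three, hX00, hX01, hX02]
    ring
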